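/- Let $X$ be a compact complex manifold which is homogeneous (its group of biholomorphisms acts transitively), and let $L$ be a very ample holomorphic line bundle on $X$ (the complete linear system of $L$ has no base points and embeds $X$ in projective space). Put $V = H^0(X,L)$, let $N = J^1L$ be the bundle of 1-jets of $L$, and let $\mathfrak g = H^0(X, L\otimes N^*)$ be the space of holomorphic linear differential operators of order at most one from $L$ to $L$; it acts on $V$ faithfully and is regarded as a Lie subalgebra of $\mathfrak{gl}(V) = V\otimes V^*$. Define the prolongations by $\mathfrak g^{(-1)} = V$, $\mathfrak g^{(0)} = \mathfrak g$ and $\mathfrak g^{(k)} = [\mathfrak g^{(k-1)}\otimes V^*]\cap[V\otimes\odot^{k+1}V^*]$ for $k\ge 1$. Let $\partial:\mathfrak g^{(k)}\otimes\Lambda^{l-1}V^*\to\mathfrak g^{(k-1)}\otimes\Lambda^{l}V^*$ be antisymmetrisation over the last $l$ indices, and for $k\ge 1$ let $$H^{k,2}(\mathfrak g) = \frac{\operatorname{Ker}\bigl(\partial:\mathfrak g^{(k-1)}\otimes\Lambda^2V^*\to\mathfrak g^{(k-2)}\otimes\Lambda^3V^*\bigr)}{\operatorname{Im}\bigl(\partial:\mathfrak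 g^{(k)}\otimes V^*\to\mathfrak g^{(k-1)}\otimes\Lambda^2V^*\bigr)}$$ be the Spencer cohomology group. The algebra $\mathfrak g$ acts on the spaces $\mathfrak g^{(k)}$ and $H^{k,2}(\mathfrak g)$ as on tensors over $V$, and on the sheaves $L\otimes\odot^mN^*$ and their cohomology by Lie derivative. Then $V$ is finite-dimensional, and: 1. For every $k = 0,1,2,\dots$ the natural map $H^0(X,L\otimes\odot^{k+1}N^*)\to V\otimes\odot^{k+1}V^*$, which sends $\varphi$ to the symmetric multilinear map $(s_1,\dots,s_{k+1})\mapsto\varphi(j^1s_1,\dots,j^1s_{k+1})$, is an isomorphism of $\mathfrak g$-modules onto $\mathfrak g^{(k)}$: $$\mathfrak g^{(k)} = H^0(X,L\otimes\odot^{k+1}N^*).$$ 2. For every $k = 1,2,\dots$ there is an exact sequence of $\mathfrak g$-modules $$0\longrightarrow H^{k,2}(\mathfrak g)\longrightarrow H^1(X,L\otimes\odot^{k+2}N^*)\longrightarrow H^1(X,L\otimes\odot^{k+1}N^*)\otimes V^*,$$ in which the last map is induced by contraction with the 1-jets of the elements of $V$, that is, by the inclusion $N^*\hookrightarrow V^*\otimes\mathcal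 O_X$ dual to $V\otimes\mathcal O_X\to J^1L$. -/

import Mathlib

noncomputable section

namespace Spencer

attribute [local instance] LieRing.ofAssociativeRing

variable {V W : Type*} [AddCommGroup V] [Module ℂ V] [AddCommGroup W] [Module ℂ W]

/-- `V ⊗ (V*)^{⊗ m}`, as multilinear maps. -/
abbrev Tensor (V : Type*) [AddCommGroup V] [Module ℂ V] (m : ℕ) : Type _ :=
  MultilinearMap ℂ (fun _ : Fin m => V) V

/-- `f ↦ ∑ᵢ f (…, A vᵢ, …)`. -/
def insertSum {m : ℕ} (A : Module.End ℂ V) :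
    MultilinearMap ℂ (fun _ : Fin m => V) W →ₗ[ℂ] MultilinearMap ℂ (fun _ : Fin m => V) W where
  toFun f := ∑ i, f.compLinearMap (Function.update (fun _ => LinearMap.id) i A)
  map_add' f g := by
    ext v; simp [Finset.sum_add_distrib]
  map_smul' c f := by
    ext v; simp [Finset.smul_sum]

lemma insertSum_apply {m : ℕ} (A : Module.End ℂ V)
    (f : MultilinearMap ℂ (fun _ : Fin m => V) W) (v : Fin m → V) :
    insertSum A f v = ∑ i, f (Function.update v i (A (v i))) := by
  simp only [insertSum, LinearMap.coe_mk, AddHom.coe_mk, sum_apply,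
    MultilinearMap.compLinearMap_apply]
  refine Finset.sum_congr rfl fun i _ => congrArg f ?_
  ext j
  by_cases h : j = i
  · subst h; simp
  · simp [h]

/-- The natural action of `A ∈ gl(V)` on `V ⊗ (V*)^{⊗ m}`. -/
def tensorAct {m : ℕ} (A : Module.End ℂ V) : Tensor V m →ₗ[ℂ] Tensor V m where
  toFun T := A.compMultilinearMap T - insertSum A T
  map_add' S T := by ext v; simp; abel
  map_smul' c T := by ext v; simp [smul_sub]

lemma tensorAct_apply {m : ℕ} (A : Module.End ℂ V) (T : Tensor V m) (v : Fin m → V) :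
    tensorAct A T v = A (T v) - ∑ i, T (Function.update v i (A (v i))) := by
  simp [tensorAct, insertSum_apply]

/-- The contraction of a vector with the first argument of a tensor. -/
def tensorContract (m : ℕ) : V →ₗ[ℂ] Tensor V (m + 1) →ₗ[ℂ] Tensor V m :=
  LinearMap.mk₂ ℂ (fun v T => T.curryLeft v)
    (fun v w T => by ext; simp) (fun c v T => by ext; simp)
    (fun v S T => by ext; simp) (fun c v T => by ext; simp)

lemma tensorContract_apply {m : ℕ} (v : V) (T : Tensor V (m + 1)) (w : Fin m → V) :
    tensorContract m v T w = T (Fin.cons v w) := rfl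

/-- `prolong 𝔤 m` is the prolongation `𝔤^{(m-1)} ⊆ V ⊗ ⊙^m V*`: it is `V` for `m = 0`, `𝔤` for
`m = 1`, and for larger `m` it consists of the symmetric tensors all of whose contractions with
vectors of `V` in one argument lie in `prolong 𝔤 (m-1)`. -/
def prolong (𝔤 : LieSubalgebra ℂ (Module.End ℂ V)) : (m : ℕ) → Submodule ℂ (Tensor V m)
  | 0 => ⊤
  | 1 => 𝔤.toSubmodule.map
      (MultilinearMap.ofSubsingletonₗ ℂ ℂ V V (0 : Fin 1)).toLinearMap
  | m + 2 =>
    { carrier := {T | (∀ (σ : Equiv.Perm (Fin (m + 2))) (v : Fin (m + 2) → V), T (v ∘ σ) = T v) ∧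
        ∀ v, tensorContract _ v T ∈ prolong 𝔤 (m + 1)}
      add_mem' := fun {S T} hS hT => ⟨fun σ v => by simp [hS.1, hT.1],
        fun v => by rw [map_add]; exact add_mem (hS.2 v) (hT.2 v)⟩
      zero_mem' := ⟨fun σ v => by simp, fun v => by rw [map_zero]; exact zero_mem _⟩
      smul_mem' := fun c T hT => ⟨fun σ v => by simp [hT.1],
        fun v => by rw [map_smul]; exact Submodule.smul_mem _ c (hT.2 v)⟩ }

lemma tensorContract_mem (𝔤 : LieSubalgebra ℂ (Module.End ℂ V)) {m : ℕ} {T : Tensor V (m + 1)}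
    (hT : T ∈ prolong 𝔤 (m + 1)) (v : V) : tensorContract _ v T ∈ prolong 𝔤 m := by
  cases m with
  | zero => exact Submodule.mem_top
  | succ m => exact hT.2 v

lemma tensorContract_tensorAct {m : ℕ} (A : Module.End ℂ V) (T : Tensor V (m + 1)) (v : V) :
    tensorContract m v (tensorAct A T) =
      tensorAct A (tensorContract m v T) - tensorContract m (A v) T := by
  ext w
  simp [tensorAct_apply, tensorContract_apply, Fin.sum_univ_succ, Fin.cons_update]
  abel

lemma tensorAct_mem (𝔤 : LieSubalgebra ℂ (Module.End ℂ V)) {A : Module.End ℂ V} (hA : A ∈ 𝔤) :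
    ∀ {m : ℕ} {T : Tensor V m}, T ∈ prolong 𝔤 m → tensorAct A T ∈ prolong 𝔤 m
  | 0, _, _ => Submodule.mem_top
  | 1, T, hT => by
    obtain ⟨B, hB, rfl⟩ := hT
    refine ⟨⁅A, B⁆, 𝔤.lie_mem hA hB, ?_⟩
    ext v
    simp [tensorAct_apply, LieRing.of_associative_ring_bracket]
  | m + 2, T, hT => by
    refine ⟨fun σ v => ?_, fun v => ?_⟩
    · simp only [tensorAct_apply, hT.1]
      congr 1
      refine Fintype.sum_equiv σ _ _ fun i => ?_
      rw [← hT.1 σ (Function.update v (σ i) (A (v (σ i))))]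
      congr 1
      ext j
      simp [Function.update_apply]
    · rw [tensorContract_tensorAct]
      exact sub_mem (tensorAct_mem 𝔤 hA (hT.2 v)) (hT.2 (A v))

/-- The prolongation `𝔤^{(m-1)}`, as a vector space. -/
def Prolongation (𝔤 : LieSubalgebra ℂ (Module.End ℂ V)) (m : ℕ) : Type _ := prolong 𝔤 m

instance (𝔤 : LieSubalgebra ℂ (Module.End ℂ V)) (m : ℕ) : AddCommGroup (Prolongation 𝔤 m) :=
  inferInstanceAs (AddCommGroup (prolong 𝔤 m))

instance (𝔤 : LieSubalgebra ℂ (Module.End ℂ V)) (m : ℕ) : Module ℂ (Prolongation 𝔤 m) :=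
  inferInstanceAs (Module ℂ (prolong 𝔤 m))

/-- The action of `A ∈ 𝔤` on `𝔤^{(m-1)}`. -/
def prolongAct (𝔤 : LieSubalgebra ℂ (Module.End ℂ V)) (m : ℕ) (A : 𝔤) :
    Prolongation 𝔤 m →ₗ[ℂ] Prolongation 𝔤 m :=
  (tensorAct (A : Module.End ℂ V)).restrict (p := prolong 𝔤 m) (q := prolong 𝔤 m)
    fun _ hT => tensorAct_mem 𝔤 A.2 hT

/-- The contraction of a vector with the first argument of an element of `𝔤^{(m)}`; this is the
inclusion of `𝔤^{(m)}` in `𝔤^{(m-1)} ⊗ V* = Hom(V, 𝔤^{(m-1)})`. -/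
def contract (𝔤 : LieSubalgebra ℂ (Module.End ℂ V)) (m : ℕ) :
    V →ₗ[ℂ] Prolongation 𝔤 (m + 1) →ₗ[ℂ] Prolongation 𝔤 m :=
  LinearMap.mk₂ ℂ (fun v T => ⟨tensorContract m v T.1, tensorContract_mem 𝔤 T.2 v⟩)
    (fun v w T => Subtype.ext (LinearMap.congr_fun ((tensorContract m).map_add v w) T.1))
    (fun c v T => Subtype.ext (LinearMap.congr_fun ((tensorContract m).map_smul c v) T.1))
    (fun v S T => Subtype.ext ((tensorContract m v).map_add S.1 T.1))
    (fun c v T => Subtype.ext ((tensorContract m v).map_smul c T.1))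

/-- The space `𝔤^{(m-1)} ⊗ Λ^l V*` of alternating `𝔤^{(m-1)}`-valued forms on `V`. -/
abbrev Cochain (𝔤 : LieSubalgebra ℂ (Module.End ℂ V)) (m l : ℕ) : Type _ :=
  V [⋀^Fin l]→ₗ[ℂ] Prolongation 𝔤 m

/-- The Spencer differential `∂ : 𝔤^{(m)} ⊗ Λ^l V* → 𝔤^{(m-1)} ⊗ Λ^{l+1} V*`,
`(∂ω)(v₀, …, v_l) = ∑ᵢ (-1)^i ω(v₀, …, v̂ᵢ, …, v_l)(vᵢ, …)`. -/
def differential (𝔤 : LieSubalgebra ℂ (Module.End ℂ V)) (m l : ℕ) :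
    Cochain 𝔤 (m + 1) l →ₗ[ℂ] Cochain 𝔤 m (l + 1) where
  toFun ω := AlternatingMap.alternatizeUncurryFin
    { toFun := fun v => (contract 𝔤 m v).compAlternatingMap ω
      map_add' := fun v w => by ext; simp
      map_smul' := fun c v => by ext; simp }
  map_add' ω η := by
    ext v : 1
    simp [AlternatingMap.alternatizeUncurryFin_apply, Finset.sum_add_distrib]
  map_smul' c ω := by
    ext v : 1
    simp only [AlternatingMap.alternatizeUncurryFin_apply, RingHom.id_apply,
      AlternatingMap.smul_apply, Finset.smul_sum]
    refine Finset.sum_congr rfl fun i _ => ?_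
    rw [smul_comm]
    simp

lemma differential_apply (𝔤 : LieSubalgebra ℂ (Module.End ℂ V)) (m l : ℕ)
    (ω : Cochain 𝔤 (m + 1) l) (v : Fin (l + 1) → V) :
    differential 𝔤 m l ω v =
      ∑ i : Fin (l + 1), (-1) ^ (i : ℕ) • contract 𝔤 m (v i) (ω (Fin.removeNth i v)) := by
  simp [differential, AlternatingMap.alternatizeUncurryFin_apply]

/-- `ω ↦ ∑ᵢ ω (…, A vᵢ, …)` on alternating forms. -/
def altInsertSum {l : ℕ} (A : Module.End ℂ V) (ω : V [⋀^Fin l]→ₗ[ℂ] W) : V [⋀^Fin l]→ₗ[ℂ] W where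
  toMultilinearMap := insertSum A ω.toMultilinearMap
  map_eq_zero_of_eq' v i j hv hij := by
    change insertSum A ω.toMultilinearMap v = 0
    rw [insertSum_apply, Fintype.sum_eq_add i j hij]
    · have h := ω.map_swap (Function.update v i (A (v i))) hij
      have h2 : Function.update v i (A (v i)) ∘ Equiv.swap i j =
          Function.update v j (A (v j)) := by
        ext k
        simp only [Function.comp_apply, Function.update_apply]
        rcases eq_or_ne k i with rfl | hk
        · simp [hij, hij.symm, hv]
        · rcases eq_or_ne k j with rfl | hk'
          · simp [hv]
          · simp [Equiv.swap_apply_of_ne_of_ne hk hk', hk, hk']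
      rw [h2] at h
      change ω _ + ω _ = 0
      rw [h]; abel
    · rintro k ⟨hki, hkj⟩
      exact ω.map_eq_zero_of_eq _ (i := i) (j := j)
        (by simp [hki.symm, hkj.symm, hv]) hij

lemma altInsertSum_apply {l : ℕ} (A : Module.End ℂ V) (ω : V [⋀^Fin l]→ₗ[ℂ] W) (v : Fin l → V) :
    altInsertSum A ω v = ∑ i, ω (Function.update v i (A (v i))) :=
  insertSum_apply A ω.toMultilinearMap v

/-- The natural action of `A ∈ 𝔤` on `𝔤^{(m-1)} ⊗ Λ^l V*`. -/
def cochainAct (𝔤 : LieSubalgebra ℂ (Module.End ℂ V)) (m l : ℕ) (A : 𝔤) :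
    Cochain 𝔤 m l →ₗ[ℂ] Cochain 𝔤 m l where
  toFun ω := (prolongAct 𝔤 m A).compAlternatingMap ω - altInsertSum (A : Module.End ℂ V) ω
  map_add' ω η := by
    ext v : 1
    simp only [AlternatingMap.sub_apply, AlternatingMap.add_apply, altInsertSum_apply,
      LinearMap.compAlternatingMap_apply, map_add, Finset.sum_add_distrib]
    abel
  map_smul' c ω := by
    ext v : 1
    simp only [AlternatingMap.sub_apply, AlternatingMap.smul_apply, altInsertSum_apply,
      LinearMap.compAlternatingMap_apply, map_smul, smul_sub, Finset.smul_sum, RingHom.id_apply]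

lemma cochainAct_apply (𝔤 : LieSubalgebra ℂ (Module.End ℂ V)) (m l : ℕ) (A : 𝔤)
    (ω : Cochain 𝔤 m l) (v : Fin l → V) :
    cochainAct 𝔤 m l A ω v = prolongAct 𝔤 m A (ω v) -
      ∑ i, ω (Function.update v i ((A : Module.End ℂ V) (v i))) := by
  simp [cochainAct, altInsertSum_apply]

lemma contract_prolongAct (𝔤 : LieSubalgebra ℂ (Module.End ℂ V)) (m : ℕ) (A : 𝔤) (v : V)
    (T : Prolongation 𝔤 (m + 1)) :
    contract 𝔤 m v (prolongAct 𝔤 (m + 1) A T) =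
      prolongAct 𝔤 m A (contract 𝔤 m v T) - contract 𝔤 m ((A : Module.End ℂ V) v) T :=
  Subtype.ext (tensorContract_tensorAct _ _ _)

lemma differential_cochainAct (𝔤 : LieSubalgebra ℂ (Module.End ℂ V)) (m l : ℕ) (A : 𝔤)
    (ω : Cochain 𝔤 (m + 1) l) :
    differential 𝔤 m l (cochainAct 𝔤 (m + 1) l A ω) =
      cochainAct 𝔤 m (l + 1) A (differential 𝔤 m l ω) := by
  ext v : 1
  simp only [differential_apply, cochainAct_apply, map_sub, contract_prolongAct, map_sum,
    map_zsmul, smul_sub, Finset.sum_sub_distrib]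
  rw [sub_sub]
  have hsw : (∑ i : Fin (l + 1), ∑ j : Fin (l + 1), (-1 : ℤ) ^ (j : ℕ) •
        contract 𝔤 m (Function.update v i ((A : Module.End ℂ V) (v i)) j)
          (ω (Fin.removeNth j (Function.update v i ((A : Module.End ℂ V) (v i)))))) =
      (∑ j : Fin (l + 1), (-1 : ℤ) ^ (j : ℕ) •
        contract 𝔤 m ((A : Module.End ℂ V) (v j)) (ω (Fin.removeNth j v))) +
      ∑ j : Fin (l + 1), (-1 : ℤ) ^ (j : ℕ) • ∑ i : Fin l, contract 𝔤 m (v j)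
        (ω (Function.update (Fin.removeNth j v) i ((A : Module.End ℂ V) (Fin.removeNth j v i)))) := by
    rw [Finset.sum_comm, ← Finset.sum_add_distrib]
    refine Finset.sum_congr rfl fun j _ => ?_
    rw [Fin.sum_univ_succAbove _ j, Finset.smul_sum]
    congr 1
    · simp
    · refine Finset.sum_congr rfl fun i _ => ?_
      have h1 : Function.update v (j.succAbove i) ((A : Module.End ℂ V) (v (j.succAbove i))) j
          = v j := by simp
      have h2 : Fin.removeNth j
          (Function.update v (j.succAbove i) ((A : Module.End ℂ V) (v (j.succAbove i)))) =
          Function.update (Fin.removeNth j v) i ((A : Module.End ℂ V) (Fin.removeNth j v i)) := by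
        ext k
        simp [Fin.removeNth, Function.update_apply]
      rw [h1, h2]
  rw [hsw]

/-- The cocycles in `𝔤^{(k)} ⊗ Λ^{l+1} V*`. -/
abbrev cocycles (𝔤 : LieSubalgebra ℂ (Module.End ℂ V)) (k l : ℕ) :
    Submodule ℂ (Cochain 𝔤 (k + 1) (l + 1)) :=
  LinearMap.ker (differential 𝔤 k (l + 1))

/-- The coboundaries, as a subspace of the space of cocycles. -/
abbrev coboundaries (𝔤 : LieSubalgebra ℂ (Module.End ℂ V)) (k l : ℕ) :
    Submodule ℂ (cocycles 𝔤 k l) :=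
  (LinearMap.range (differential 𝔤 (k + 1) l)).comap (cocycles 𝔤 k l).subtype

/-- The Spencer cohomology group `H^{k+1,l+1}(𝔤)`, the cohomology of
`𝔤^{(k+1)} ⊗ Λ^l V* → 𝔤^{(k)} ⊗ Λ^{l+1} V* → 𝔤^{(k-1)} ⊗ Λ^{l+2} V*`. -/
abbrev Cohomology (𝔤 : LieSubalgebra ℂ (Module.End ℂ V)) (k l : ℕ) : Type _ :=
  cocycles 𝔤 k l ⧸ coboundaries 𝔤 k l

/-- The action of `A ∈ 𝔤` on the cocycles. -/
def cocycleAct (𝔤 : LieSubalgebra ℂ (Module.End ℂ V)) (k l : ℕ) (A : 𝔤) :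
    cocycles 𝔤 k l →ₗ[ℂ] cocycles 𝔤 k l :=
  (cochainAct 𝔤 (k + 1) (l + 1) A).restrict fun ω hω => by
    rw [LinearMap.mem_ker] at hω ⊢
    rw [differential_cochainAct, hω, map_zero]

/-- The action of `A ∈ 𝔤` on the Spencer cohomology group `H^{k+1,l+1}(𝔤)`. -/
def cohomologyAct (𝔤 : LieSubalgebra ℂ (Module.End ℂ V)) (k l : ℕ) (A : 𝔤) :
    Cohomology 𝔤 k l →ₗ[ℂ] Cohomology 𝔤 k l :=
  Submodule.mapQ _ _ (cocycleAct 𝔤 k l A) fun ω hω => by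
    obtain ⟨η, hη⟩ := hω
    exact ⟨cochainAct 𝔤 (k + 1 + 1) l A η, by rw [differential_cochainAct, hη]; rfl⟩

end Spencer
end

noncomputable section

namespace JetSpencer

open Bundle Topology TopologicalSpace CategoryTheory
open scoped Manifold ContDiff

attribute [local instance] LieRing.ofAssociativeRing

universe u

section Jets

variable (E : Type*) [NormedAddCommGroup E] [NormedSpace ℂ E]
  {X : Type u} [TopologicalSpace X] [ChartedSpace E X]

/-- A function is holomorphic at (hence near) the point `x`. -/
def HolFunAt (f : X → ℂ) (x : X) : Prop :=
  ContMDiffAt 𝓘(ℂ, E) 𝓘(ℂ, ℂ) ω f x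

variable (L : X → Type u) [∀ x, AddCommGroup (L x)] [∀ x, Module ℂ (L x)]
  [∀ x, TopologicalSpace (L x)] [TopologicalSpace (TotalSpace ℂ L)] [FiberBundle ℂ L]

/-- A section of `L` is holomorphic at (hence near) the point `x`. -/
def HolAt (s : ∀ y, L y) (x : X) : Prop :=
  ContMDiffAt 𝓘(ℂ, E) (𝓘(ℂ, E).prod 𝓘(ℂ, ℂ)) ω (fun y => TotalSpace.mk' ℂ y (s y)) x

variable [VectorBundle ℂ ℂ L]

/-- The sections of `L` that are holomorphic near `x`. -/
def holSections (x : X) : Submodule ℂ (∀ y, L y) where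
  carrier := {s | HolAt E L s x}
  add_mem' hs ht := ContMDiffAt.add_section hs ht
  zero_mem' := (contMDiff_zeroSection ℂ L).contMDiffAt
  smul_mem' _ _ hs := ContMDiffAt.const_smul_section hs

/-- The sections in `𝔪ₓ² · L`, where `𝔪ₓ` is the ideal of functions vanishing at `x`. -/
def vanishTwice (x : X) : Submodule ℂ (holSections E L x) :=
  Submodule.span ℂ {t | ∃ (f g : X → ℂ) (s : ∀ y, L y), HolFunAt E f x ∧ HolFunAt E g x ∧
    HolAt E L s x ∧ f x = 0 ∧ g x = 0 ∧ (t : ∀ y, L y) = fun y => (f y * g y) • s y}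

/-- The fibre at `x` of the bundle `N = J¹L` of 1-jets: the quotient of the local holomorphic
sections near `x` by those in `𝔪ₓ² · L`. (A section which vanishes near `x` belongs to `𝔪ₓ² · L`,
so it does not matter that sections are used here in place of their germs.) -/
abbrev Jet (x : X) : Type u := holSections E L x ⧸ vanishTwice E L x

open Classical in
/-- The 1-jet at `x` of a section that is holomorphic near `x`. -/
def jet (x : X) (s : ∀ y, L y) : Jet E L x :=
  if h : HolAt E L s x then Submodule.Quotient.mk ⟨s, h⟩ else 0

variable {E L}

lemma jet_of_hol {x : X} {s : ∀ y, L y} (h : HolAt E L s x) :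
    jet E L x s = (vanishTwice E L x).mkQ ⟨s, h⟩ := by
  simp [jet, h]

lemma jet_coe {x : X} (s : holSections E L x) : jet E L x s = (vanishTwice E L x).mkQ s :=
  jet_of_hol s.2

lemma exists_jet_eq {x : X} (q : Jet E L x) : ∃ s, HolAt E L s x ∧ jet E L x s = q := by
  obtain ⟨s, rfl⟩ := Submodule.mkQ_surjective _ q
  exact ⟨s, s.2, jet_coe s⟩

lemma HolAt.congr {x : X} {s t : ∀ y, L y} (hs : HolAt E L s x) (h : ∀ᶠ y in 𝓝 x, t y = s y) :
    HolAt E L t x :=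
  ContMDiffAt.congr_of_eventuallyEq hs (h.mono fun y hy => by simp [hy])

lemma HolAt.add {x : X} {s t : ∀ y, L y} (hs : HolAt E L s x) (ht : HolAt E L t x) :
    HolAt E L (s + t) x := ContMDiffAt.add_section hs ht

lemma HolAt.sub {x : X} {s t : ∀ y, L y} (hs : HolAt E L s x) (ht : HolAt E L t x) :
    HolAt E L (s - t) x := ContMDiffAt.sub_section hs ht

lemma HolAt.const_smul {x : X} {s : ∀ y, L y} (hs : HolAt E L s x) (c : ℂ) :
    HolAt E L (c • s) x := ContMDiffAt.const_smul_section hs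

lemma HolAt.smul {x : X} {f : X → ℂ} {s : ∀ y, L y} (hf : HolFunAt E f x)
    (hs : HolAt E L s x) : HolAt E L (fun y => f y • s y) x := ContMDiffAt.smul_section hf hs

lemma holAt_zero (x : X) : HolAt E L 0 x := (holSections E L x).zero_mem

lemma HolAt.sum {ι : Type*} {x : X} {S : Finset ι} {t : ι → ∀ y, L y}
    (h : ∀ i ∈ S, HolAt E L (t i) x) : HolAt E L (∑ i ∈ S, t i) x :=
  (holSections E L x).sum_mem h

lemma jet_add {x : X} {s t : ∀ y, L y} (hs : HolAt E L s x) (ht : HolAt E L t x) :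
    jet E L x (s + t) = jet E L x s + jet E L x t := by
  rw [jet_of_hol hs, jet_of_hol ht, jet_of_hol (hs.add ht), ← map_add]; rfl

lemma jet_sub {x : X} {s t : ∀ y, L y} (hs : HolAt E L s x) (ht : HolAt E L t x) :
    jet E L x (s - t) = jet E L x s - jet E L x t := by
  rw [jet_of_hol hs, jet_of_hol ht, jet_of_hol (hs.sub ht), ← map_sub]; rfl

lemma jet_smul {x : X} {s : ∀ y, L y} (hs : HolAt E L s x) (c : ℂ) :
    jet E L x (c • s) = c • jet E L x s := by
  rw [jet_of_hol hs, jet_of_hol (hs.const_smul c), ← map_smul]; rfl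

lemma jet_mul_mul {x : X} {f g : X → ℂ} {s : ∀ y, L y} (hf : HolFunAt E f x)
    (hg : HolFunAt E g x) (hs : HolAt E L s x) (hfx : f x = 0) (hgx : g x = 0) :
    jet E L x (fun y => (f y * g y) • s y) = 0 := by
  have h : HolAt E L (fun y => (f y * g y) • s y) x := HolAt.smul (ContMDiffAt.mul hf hg) hs
  rw [jet_of_hol h, Submodule.mkQ_apply, Submodule.Quotient.mk_eq_zero]
  exact Submodule.subset_span ⟨f, g, s, hf, hg, hs, hfx, hgx, rfl⟩

open Classical in
lemma jet_eq_zero {x : X} {s : ∀ y, L y} (h : ∀ᶠ y in 𝓝 x, s y = 0) : jet E L x s = 0 := by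
  have hs : HolAt E L s x := (holAt_zero x).congr h
  have hf : HolFunAt E (fun y => if s y = 0 then (0 : ℂ) else 1) x :=
    (contMDiffAt_const (c := (0 : ℂ))).congr_of_eventuallyEq (h.mono fun y hy => by simp [hy])
  have h0 : (if s x = 0 then (0 : ℂ) else 1) = 0 := by simp [h.self_of_nhds]
  have := jet_mul_mul hf hf hs h0 h0
  convert this using 2
  ext y
  by_cases hy : s y = 0 <;> simp [hy]

lemma jet_congr {x : X} {s t : ∀ y, L y} (h : ∀ᶠ y in 𝓝 x, s y = t y) :
    jet E L x s = jet E L x t := by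
  by_cases hs : HolAt E L s x
  · have ht : HolAt E L t x := hs.congr (h.mono fun y hy => hy.symm)
    rw [← sub_eq_zero, ← jet_sub hs ht]
    exact jet_eq_zero (h.mono fun y hy => by simp [hy])
  · have ht : ¬ HolAt E L t x := fun ht => hs (ht.congr h)
    simp [jet, hs, ht]

/-- First-order Leibniz rule for jets. -/
lemma jet_mul {x : X} {f g : X → ℂ} {s : ∀ y, L y} (hf : HolFunAt E f x)
    (hg : HolFunAt E g x) (hs : HolAt E L s x) :
    jet E L x (fun y => (f y * g y) • s y) = f x • jet E L x (fun y => g y • s y) +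
      g x • jet E L x (fun y => f y • s y) - (f x * g x) • jet E L x s := by
  have hf' : HolFunAt E (fun y => f y - f x) x := ContMDiffAt.sub hf contMDiffAt_const
  have hg' : HolFunAt E (fun y => g y - g x) x := ContMDiffAt.sub hg contMDiffAt_const
  have h := jet_mul_mul hf' hg' hs (sub_self _) (sub_self _)
  have h1 : HolAt E L (fun y => (f y * g y) • s y) x := HolAt.smul (ContMDiffAt.mul hf hg) hs
  have h2 := (HolAt.smul hg hs).const_smul (f x)
  have h3 := (HolAt.smul hf hs).const_smul (g x)
  have h4 := hs.const_smul (f x * g x)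
  have h5 : (fun y => ((f y - f x) * (g y - g x)) • s y) =
      (fun y => (f y * g y) • s y) - (f x • fun y => g y • s y) - (g x • fun y => f y • s y) +
        (f x * g x) • s := by
    ext y
    simp only [Pi.add_apply, Pi.sub_apply, Pi.smul_apply]
    module
  rw [h5, jet_add ((h1.sub h2).sub h3) h4, jet_sub (h1.sub h2) h3, jet_sub h1 h2,
    jet_smul (HolAt.smul hg hs), jet_smul (HolAt.smul hf hs), jet_smul hs] at h
  rw [← sub_eq_zero, ← h]
  abel

variable [IsManifold 𝓘(ℂ, E) ω X] [ContMDiffVectorBundle ω ℂ L 𝓘(ℂ, E)]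

lemma HolFunAt.eventually {f : X → ℂ} {x : X} (h : HolFunAt E f x) :
    ∀ᶠ y in 𝓝 x, HolFunAt E f y :=
  (contMDiffAt_iff_contMDiffAt_nhds (by simp)).1 h

lemma HolAt.eventually {x : X} {s : ∀ y, L y} (h : HolAt E L s x) :
    ∀ᶠ y in 𝓝 x, HolAt E L s y :=
  (contMDiffAt_iff_contMDiffAt_nhds (by simp)).1 h

variable (E L) in
/-- Near every point there is a holomorphic section that generates `L`. -/
lemma exists_frame (x : X) : ∃ e : ∀ y, L y, HolAt E L e x ∧
    (∀ u, HolAt E L u x → ∃ h : X → ℂ, HolFunAt E h x ∧ ∀ᶠ y in 𝓝 x, u y = h y • e y) ∧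
    ∀ a : L x, ∃ c : ℂ, a = c • e x := by
  set t := trivializationAt ℂ L x
  have hx : x ∈ t.baseSet := mem_baseSet_trivializationAt ℂ L x
  have hnhds : ∀ᶠ y in 𝓝 x, y ∈ t.baseSet := t.open_baseSet.mem_nhds hx
  have key : ∀ y ∈ t.baseSet, ∀ a : L y, a = (t ⟨y, a⟩).2 • t.symm y (1 : ℂ) := by
    intro y hy a
    have h1 : t.symm y ((t ⟨y, a⟩).2) = a := t.symm_apply_apply_mk hy a
    have h2 : t.symm y ((t ⟨y, a⟩).2 • (1 : ℂ)) = (t ⟨y, a⟩).2 • t.symm y (1 : ℂ) := by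
      simpa only [Trivialization.symmₗ_apply _ hy] using (t.symmₗ ℂ y).map_smul (t ⟨y, a⟩).2 (1 : ℂ)
    rw [smul_eq_mul, mul_one, h1] at h2
    exact h2
  refine ⟨fun y => t.symm y (1 : ℂ), ?_, ?_, fun a => ⟨_, key x hx a⟩⟩
  · rw [HolAt, contMDiffAt_section]
    refine (contMDiffAt_const (c := (1 : ℂ))).congr_of_eventuallyEq (hnhds.mono fun y hy => ?_)
    simp only
    rw [t.apply_mk_symm hy]
  · intro u hu
    exact ⟨fun y => (t ⟨y, u y⟩).2, (contMDiffAt_section x).1 hu,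
      hnhds.mono fun y hy => key y hy (u y)⟩

/-- The symbol of a linear functional on 1-jets, at a function vanishing at the point. -/
lemma exists_symbol {x : X} (ψ : Jet E L x →ₗ[ℂ] L x) {f : X → ℂ} (hf : HolFunAt E f x)
    (hfx : f x = 0) :
    ∃ a : ℂ, ∀ u, HolAt E L u x → ψ (jet E L x (fun y => f y • u y)) = a • u x := by
  obtain ⟨e, he, h1, h2⟩ := exists_frame E L x
  obtain ⟨a, ha⟩ := h2 (ψ (jet E L x (fun y => f y • e y)))
  refine ⟨a, fun u hu => ?_⟩
  obtain ⟨h, hh, hu'⟩ := h1 u hu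
  have : jet E L x (fun y => f y • u y) = jet E L x (fun y => (f y * h y) • e y) :=
    jet_congr (hu'.mono fun y hy => by simp [hy, mul_smul])
  rw [this, jet_mul hf hh he, hfx, hu'.self_of_nhds]
  simp [ha, smul_smul, mul_comm]

end Jets

section Sheaf

variable (E : Type*) [NormedAddCommGroup E] [NormedSpace ℂ E]
  {X : Type u} [TopologicalSpace X] [ChartedSpace E X]
  (L : X → Type u) [∀ x, AddCommGroup (L x)] [∀ x, Module ℂ (L x)]
  [∀ x, TopologicalSpace (L x)] [TopologicalSpace (TotalSpace ℂ L)] [FiberBundle ℂ L]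
  [VectorBundle ℂ ℂ L]

/-- `Lₓ ⊗ (Nₓ*)^{⊗ m}`, as the space of multilinear maps from `Nₓ = J¹ₓL` to `Lₓ`. -/
abbrev JetForm (m : ℕ) (x : X) : Type u :=
  MultilinearMap ℂ (fun _ : Fin m => Jet E L x) (L x)

variable {E L}

open Classical in
/-- The section `y ↦ φ_y(j¹s₁, …, j¹s_m)` of `L`, extended by zero outside of `U`. -/
def evalJets {m : ℕ} {U : Opens X} (φ : ∀ x : U, JetForm E L m x) (s : Fin m → ∀ y, L y) :
    ∀ y, L y :=
  fun y => if h : y ∈ U then φ ⟨y, h⟩ (fun i => jet E L y (s i)) else 0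

lemma evalJets_of_mem {m : ℕ} {U : Opens X} (φ : ∀ x : U, JetForm E L m x)
    (s : Fin m → ∀ y, L y) {y : X} (h : y ∈ U) :
    evalJets φ s y = φ ⟨y, h⟩ (fun i => jet E L y (s i)) := by
  simp [evalJets, h]

variable (E L) in
/-- The space of holomorphic sections over `U` of the bundle `L ⊗ ⊙^m N*`, `N = J¹L`. A section
is a family of symmetric multilinear maps `φₓ : Nₓ × ⋯ × Nₓ → Lₓ`; it is holomorphic if it maps the
jets of local holomorphic sections of `L` (which generate the sheaf of holomorphic sections of `N`)
to holomorphic sections of `L`. -/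
def symSections (m : ℕ) (U : Opens X) : Submodule ℂ (∀ x : U, JetForm E L m x) where
  carrier := {φ | (∀ (x : U) (σ : Equiv.Perm (Fin m)) (q : Fin m → Jet E L x),
      φ x (q ∘ σ) = φ x q) ∧
    ∀ (x : U) (s : Fin m → ∀ y, L y), (∀ i, HolAt E L (s i) x) → HolAt E L (evalJets φ s) x}
  add_mem' {φ ψ} hφ hψ := by
    refine ⟨fun x σ q => by simp [hφ.1, hψ.1], fun x s hs => ?_⟩
    refine ((hφ.2 x s hs).add (hψ.2 x s hs)).congr ?_
    filter_upwards [U.isOpen.mem_nhds x.2] with y hy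
    simp [evalJets_of_mem _ _ hy]
  zero_mem' := by
    refine ⟨fun x σ q => by simp, fun x s hs => ?_⟩
    refine (holAt_zero (x : X)).congr ?_
    filter_upwards [U.isOpen.mem_nhds x.2] with y hy
    simp [evalJets_of_mem _ _ hy]
  smul_mem' c φ hφ := by
    refine ⟨fun x σ q => by simp [hφ.1], fun x s hs => ?_⟩
    refine ((hφ.2 x s hs).const_smul c).congr ?_
    filter_upwards [U.isOpen.mem_nhds x.2] with y hy
    simp [evalJets_of_mem _ _ hy]

lemma symSections_ext {m : ℕ} {U : Opens X} {φ ψ : symSections E L m U}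
    (h : ∀ (x : X) (_ : x ∈ U) (s : Fin m → ∀ y, L y), (∀ i, HolAt E L (s i) x) →
      evalJets φ.1 s x = evalJets ψ.1 s x) : φ = ψ := by
  refine Subtype.ext (funext fun x => MultilinearMap.ext fun q => ?_)
  choose s hs hq using fun i => exists_jet_eq (q i)
  have := h x x.2 s hs
  rw [evalJets_of_mem _ _ x.2, evalJets_of_mem _ _ x.2] at this
  simpa [hq] using this

lemma jets_update {m : ℕ} (s : Fin m → ∀ y, L y) (i : Fin m) (t : ∀ y, L y) (y : X) :
    (fun j => jet E L y (Function.update s i t j)) =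
      Function.update (fun j => jet E L y (s j)) i (jet E L y t) := by
  ext j
  by_cases h : j = i
  · subst h; simp
  · simp [h]

/-- Restriction of sections. -/
def restrict {m : ℕ} {U U' : Opens X} (h : U ≤ U') :
    symSections E L m U' →ₗ[ℂ] symSections E L m U where
  toFun φ := ⟨fun x => φ.1 ⟨x, h x.2⟩, fun x => φ.2.1 ⟨x, h x.2⟩, fun x s hs => by
    refine (φ.2.2 ⟨x, h x.2⟩ s hs).congr ?_
    filter_upwards [U.isOpen.mem_nhds x.2] with y hy
    rw [evalJets_of_mem _ _ hy, evalJets_of_mem _ _ (h hy)]⟩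
  map_add' _ _ := rfl
  map_smul' _ _ := rfl

lemma evalJets_restrict {m : ℕ} {U U' : Opens X} (h : U ≤ U') (φ : symSections E L m U')
    (s : Fin m → ∀ y, L y) {y : X} (hy : y ∈ U) :
    evalJets (restrict h φ).1 s y = evalJets φ.1 s y := by
  rw [evalJets_of_mem _ _ hy, evalJets_of_mem _ _ (h hy)]; rfl

variable (E L) in
/-- The presheaf of holomorphic sections of `L ⊗ ⊙^m N*`. -/
def symPresheaf (m : ℕ) : (Opens X)ᵒᵖ ⥤ AddCommGrpCat.{u} where
  obj U := AddCommGrpCat.of (symSections E L m U.unop)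
  map f := AddCommGrpCat.ofHom (restrict f.unop.le).toAddMonoidHom

variable (E L) in
lemma symPresheaf_isSheaf (m : ℕ) :
    Presheaf.IsSheaf (Opens.grothendieckTopology X) (symPresheaf E L m) := by
  change TopCat.Presheaf.IsSheaf (X := TopCat.of X) (symPresheaf E L m)
  rw [TopCat.Presheaf.isSheaf_iff_isSheaf_comp (forget AddCommGrpCat.{u})]
  refine TopCat.Presheaf.isSheaf_of_isSheafUniqueGluing_types _ ?_
  intro ι U sf hsf
  have hcomp : ∀ (i j : ι) (x : X) (hi : x ∈ U i) (hj : x ∈ U j),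
      (sf i : symSections E L m (U i)).1 ⟨x, hi⟩ =
        (sf j : symSections E L m (U j)).1 ⟨x, hj⟩ := by
    intro i j x hi hj
    have := hsf i j
    exact congrArg (fun φ : symSections E L m (U i ⊓ U j) => φ.1 ⟨x, hi, hj⟩) this
  have hmem : ∀ x : (iSup U : Opens X), ∃ i, (x : X) ∈ U i := fun x => Opens.mem_iSup.1 x.2
  choose c hc using hmem
  have hglue : ∀ (x : (iSup U : Opens X)) (i : ι) (hi : (x : X) ∈ U i),
      (sf (c x) : symSections E L m (U (c x))).1 ⟨x, hc x⟩ =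
        (sf i : symSections E L m (U i)).1 ⟨x, hi⟩ := fun x i hi => hcomp _ _ _ _ _
  refine ⟨(⟨fun x => (sf (c x) : symSections E L m (U (c x))).1 ⟨x, hc x⟩,
    fun x => (sf (c x) : symSections E L m (U (c x))).2.1 ⟨x, hc x⟩, fun x s hs => ?_⟩ :
      symSections E L m (iSup U)), ?_, ?_⟩
  · refine ((sf (c x) : symSections E L m (U (c x))).2.2 ⟨x, hc x⟩ s hs).congr ?_
    filter_upwards [(U (c x)).isOpen.mem_nhds (hc x)] with y hy
    have hy' : y ∈ (iSup U : Opens X) := Opens.mem_iSup.2 ⟨_, hy⟩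
    rw [evalJets_of_mem _ _ hy', evalJets_of_mem _ _ hy]
    exact congrArg (fun T => T (fun i => jet E L y (s i))) (hglue ⟨y, hy'⟩ (c x) hy)
  · intro i
    exact Subtype.ext (funext fun x => hglue ⟨x, Opens.mem_iSup.2 ⟨i, x.2⟩⟩ i x.2)
  · intro t ht
    refine Subtype.ext (funext fun x => ?_)
    exact congrArg (fun φ : symSections E L m (U (c x)) => φ.1 ⟨x, hc x⟩) (ht (c x))

variable (E L) in
/-- The sheaf of holomorphic sections of `L ⊗ ⊙^m N*`. -/
def symSheaf (m : ℕ) : Sheaf (Opens.grothendieckTopology X) AddCommGrpCat.{u} :=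
  ⟨symPresheaf E L m, symPresheaf_isSheaf E L m⟩

/-- A morphism of sheaves given by linear maps that commute with restrictions. -/
def sheafHom {m m' : ℕ} (F : ∀ U : Opens X, symSections E L m U →ₗ[ℂ] symSections E L m' U)
    (hF : ∀ (U U' : Opens X) (h : U ≤ U') (φ : symSections E L m U'),
      F U (restrict h φ) = restrict h (F U' φ)) : symSheaf E L m ⟶ symSheaf E L m' :=
  ⟨{ app := fun U => AddCommGrpCat.ofHom (F U.unop).toAddMonoidHom
     naturality := fun U U' f => by
      ext φ
      exact hF _ _ f.unop.le φ }⟩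

variable (E L) in
/-- Multiplication by a scalar on the sheaf of holomorphic sections of `L ⊗ ⊙^m N*`. -/
def smulHom (m : ℕ) (c : ℂ) : symSheaf E L m ⟶ symSheaf E L m :=
  sheafHom (fun _ => c • LinearMap.id) fun _ _ h φ => by simp

variable (E L) in
/-- The cohomology `H¹(X, L ⊗ ⊙^m N*)`. -/
def H1 (m : ℕ) : Type u := (symSheaf E L m).H 1

instance (m : ℕ) : AddCommGroup (H1 E L m) := inferInstanceAs (AddCommGroup ((symSheaf E L m).H 1))

/-- `H¹(X, L ⊗ ⊙^m N*)` is a complex vector space by functoriality. -/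
instance (m : ℕ) : Module ℂ (H1 E L m) where
  smul c h := Sheaf.H.map (smulHom E L m c) 1 h
  one_smul h := by
    change Sheaf.H.map (smulHom E L m 1) 1 h = h
    have : smulHom E L m 1 = 𝟙 _ := by
      ext U φ
      exact one_smul ℂ (show symSections E L m U.unop from φ)
    rw [this]; exact Sheaf.H.map_id_apply _
  mul_smul a b h := by
    change Sheaf.H.map (smulHom E L m (a * b)) 1 h =
      Sheaf.H.map (smulHom E L m a) 1 (Sheaf.H.map (smulHom E L m b) 1 h)
    have : smulHom E L m (a * b) = smulHom E L m b ≫ smulHom E L m a := by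
      ext U φ
      exact mul_smul a b (show symSections E L m U.unop from φ)
    rw [this]; exact Sheaf.H.map_comp_apply _ _ _
  smul_zero c := map_zero (Sheaf.H.map (smulHom E L m c) 1)
  smul_add c := map_add (Sheaf.H.map (smulHom E L m c) 1)
  add_smul a b h := by
    change Sheaf.H.map (smulHom E L m (a + b)) 1 h =
      Sheaf.H.map (smulHom E L m a) 1 h + Sheaf.H.map (smulHom E L m b) 1 h
    have : smulHom E L m (a + b) = smulHom E L m a + smulHom E L m b := by
      ext U φ
      exact add_smul a b (show symSections E L m U.unop from φ)
    rw [this]; exact Sheaf.H.map_add_apply _ _ _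
  zero_smul h := by
    change Sheaf.H.map (smulHom E L m 0) 1 h = 0
    have : smulHom E L m 0 = 0 := by
      ext U φ
      exact zero_smul ℂ (show symSections E L m U.unop from φ)
    rw [this]
    have := Sheaf.H.map_add_apply (0 : symSheaf E L m ⟶ symSheaf E L m) 0 h
    simpa using this

lemma H1_smul_def {m : ℕ} (c : ℂ) (h : H1 E L m) :
    c • h = (Sheaf.H.map (smulHom E L m c) 1 h : (symSheaf E L m).H 1) := rfl

/-- The linear map on `H¹` induced by a morphism of sheaves given by linear maps. -/
def H1map {m m' : ℕ} (F : ∀ U : Opens X, symSections E L m U →ₗ[ℂ] symSections E L m' U)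
    (hF : ∀ (U U' : Opens X) (h : U ≤ U') (φ : symSections E L m U'),
      F U (restrict h φ) = restrict h (F U' φ)) : H1 E L m →ₗ[ℂ] H1 E L m' where
  toFun h := Sheaf.H.map (sheafHom F hF) 1 h
  map_add' := map_add (Sheaf.H.map (sheafHom F hF) 1)
  map_smul' c h := by
    change Sheaf.H.map (sheafHom F hF) 1 (Sheaf.H.map (smulHom E L m c) 1 h) =
      Sheaf.H.map (smulHom E L m' c) 1 (Sheaf.H.map (sheafHom F hF) 1 h)
    have hc : smulHom E L m c ≫ sheafHom F hF = sheafHom F hF ≫ smulHom E L m' c := by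
      ext U φ
      exact (F U.unop).map_smul c φ
    refine (Sheaf.H.map_comp_apply _ _ _).symm.trans (Eq.trans ?_ (Sheaf.H.map_comp_apply _ _ _))
    rw [hc]

lemma H1map_add {m m' : ℕ}
    (F G K : ∀ U : Opens X, symSections E L m U →ₗ[ℂ] symSections E L m' U) (hF hG hK)
    (h : ∀ U φ, F U φ = G U φ + K U φ) (c : H1 E L m) :
    H1map F hF c = H1map G hG c + H1map K hK c := by
  have : sheafHom F hF = sheafHom G hG + sheafHom K hK := by
    ext U φ
    exact h U.unop φ
  change Sheaf.H.map (sheafHom F hF) 1 c = _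
  rw [this]
  exact Sheaf.H.map_add_apply _ _ _

lemma H1map_smul {m m' : ℕ} (a : ℂ)
    (F G : ∀ U : Opens X, symSections E L m U →ₗ[ℂ] symSections E L m' U) (hF hG)
    (h : ∀ U φ, F U φ = a • G U φ) (c : H1 E L m) :
    H1map F hF c = a • H1map G hG c := by
  have : sheafHom F hF = sheafHom G hG ≫ smulHom E L m' a := by
    ext U φ
    exact h U.unop φ
  change Sheaf.H.map (sheafHom F hF) 1 c = _
  rw [this]
  exact Sheaf.H.map_comp_apply _ _ _

end Sheaf

section Action

variable {E : Type*} [NormedAddCommGroup E] [NormedSpace ℂ E]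
  {X : Type u} [TopologicalSpace X] [ChartedSpace E X]
  {L : X → Type u} [∀ x, AddCommGroup (L x)] [∀ x, Module ℂ (L x)]
  [∀ x, TopologicalSpace (L x)] [TopologicalSpace (TotalSpace ℂ L)] [FiberBundle ℂ L]
  [VectorBundle ℂ ℂ L]

variable (E L) in
/-- `H⁰(X, L ⊗ N*)`, the space of global holomorphic first-order differential operators on `L`. -/
abbrev InfAut : Type u := symSections E L 1 (⊤ : Opens X)

/-- The fibre at `x` of a global section of `L ⊗ N*`, as a linear map `Nₓ → Lₓ`. -/
def linAt (D : InfAut E L) (x : X) : Jet E L x →ₗ[ℂ] L x :=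
  (MultilinearMap.ofSubsingletonₗ ℂ ℂ (Jet E L x) (L x) (0 : Fin 1)).symm (D.1 ⟨x, trivial⟩)

lemma linAt_apply (D : InfAut E L) (x : X) (q : Jet E L x) :
    linAt D x q = D.1 ⟨x, trivial⟩ (fun _ => q) := rfl

/-- The section `D s` of `L`, for a global section `D` of `L ⊗ N*` and a section `s` of `L`. -/
def appl (D : InfAut E L) (s : ∀ y, L y) : ∀ y, L y := fun y => linAt D y (jet E L y s)

lemma evalJets_infAut (D : InfAut E L) (s : Fin 1 → ∀ y, L y) : evalJets D.1 s = appl D (s 0) := by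
  ext y
  rw [evalJets_of_mem _ _ (show y ∈ (⊤ : Opens X) from trivial)]
  rw [appl, linAt_apply]
  congr 1
  ext i
  rw [Subsingleton.elim i 0]

lemma HolAt.appl {x : X} {s : ∀ y, L y} (hs : HolAt E L s x) (D : InfAut E L) :
    HolAt E L (appl D s) x := by
  have := D.2.2 ⟨x, trivial⟩ (fun _ => s) fun _ => hs
  rwa [evalJets_infAut] at this

lemma appl_add {x : X} {s t : ∀ y, L y} (hs : HolAt E L s x) (ht : HolAt E L t x)
    (D : InfAut E L) : appl D (s + t) x = appl D s x + appl D t x := by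
  rw [appl, jet_add hs ht, map_add]; rfl

lemma appl_smul {x : X} {s : ∀ y, L y} (hs : HolAt E L s x) (c : ℂ) (D : InfAut E L) :
    appl D (c • s) x = c • appl D s x := by
  rw [appl, jet_smul hs, map_smul]; rfl

lemma evalJets_add {m : ℕ} {U : Opens X} (φ ψ : symSections E L m U) (t : Fin m → ∀ y, L y) :
    evalJets (φ + ψ).1 t = evalJets φ.1 t + evalJets ψ.1 t := by
  ext y
  by_cases hy : y ∈ U <;> simp [evalJets, hy]

lemma evalJets_smul {m : ℕ} {U : Opens X} (c : ℂ) (φ : symSections E L m U)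
    (t : Fin m → ∀ y, L y) : evalJets (c • φ).1 t = c • evalJets φ.1 t := by
  ext y
  by_cases hy : y ∈ U <;> simp [evalJets, hy]

lemma HolAt.evalJets {m : ℕ} {U : Opens X} (φ : symSections E L m U) {x : X} (hx : x ∈ U)
    {s : Fin m → ∀ y, L y} (hs : ∀ i, HolAt E L (s i) x) : HolAt E L (evalJets φ.1 s) x :=
  φ.2.2 ⟨x, hx⟩ s hs

lemma HolAt.update {m : ℕ} {x : X} {s : Fin m → ∀ y, L y} (hs : ∀ i, HolAt E L (s i) x)
    (i : Fin m) {t : ∀ y, L y} (ht : HolAt E L t x) (j : Fin m) :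
    HolAt E L (Function.update s i t j) x := by
  by_cases h : j = i
  · subst h; simpa using ht
  · simpa [h] using hs j

variable [IsManifold 𝓘(ℂ, E) ω X] [ContMDiffVectorBundle ω ℂ L 𝓘(ℂ, E)]

lemma coe_update {m : ℕ} {x : X} (s : Fin m → holSections E L x) (i : Fin m)
    (t : holSections E L x) :
    (fun j => ((Function.update s i t j : holSections E L x) : ∀ y, L y)) =
      Function.update (fun j => (s j : ∀ y, L y)) i t := by
  ext j
  by_cases h : j = i
  · subst h; simp
  · simp [h]

/-- `(s₁, …, s_m) ↦ j¹ₓ(φ(j¹s₁, …, j¹s_m))`. -/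
def jetEval {m : ℕ} {U : Opens X} (φ : symSections E L m U) {x : X} (hx : x ∈ U) :
    MultilinearMap ℂ (fun _ : Fin m => holSections E L x) (Jet E L x) :=
  MultilinearMap.mk' (fun s => jet E L x (evalJets φ.1 fun i => (s i : ∀ y, L y)))
    (fun s i t t' => by
      simp only [coe_update]
      rw [← jet_add (HolAt.evalJets φ hx (HolAt.update (fun j => (s j).2) i t.2))
        (HolAt.evalJets φ hx (HolAt.update (fun j => (s j).2) i t'.2))]
      refine jet_congr ?_
      filter_upwards [U.isOpen.mem_nhds hx, HolAt.eventually t.2, HolAt.eventually t'.2]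
        with y hy h1 h2
      rw [Pi.add_apply]
      simp only [evalJets_of_mem _ _ hy, jets_update]
      rw [← MultilinearMap.map_update_add]
      congr 2
      exact jet_add h1 h2)
    (fun s i c t => by
      simp only [coe_update]
      rw [← jet_smul (HolAt.evalJets φ hx (HolAt.update (fun j => (s j).2) i t.2))]
      refine jet_congr ?_
      filter_upwards [U.isOpen.mem_nhds hx, HolAt.eventually t.2] with y hy h1
      rw [Pi.smul_apply]
      simp only [evalJets_of_mem _ _ hy, jets_update]
      rw [← MultilinearMap.map_update_smul]
      congr 2
      exact jet_smul h1 c)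

/-- `s ↦ j¹ₓ(D s)`. -/
def jetAppl (D : InfAut E L) (x : X) : holSections E L x →ₗ[ℂ] Jet E L x where
  toFun s := jet E L x (appl D s)
  map_add' s t := by
    rw [← jet_add (HolAt.appl s.2 D) (HolAt.appl t.2 D)]
    refine jet_congr ?_
    filter_upwards [HolAt.eventually s.2, HolAt.eventually t.2] with y h1 h2
    simp only [appl, Pi.add_apply, Submodule.coe_add]
    rw [← map_add]
    congr 1
    exact jet_add h1 h2
  map_smul' c s := by
    rw [RingHom.id_apply, ← jet_smul (HolAt.appl s.2 D)]
    refine jet_congr ?_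
    filter_upwards [HolAt.eventually s.2] with y h1
    simp only [appl, Pi.smul_apply, Submodule.coe_smul]
    rw [← map_smul]
    congr 1
    exact jet_smul h1 c

/-- `(s₁, …, s_m) ↦ (D(φ(s₁, …, s_m)) - ∑ᵢ φ(s₁, …, D sᵢ, …, s_m))(x)`. -/
def preLie (D : InfAut E L) {m : ℕ} {U : Opens X} (φ : symSections E L m U) {x : X} (hx : x ∈ U) :
    MultilinearMap ℂ (fun _ : Fin m => holSections E L x) (L x) :=
  (linAt D x).compMultilinearMap (jetEval φ hx) -
    ∑ i, (φ.1 ⟨x, hx⟩).compLinearMap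
      (Function.update (fun _ => (vanishTwice E L x).mkQ) i (jetAppl D x))

lemma preLie_apply (D : InfAut E L) {m : ℕ} {U : Opens X} (φ : symSections E L m U) {x : X}
    (hx : x ∈ U) (s : Fin m → holSections E L x) :
    preLie D φ hx s = appl D (evalJets φ.1 fun i => (s i : ∀ y, L y)) x -
      ∑ i, evalJets φ.1 (Function.update (fun j => (s j : ∀ y, L y)) i (appl D (s i))) x := by
  simp only [preLie, sub_apply, LinearMap.compMultilinearMap_apply, sum_apply,
    MultilinearMap.compLinearMap_apply]
  congr 1
  refine Finset.sum_congr rfl fun i _ => ?_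
  rw [evalJets_of_mem _ _ hx, jets_update]
  congr 1
  ext j
  by_cases h : j = i
  · subst h; simp [jetAppl]
  · simp [h, jet_coe]

lemma preLie_vanish (D : InfAut E L) {m : ℕ} {U : Opens X} (φ : symSections E L m U) {x : X}
    (hx : x ∈ U) (s : Fin m → holSections E L x) (i : Fin m) {t : holSections E L x}
    (ht : t ∈ vanishTwice E L x) : preLie D φ hx (Function.update s i t) = 0 := by
  suffices h : vanishTwice E L x ≤ LinearMap.ker ((preLie D φ hx).toLinearMap s i) from h ht
  refine Submodule.span_le.2 ?_
  rintro ⟨_, ht'⟩ ⟨f, g, t₀, hf, hg, ht₀, hfx, hgx, rfl⟩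
  change preLie D φ hx (Function.update s i _) = 0
  set s' : Fin m → ∀ y, L y := fun j => (s j : ∀ y, L y) with hs'
  have hs : ∀ j, HolAt E L (s' j) x := fun j => (s j).2
  obtain ⟨a, ha⟩ := exists_symbol (linAt D x) hf hfx
  obtain ⟨a', ha'⟩ := exists_symbol (linAt D x) hg hgx
  set ψ : Jet E L x →ₗ[ℂ] L x := (φ.1 ⟨x, hx⟩).toLinearMap (fun j => jet E L x (s' j)) i with hψ
  have hψ' : ∀ q, φ.1 ⟨x, hx⟩ (Function.update (fun j => jet E L x (s' j)) i q) = ψ q :=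
    fun q => rfl
  obtain ⟨b, hb⟩ := exists_symbol ψ hf hfx
  obtain ⟨b', hb'⟩ := exists_symbol ψ hg hgx
  have hft : HolAt E L (fun y => f y • t₀ y) x := HolAt.smul hf ht₀
  have hgt : HolAt E L (fun y => g y • t₀ y) x := HolAt.smul hg ht₀
  rw [preLie_apply, coe_update]
  -- the first term
  have e1 : jet E L x (evalJets φ.1 (Function.update s' i fun y => (f y * g y) • t₀ y)) =
      jet E L x (fun y => f y • evalJets φ.1 (Function.update s' i fun y => g y • t₀ y) y) +
        jet E L x (fun y => g y • evalJets φ.1 (Function.update s' i fun y => f y • t₀ y) y) := by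
    have hA := HolAt.smul hf (HolAt.evalJets φ hx (HolAt.update hs i hgt))
    have hB := HolAt.smul hg (HolAt.evalJets φ hx (HolAt.update hs i hft))
    have hC := HolAt.evalJets φ hx (HolAt.update hs i ht₀)
    have hC' : HolAt E L
        (fun y => (f y * g y) • evalJets φ.1 (Function.update s' i t₀) y) x :=
      HolAt.smul (ContMDiffAt.mul hf hg) hC
    have h0 := jet_mul_mul hf hg hC hfx hgx
    rw [← jet_add hA hB]
    refine Eq.trans ?_ (sub_zero _)
    rw [← h0, ← jet_sub (hA.add hB) hC']
    refine jet_congr ?_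
    filter_upwards [U.isOpen.mem_nhds hx, hf.eventually, hg.eventually, ht₀.eventually]
      with y hy h1 h2 h3
    simp only [Pi.add_apply, Pi.sub_apply, evalJets_of_mem _ _ hy, jets_update]
    set ψ' : Jet E L y →ₗ[ℂ] L y := (φ.1 ⟨y, hy⟩).toLinearMap (fun j => jet E L y (s' j)) i
    change ψ' _ = f y • ψ' _ + g y • ψ' _ - (f y * g y) • ψ' _
    rw [jet_mul h1 h2 h3, map_sub, map_add, map_smul, map_smul, map_smul]
  have e2 : jet E L x (appl D fun y => (f y * g y) • t₀ y) =
      jet E L x (fun y => f y • appl D (fun y => g y • t₀ y) y) +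
        jet E L x (fun y => g y • appl D (fun y => f y • t₀ y) y) := by
    have hA := HolAt.smul hf (HolAt.appl hgt D)
    have hB := HolAt.smul hg (HolAt.appl hft D)
    have hC := HolAt.appl ht₀ D
    have hC' : HolAt E L (fun y => (f y * g y) • appl D t₀ y) x :=
      HolAt.smul (ContMDiffAt.mul hf hg) hC
    have h0 := jet_mul_mul hf hg hC hfx hgx
    rw [← jet_add hA hB]
    refine Eq.trans ?_ (sub_zero _)
    rw [← h0, ← jet_sub (hA.add hB) hC']
    refine jet_congr ?_
    filter_upwards [hf.eventually, hg.eventually, ht₀.eventually] with y h1 h2 h3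
    simp only [Pi.add_apply, Pi.sub_apply, appl]
    rw [jet_mul h1 h2 h3, map_sub, map_add, map_smul, map_smul, map_smul]
  have t1 : appl D (evalJets φ.1 (Function.update s' i fun y => (f y * g y) • t₀ y)) x =
      (a * b' + a' * b) • t₀ x := by
    rw [appl, e1, map_add, ha _ (HolAt.evalJets φ hx (HolAt.update hs i hgt)),
      ha' _ (HolAt.evalJets φ hx (HolAt.update hs i hft)), evalJets_of_mem _ _ hx,
      evalJets_of_mem _ _ hx, jets_update, jets_update, hψ', hψ', hb _ ht₀, hb' _ ht₀]
    module
  have t2 : ∀ j, j ≠ i → evalJets φ.1 (Function.update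
      (Function.update s' i fun y => (f y * g y) • t₀ y) j
        (appl D (Function.update s i ⟨fun y => (f y * g y) • t₀ y, ht'⟩ j :
          holSections E L x))) x = 0 := by
    intro j hj
    rw [evalJets_of_mem _ _ hx]
    refine MultilinearMap.map_coord_zero _ i ?_
    rw [Function.update_of_ne hj.symm, Function.update_self]
    exact jet_mul_mul hf hg ht₀ hfx hgx
  have t3 : evalJets φ.1 (Function.update
      (Function.update s' i fun y => (f y * g y) • t₀ y) i
        (appl D (Function.update s i ⟨fun y => (f y * g y) • t₀ y, ht'⟩ i :
          holSections E L x))) x = (a * b' + a' * b) • t₀ x := by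
    rw [Function.update_idem, Function.update_self, evalJets_of_mem _ _ hx, jets_update, hψ', e2,
      map_add, hb _ (HolAt.appl hgt D), hb' _ (HolAt.appl hft D), appl, appl, ha _ ht₀, ha' _ ht₀]
    module
  rw [t1, Finset.sum_eq_single i (fun j _ hj => t2 j hj) (by simp), t3, sub_self]

lemma preLie_congr (D : InfAut E L) {m : ℕ} {U : Opens X} (φ : symSections E L m U) {x : X}
    (hx : x ∈ U) {s s' : Fin m → holSections E L x}
    (h : ∀ i, s i - s' i ∈ vanishTwice E L x) : preLie D φ hx s = preLie D φ hx s' := by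
  classical
  have key : ∀ S : Finset (Fin m), preLie D φ hx (S.piecewise s s') = preLie D φ hx s' := by
    intro S
    induction S using Finset.induction_on with
    | empty => simp
    | insert i S hi ih =>
      rw [← ih, ← sub_eq_zero, Finset.piecewise_insert]
      have h1 : S.piecewise s s' = Function.update (S.piecewise s s') i (s' i) := by
        rw [eq_comm, Function.update_eq_self_iff]
        simp [hi]
      nth_rewrite 2 [h1]
      rw [← MultilinearMap.map_update_sub]
      exact preLie_vanish D φ hx _ i (h i)
  simpa using key Finset.univ

/-- A linear choice of representatives of jets. -/
def jetLift (x : X) : Jet E L x →ₗ[ℂ] holSections E L x :=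
  ((vanishTwice E L x).mkQ.exists_rightInverse_of_surjective (Submodule.range_mkQ _)).choose

lemma mkQ_jetLift (x : X) (q : Jet E L x) : (vanishTwice E L x).mkQ (jetLift x q) = q :=
  LinearMap.congr_fun ((vanishTwice E L x).mkQ.exists_rightInverse_of_surjective
    (Submodule.range_mkQ _)).choose_spec q

/-- The Lie derivative of a section `φ` of `L ⊗ ⊙^m N*` along `D ∈ H⁰(X, L ⊗ N*)`. -/
def lieFun (D : InfAut E L) {m : ℕ} {U : Opens X} (φ : symSections E L m U) (x : U) :
    JetForm E L m x :=
  (preLie D φ x.2).compLinearMap fun _ => jetLift (x : X)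

/-- The Lie derivative is `(s₁, …, s_m) ↦ D(φ(s₁, …, s_m)) - ∑ᵢ φ(s₁, …, D sᵢ, …, s_m)`. -/
lemma evalJets_lieFun (D : InfAut E L) {m : ℕ} {U : Opens X} (φ : symSections E L m U)
    {s : Fin m → ∀ y, L y} {x : X} (hx : x ∈ U) (hs : ∀ i, HolAt E L (s i) x) :
    evalJets (lieFun D φ) s x = appl D (evalJets φ.1 s) x -
      ∑ i, evalJets φ.1 (Function.update s i (appl D (s i))) x := by
  rw [evalJets_of_mem _ _ hx, lieFun, MultilinearMap.compLinearMap_apply]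
  rw [preLie_congr D φ hx (s' := fun i => ⟨s i, hs i⟩), preLie_apply]
  intro i
  exact (Submodule.Quotient.eq (vanishTwice E L x)).1
    ((mkQ_jetLift x _).trans (jet_of_hol (hs i)))

lemma evalJets_perm {m : ℕ} {U : Opens X} (φ : symSections E L m U) (σ : Equiv.Perm (Fin m))
    (t : Fin m → ∀ y, L y) : evalJets φ.1 (t ∘ σ) = evalJets φ.1 t := by
  ext y
  by_cases hy : y ∈ U
  · rw [evalJets_of_mem _ _ hy, evalJets_of_mem _ _ hy]
    exact φ.2.1 ⟨y, hy⟩ σ fun i => jet E L y (t i)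
  · simp [evalJets, hy]

lemma lieFun_mem (D : InfAut E L) {m : ℕ} {U : Opens X} (φ : symSections E L m U) :
    lieFun D φ ∈ symSections E L m U := by
  refine ⟨fun x σ q => ?_, fun x s hs => ?_⟩
  · choose s hs hq using fun i => exists_jet_eq (q i)
    obtain rfl : (fun i => jet E L x (s i)) = q := funext hq
    have h1 := evalJets_lieFun D φ (s := s) x.2 hs
    have h2 := evalJets_lieFun D φ (s := s ∘ σ) x.2 fun i => hs (σ i)
    rw [evalJets_of_mem _ _ x.2] at h1 h2
    refine h2.trans (Eq.trans ?_ h1.symm)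
    rw [evalJets_perm]
    congr 1
    refine Fintype.sum_equiv σ _ _ fun i => ?_
    rw [← evalJets_perm φ σ (Function.update s (σ i) _)]
    have hu : Function.update (s ∘ σ) i (appl D (s (σ i))) =
        Function.update s (σ i) (appl D (s (σ i))) ∘ σ := by
      ext j y
      simp only [Function.comp_apply, Function.update_apply]
      by_cases h : j = i <;> simp [h]
    exact congrFun (congrArg (evalJets φ.1) hu) x
  · have h1 : HolAt E L (appl D (evalJets φ.1 s) -
        ∑ i, evalJets φ.1 (Function.update s i (appl D (s i)))) x :=
      (HolAt.appl (HolAt.evalJets φ x.2 hs) D).sub (HolAt.sum fun i _ =>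
        HolAt.evalJets φ x.2 (HolAt.update hs i (HolAt.appl (hs i) D)))
    refine h1.congr ?_
    filter_upwards [U.isOpen.mem_nhds x.2,
      Filter.eventually_all.2 fun i => (hs i).eventually] with y hy hys
    rw [evalJets_lieFun D φ hy hys, Pi.sub_apply, Finset.sum_apply]

/-- The Lie derivative along `D ∈ H⁰(X, L ⊗ N*)` on the sections of `L ⊗ ⊙^m N*`. -/
def lieDeriv (D : InfAut E L) (m : ℕ) (U : Opens X) :
    symSections E L m U →ₗ[ℂ] symSections E L m U where
  toFun φ := ⟨lieFun D φ, lieFun_mem D φ⟩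
  map_add' φ ψ := by
    refine symSections_ext fun x hx s hs => ?_
    rw [evalJets_add]
    change evalJets (lieFun D (φ + ψ)) s x = evalJets (lieFun D φ) s x + evalJets (lieFun D ψ) s x
    rw [evalJets_lieFun D _ hx hs, evalJets_lieFun D _ hx hs, evalJets_lieFun D _ hx hs]
    simp only [evalJets_add, Pi.add_apply, Finset.sum_add_distrib]
    rw [appl_add (HolAt.evalJets φ hx hs) (HolAt.evalJets ψ hx hs), add_sub_add_comm]
  map_smul' c φ := by
    refine symSections_ext fun x hx s hs => ?_
    rw [RingHom.id_apply, evalJets_smul]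
    change evalJets (lieFun D (c • φ)) s x = c • evalJets (lieFun D φ) s x
    rw [evalJets_lieFun D _ hx hs, evalJets_lieFun D _ hx hs]
    simp only [evalJets_smul, Pi.smul_apply, smul_sub, Finset.smul_sum]
    rw [appl_smul (HolAt.evalJets φ hx hs)]

lemma evalJets_lieDeriv (D : InfAut E L) {m : ℕ} {U : Opens X} (φ : symSections E L m U)
    {s : Fin m → ∀ y, L y} {x : X} (hx : x ∈ U) (hs : ∀ i, HolAt E L (s i) x) :
    evalJets (lieDeriv D m U φ).1 s x = appl D (evalJets φ.1 s) x -
      ∑ i, evalJets φ.1 (Function.update s i (appl D (s i))) x :=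
  evalJets_lieFun D φ hx hs

lemma lieDeriv_restrict (D : InfAut E L) (m : ℕ) (U U' : Opens X) (h : U ≤ U')
    (φ : symSections E L m U') :
    lieDeriv D m U (restrict h φ) = restrict h (lieDeriv D m U' φ) := by
  refine symSections_ext fun x hx s hs => ?_
  rw [evalJets_restrict h _ _ hx, evalJets_lieDeriv D _ hx hs, evalJets_lieDeriv D _ (h hx) hs]
  simp only [evalJets_restrict h _ _ hx]
  congr 1
  simp only [appl]
  congr 1
  refine jet_congr ?_
  filter_upwards [U.isOpen.mem_nhds hx] with y hy
  exact evalJets_restrict h _ _ hy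

/-- The action of `D ∈ H⁰(X, L ⊗ N*)` on `H¹(X, L ⊗ ⊙^m N*)`. -/
def H1act (D : InfAut E L) (m : ℕ) : H1 E L m →ₗ[ℂ] H1 E L m :=
  H1map (lieDeriv D m) (lieDeriv_restrict D m)

variable (E L) in
/-- `V = H⁰(X, L)`. -/
abbrev GlobalSections : Type u := Cₛ^ω⟮𝓘(ℂ, E); ℂ, L⟯

lemma GlobalSections.hol (s : GlobalSections E L) (x : X) : HolAt E L s x := s.contMDiff x

/-- The canonical representation of `H⁰(X, L ⊗ N*)` in `V = H⁰(X, L)`. -/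
def rep : InfAut E L →ₗ[ℂ] Module.End ℂ (GlobalSections E L) :=
  LinearMap.mk₂ ℂ (fun D s => ⟨appl D s, fun x => HolAt.appl (s.hol x) D⟩)
    (fun D D' s => by ext x; rfl) (fun c D s => by ext x; rfl)
    (fun D s t => by
      ext x
      change linAt D x (jet E L x (⇑s + ⇑t)) = _
      rw [jet_add (s.hol x) (t.hol x), map_add]; rfl)
    (fun c D s => by
      ext x
      change linAt D x (jet E L x (c • ⇑s)) = _
      rw [jet_smul (s.hol x), map_smul]; rfl)

lemma rep_apply (D : InfAut E L) (s : GlobalSections E L) (x : X) :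
    rep D s x = linAt D x (jet E L x s) := rfl

lemma lie_rep (D D' : InfAut E L) : ⁅rep D, rep D'⁆ = rep (lieDeriv D 1 ⊤ D') := by
  ext s x
  have h := evalJets_lieDeriv D D' (s := fun _ => s) (x := x) trivial fun _ => s.hol x
  simp only [evalJets_infAut, Finset.univ_unique, Finset.sum_singleton] at h
  rw [LieRing.of_associative_ring_bracket]
  change rep D (rep D' s) x - rep D' (rep D s) x = appl (lieDeriv D 1 ⊤ D') s x
  rw [h]
  simp
  rfl

variable (E L) in
/-- The Lie algebra `𝔤 = H⁰(X, L ⊗ N*)`, as a Lie subalgebra of `gl(V)`, `V = H⁰(X, L)`. -/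
def lieAlgebra : LieSubalgebra ℂ (Module.End ℂ (GlobalSections E L)) :=
  { LinearMap.range (rep (E := E) (L := L)) with
    lie_mem' := by
      rintro _ _ ⟨D, rfl⟩ ⟨D', rfl⟩
      exact ⟨_, (lie_rep D D').symm⟩ }

/-- The element of `𝔤 ⊆ gl(V)` defined by a global section of `L ⊗ N*`. -/
def toLie (D : InfAut E L) : lieAlgebra E L := ⟨rep D, D, rfl⟩

variable (E L) in
/-- The natural map `H⁰(X, L ⊗ ⊙^m N*) → V ⊗ (V*)^{⊗ m}`, `V = H⁰(X, L)`, given by evaluation on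
the 1-jets of global sections of `L`. -/
def toTensor (m : ℕ) :
    symSections E L m (⊤ : Opens X) →ₗ[ℂ] Spencer.Tensor (GlobalSections E L) m where
  toFun φ := MultilinearMap.mk'
    (fun v => (⟨evalJets φ.1 fun i => v i, fun x =>
      HolAt.evalJets φ trivial fun i => (v i).hol x⟩ : GlobalSections E L))
    (fun v i s t => by
      ext x
      have hu : ∀ w : GlobalSections E L, (fun j => ((Function.update v i w j :
          GlobalSections E L) : ∀ y, L y)) = Function.update (fun j => (v j : ∀ y, L y)) i w := by
        intro w; ext j; by_cases h : j = i
        · subst h; simp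
        · simp [h]
      simp only [hu, ContMDiffSection.coe_add, Pi.add_apply, ContMDiffSection.coeFn_mk]
      simp only [evalJets_of_mem _ _ (show x ∈ (⊤ : Opens X) from trivial), jets_update]
      rw [jet_add (s.hol x) (t.hol x), MultilinearMap.map_update_add])
    (fun v i c s => by
      ext x
      have hu : ∀ w : GlobalSections E L, (fun j => ((Function.update v i w j :
          GlobalSections E L) : ∀ y, L y)) = Function.update (fun j => (v j : ∀ y, L y)) i w := by
        intro w; ext j; by_cases h : j = i
        · subst h; simp
        · simp [h]
      simp only [hu, ContMDiffSection.coe_smul, Pi.smul_apply, ContMDiffSection.coeFn_mk]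
      simp only [evalJets_of_mem _ _ (show x ∈ (⊤ : Opens X) from trivial), jets_update]
      rw [jet_smul (s.hol x), MultilinearMap.map_update_smul])
  map_add' φ ψ := by
    ext v x
    change evalJets (φ + ψ).1 _ x = evalJets φ.1 _ x + evalJets ψ.1 _ x
    simp only [evalJets_of_mem _ _ (show x ∈ (⊤ : Opens X) from trivial)]
    rfl
  map_smul' c φ := by
    ext v x
    change evalJets (c • φ).1 _ x = c • evalJets φ.1 _ x
    simp only [evalJets_of_mem _ _ (show x ∈ (⊤ : Opens X) from trivial)]
    rfl

lemma toTensor_apply {m : ℕ} (φ : symSections E L m (⊤ : Opens X)) (v : Fin m → GlobalSections E L)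
    (x : X) : toTensor E L m φ v x = φ.1 ⟨x, trivial⟩ (fun i => jet E L x (v i)) :=
  evalJets_of_mem _ _ (show x ∈ (⊤ : Opens X) from trivial)

/-- The contraction `L ⊗ ⊙^{m+1} N* → L ⊗ ⊙^m N*` with the 1-jet of `v ∈ V = H⁰(X, L)`. -/
def contractJet (v : GlobalSections E L) (m : ℕ) (U : Opens X) :
    symSections E L (m + 1) U →ₗ[ℂ] symSections E L m U where
  toFun φ := ⟨fun x => (φ.1 x).curryLeft (jet E L x v), by
    refine ⟨fun x σ q => ?_, fun x s hs => ?_⟩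
    · have := φ.2.1 x (Equiv.Perm.decomposeFin.symm (0, σ)) (Fin.cons (jet E L x v) q)
      rw [MultilinearMap.curryLeft_apply, MultilinearMap.curryLeft_apply, ← this]
      congr 1
      ext j
      refine Fin.cases ?_ (fun j => ?_) j <;> simp
    · refine (HolAt.evalJets φ x.2 (s := Fin.cons (v : ∀ y, L y) s)
        (Fin.cases (v.hol x) hs)).congr ?_
      filter_upwards [U.isOpen.mem_nhds x.2] with y hy
      rw [evalJets_of_mem _ _ hy, evalJets_of_mem _ _ hy, MultilinearMap.curryLeft_apply]
      congr 1
      ext j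
      refine Fin.cases ?_ (fun j => ?_) j <;> simp⟩
  map_add' φ ψ := by
    refine Subtype.ext (funext fun x => MultilinearMap.ext fun q => ?_)
    rfl
  map_smul' c φ := by
    refine Subtype.ext (funext fun x => MultilinearMap.ext fun q => ?_)
    rfl

lemma contractJet_add (v w : GlobalSections E L) (m : ℕ) (U : Opens X)
    (φ : symSections E L (m + 1) U) :
    contractJet (v + w) m U φ = contractJet v m U φ + contractJet w m U φ := by
  refine Subtype.ext (funext fun x => ?_)
  change (φ.1 x).curryLeft (jet E L x (⇑v + ⇑w)) = _
  rw [jet_add (v.hol x) (w.hol x), map_add]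
  rfl

lemma contractJet_smul (c : ℂ) (v : GlobalSections E L) (m : ℕ) (U : Opens X)
    (φ : symSections E L (m + 1) U) : contractJet (c • v) m U φ = c • contractJet v m U φ := by
  refine Subtype.ext (funext fun x => ?_)
  change (φ.1 x).curryLeft (jet E L x (c • ⇑v)) = _
  rw [jet_smul (v.hol x), map_smul]
  rfl

/-- The natural map `H¹(X, L ⊗ ⊙^{m+1} N*) → H¹(X, L ⊗ ⊙^m N*) ⊗ V* = Hom(V, H¹(X, L ⊗ ⊙^m N*))`
induced by the contractions with the 1-jets of the elements of `V = H⁰(X, L)`. -/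
def H1contract (m : ℕ) : H1 E L (m + 1) →ₗ[ℂ] GlobalSections E L →ₗ[ℂ] H1 E L m :=
  LinearMap.mk₂ ℂ (fun h v => H1map (contractJet v m) (fun _ _ _ _ => rfl) h)
    (fun h h' _ => map_add _ h h') (fun c h _ => map_smul _ c h)
    (fun h v w => H1map_add _ _ _ _ _ _ (fun U φ => contractJet_add v w m U φ) h)
    (fun c h v => H1map_smul c _ _ _ _ (fun U φ => contractJet_smul c v m U φ) h)

end Action

section Hypotheses

variable (E : Type*) [NormedAddCommGroup E] [NormedSpace ℂ E]
  {X : Type u} [TopologicalSpace X] [ChartedSpace E X]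

variable (X) in
/-- A complex manifold is homogeneous if its biholomorphisms act transitively. -/
def Homogeneous : Prop :=
  ∀ x y : X, ∃ f : X ≃ₘ^ω⟮𝓘(ℂ, E), 𝓘(ℂ, E)⟯ X, f x = y

/-- A line bundle `L` on a compact complex manifold is very ample if the map
`x ↦ [s ↦ s(x)]`, `X → ℙ(V*)`, `V = H⁰(X, L)`, is a well-defined holomorphic embedding, i.e. `L` has
no base points, the map is injective, and it is an immersion: in the affine chart of `ℙ(V*)` given
by `s₀ ∈ V`, its components are the functions `s / s₀`, `s ∈ V`. -/
structure VeryAmple (L : X → Type u) [∀ x, AddCommGroup (L x)] [∀ x, Module ℂ (L x)]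
    [∀ x, TopologicalSpace (L x)] [TopologicalSpace (TotalSpace ℂ L)] [FiberBundle ℂ L] :
    Prop where
  exists_ne_zero : ∀ x : X, ∃ s : GlobalSections E L, s x ≠ 0
  separates_points : ∀ x y : X, x ≠ y → ∃ s : GlobalSections E L, s x = 0 ∧ s y ≠ 0
  immersive : ∀ (x : X) (s₀ : GlobalSections E L), s₀ x ≠ 0 →
    ∀ v : TangentSpace 𝓘(ℂ, E) x, v ≠ 0 →
      ∃ (s : GlobalSections E L) (h : X → ℂ), HolFunAt E h x ∧ (∀ᶠ y in 𝓝 x, s y = h y • s₀ y) ∧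
        mfderiv 𝓘(ℂ, E) 𝓘(ℂ, ℂ) h x v ≠ 0

end Hypotheses

end JetSpencer

end

open JetSpencer Bundle
open scoped Manifold ContDiff

universe u v

set_option linter.unusedSectionVars false

/-! Everything rests on one consequence of very ampleness: the evaluation `V ⊗ 𝒪 → N = J¹L` is
surjective, and near each point it has a holomorphic right inverse (`exists_taylor_eq`,
`exists_jet_frame`). Dually `N* ⊆ V* ⊗ 𝒪`, so a section of `L ⊗ ⊙^{m+1} N*` is determined by its
contractions with the jets of elements of `V`. Conversely, a linear family `β : V → Γ(U, L ⊗ ⊙^{m+1}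
N*)` with `β w (j¹v, …) = β v (j¹w, …)` comes from a section of `L ⊗ ⊙^{m+2} N*`
(`exists_contractJet_eq`).

For `U = X` this is the recursion that defines the prolongations, and `𝔤` is by definition the image
of `H⁰(X, L ⊗ N*)`; induction on the degree gives the first assertion (`range_toTensor`).

For the second, let `Z ⊆ L ⊗ ⊙^{m+1} N* ⊗ Λ²V*` be the sheaf of Spencer cocycles. The sequence `0 →
L ⊗ ⊙^{m+3} N* → L ⊗ ⊙^{m+2} N* ⊗ V* → Z → 0` is exact. On the left and in the middle this is the
determination and reconstruction of sections above. On the right it is the Poincaré lemma for a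
Koszul complex: an explicit primitive (`koszulPrimitive_spec`), formed with the local right inverse
and therefore holomorphic (`exists_local_primitive`).

By the first assertion, `H⁰` of the middle term is `𝔤^{(m+1)} ⊗ V*` and `H⁰(X, Z)` is the space of
cocycles in `𝔤^{(m)} ⊗ Λ²V*`, with the Spencer differential between them. Hence `H^{m+1,2}(𝔤)` is
the cokernel of `H⁰` of the middle term in `H⁰(X, Z)`. The long exact sequence identifies it with
the kernel of `H¹(L ⊗ ⊙^{m+3} N*) → H¹(L ⊗ ⊙^{m+2} N* ⊗ V*)`. As `V` is finite-dimensional, `⊗ V*`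
passes out of `H¹`.

Equivariance comes from the product rule `contractJet_lieDeriv`, by which each `D ∈ 𝔤` acts on the
whole short exact sequence, together with naturality of the connecting map. Finiteness of `V`
follows from compactness, the Schwarz lemma and a maximum argument
(`finiteDimensional_globalSections`). -/

noncomputable section

namespace JetSpencer

open Topology TopologicalSpace CategoryTheory

/-! ### Coordinates on 1-jets: the value and the derivative. -/

section LocalAnalysis

/-- First-order Taylor expansion of an analytic function with analytic remainder. -/
lemma _root_.AnalyticAt.exists_eq_add_clm_apply {E F : Type*} [NormedAddCommGroup E]
    [NormedSpace ℂ E] [NormedAddCommGroup F] [NormedSpace ℂ F] [CompleteSpace F] {f : E → F}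
    {z₀ : E} (hf : AnalyticAt ℂ f z₀) :
    ∃ g : E → E →L[ℂ] F, AnalyticAt ℂ g z₀ ∧ g z₀ = fderiv ℂ f z₀ ∧
      ∀ᶠ z in 𝓝 z₀, f z = f z₀ + g z (z - z₀) := by
  obtain ⟨p, r, hp⟩ := hf
  have hr : 0 < p.shift.radius := by
    rw [FormalMultilinearSeries.radius_shift]; exact hp.r_pos.trans_le hp.r_le
  have hg := (p.shift.hasFPowerSeriesOnBall hr).comp_sub z₀
  rw [zero_add] at hg
  set g : E → E →L[ℂ] F := fun z => p.shift.sum (z - z₀) with hgdef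
  have hga : AnalyticAt ℂ g z₀ := hg.analyticAt
  have hev : ∀ᶠ z in 𝓝 z₀, f z = f z₀ + g z (z - z₀) := by
    -- Here `g` is the sum of the series obtained from `p` by leaving one variable free. Feeding `z
    -- - z₀` into that variable and adding `f z₀` restores `p`, so both sides are sums of the same
    -- series on the smaller ball.
    have h1 := hg.unshift (z := f z₀)
    have hser : p.shift.unshift (f z₀) = p := by
      ext n v
      cases n with
      | zero => exact (hp.coeff_zero v).symm
      | succ n => simp [FormalMultilinearSeries.unshift, FormalMultilinearSeries.shift]
    rw [hser] at h1
    have h2 : ∀ᶠ z in 𝓝 z₀, z ∈ Metric.eball z₀ (min r p.shift.radius) :=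
      Metric.eball_mem_nhds _ (lt_min hp.r_pos hr)
    filter_upwards [h2] with z hz
    have e1 := hp.hasSum_sub (Metric.eball_subset_eball (min_le_left _ _) hz)
    have e2 := h1.hasSum_sub (Metric.eball_subset_eball (min_le_right _ _) hz)
    exact e1.unique e2
  refine ⟨g, hga, ?_, hev⟩
  have h3 : HasFDerivAt (fun z => f z₀ + g z (z - z₀)) (g z₀) z₀ := by
    have := (hga.differentiableAt.hasFDerivAt.clm_apply
      ((hasFDerivAt_id z₀).sub_const z₀)).const_add (f z₀)
    refine this.congr_fderiv ?_
    ext v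
    simp
  exact (h3.congr_of_eventuallyEq hev).fderiv.symm

variable {E : Type*} [NormedAddCommGroup E] [NormedSpace ℂ E]
  {X : Type u} [TopologicalSpace X] [ChartedSpace E X] [IsManifold 𝓘(ℂ, E) ω X]

/-- The chart stays that of `x₀` while `y` moves, so that a single chart serves a whole
neighbourhood; charts of the maximal atlas are analytic at every point of their source. -/
lemma holFunAt_iff_analyticAt {x₀ y : X} (hy : y ∈ (chartAt E x₀).source) {f : X → ℂ} :
    HolFunAt E f y ↔ AnalyticAt ℂ (f ∘ (chartAt E x₀).symm) (chartAt E x₀ y) := by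
  constructor
  · intro hf
    have h1 : ContMDiffAt 𝓘(ℂ, E) 𝓘(ℂ, E) ω (chartAt E x₀).symm (chartAt E x₀ y) :=
      contMDiffAt_symm_of_mem_maximalAtlas (IsManifold.chart_mem_maximalAtlas x₀)
        ((chartAt E x₀).map_source hy)
    have h2 : ContMDiffAt 𝓘(ℂ, E) 𝓘(ℂ, ℂ) ω f ((chartAt E x₀).symm (chartAt E x₀ y)) := by
      rwa [(chartAt E x₀).left_inv hy]
    exact (contMDiffAt_iff_contDiffAt.1 (h2.comp _ h1)).analyticAt
  · intro hf
    have h1 : ContMDiffAt 𝓘(ℂ, E) 𝓘(ℂ, E) ω (chartAt E x₀) y :=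
      contMDiffAt_of_mem_maximalAtlas (IsManifold.chart_mem_maximalAtlas x₀) hy
    have h2 := (contMDiffAt_iff_contDiffAt.2 (hf.contDiffAt (n := ω))).comp y h1
    refine h2.congr_of_eventuallyEq ?_
    filter_upwards [(chartAt E x₀).open_source.mem_nhds hy] with z hz
    simp [(chartAt E x₀).left_inv hz]

lemma HolFunAt.comp_chart {x₀ y : X} (hy : y ∈ (chartAt E x₀).source) {f : E → ℂ}
    (hf : AnalyticAt ℂ f (chartAt E x₀ y)) : HolFunAt E (fun z => f (chartAt E x₀ z)) y :=
  (contMDiffAt_iff_contDiffAt.2 (hf.contDiffAt (n := ω))).comp y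
    (contMDiffAt_of_mem_maximalAtlas (IsManifold.chart_mem_maximalAtlas x₀) hy)

variable {L : X → Type u} [∀ x, AddCommGroup (L x)] [∀ x, Module ℂ (L x)]
  [∀ x, TopologicalSpace (L x)] [TopologicalSpace (TotalSpace ℂ L)] [FiberBundle ℂ L]
  [VectorBundle ℂ ℂ L]

/-- The coordinate of an element of a fibre of `L` in the preferred trivialization at `x₀`. -/
def fibreCoord (x₀ : X) {y : X} (a : L y) : ℂ := (trivializationAt ℂ L x₀ ⟨y, a⟩).2

section

variable {x₀ y : X} (hy : y ∈ (trivializationAt ℂ L x₀).baseSet)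
include hy

lemma fibreCoord_add (a b : L y) :
    fibreCoord x₀ (a + b) = fibreCoord x₀ a + fibreCoord x₀ b :=
  ((trivializationAt ℂ L x₀).linear ℂ hy).map_add a b

lemma fibreCoord_smul (c : ℂ) (a : L y) : fibreCoord x₀ (c • a) = c * fibreCoord x₀ a :=
  ((trivializationAt ℂ L x₀).linear ℂ hy).map_smul c a

lemma fibreCoord_zero : fibreCoord x₀ (0 : L y) = 0 := by
  have := fibreCoord_smul hy 0 (0 : L y)
  simpa using this

lemma fibreCoord_smul_symm_one (a : L y) :
    fibreCoord x₀ a • (trivializationAt ℂ L x₀).symm y (1 : ℂ) = a := by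
  set t := trivializationAt ℂ L x₀
  have h1 : t.symm y ((t ⟨y, a⟩).2) = a := t.symm_apply_apply_mk hy a
  have h2 : t.symm y ((t ⟨y, a⟩).2 • (1 : ℂ)) = (t ⟨y, a⟩).2 • t.symm y (1 : ℂ) := by
    simpa only [Trivialization.symmₗ_apply _ hy] using (t.symmₗ ℂ y).map_smul (t ⟨y, a⟩).2 (1 : ℂ)
  rw [smul_eq_mul, mul_one, h1] at h2
  exact h2.symm

lemma fibreCoord_eq_zero_iff (a : L y) : fibreCoord x₀ a = 0 ↔ a = 0 := by
  refine ⟨fun h => ?_, fun h => by rw [h, fibreCoord_zero hy]⟩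
  rw [← fibreCoord_smul_symm_one hy a, h, zero_smul]

end

/-- The coordinate representation of a section of `L` in the preferred chart and trivialization
at `x₀`. -/
def localRep (x₀ : X) (s : ∀ y, L y) (z : E) : ℂ :=
  fibreCoord x₀ (s ((chartAt E x₀).symm z))

variable (E L) in
/-- The common domain of the preferred chart and trivialization at `x₀`. -/
def localDomain (x₀ : X) : Opens X :=
  ⟨(chartAt E x₀).source ∩ (trivializationAt ℂ L x₀).baseSet,
    (chartAt E x₀).open_source.inter (trivializationAt ℂ L x₀).open_baseSet⟩

lemma mem_localDomain (x₀ : X) : x₀ ∈ localDomain E L x₀ :=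
  ⟨mem_chart_source E x₀, mem_baseSet_trivializationAt ℂ L x₀⟩

lemma localRep_chart {x₀ y : X} (hy : y ∈ localDomain E L x₀) (s : ∀ y, L y) :
    localRep x₀ s (chartAt E x₀ y) = fibreCoord x₀ (s y) := by
  rw [localRep, (chartAt E x₀).left_inv hy.1]

/-- Near the image of a point of the local domain, the inverse chart takes values in the domain. -/
lemma eventually_chart_symm {x₀ y : X} (hy : y ∈ localDomain E L x₀) :
    ∀ᶠ z in 𝓝 (chartAt E x₀ y), (chartAt E x₀).symm z ∈ localDomain E L x₀ := by
  have hc : ContinuousAt (chartAt E x₀).symm (chartAt E x₀ y) :=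
    (chartAt E x₀).continuousAt_symm ((chartAt E x₀).map_source hy.1)
  refine hc.eventually ?_
  rw [(chartAt E x₀).left_inv hy.1]
  exact (localDomain E L x₀).isOpen.mem_nhds hy

variable [ContMDiffVectorBundle ω ℂ L 𝓘(ℂ, E)]

lemma holAt_iff_analyticAt {x₀ y : X} (hy : y ∈ localDomain E L x₀) {s : ∀ y, L y} :
    HolAt E L s y ↔ AnalyticAt ℂ (localRep x₀ s) (chartAt E x₀ y) := by
  rw [HolAt, (trivializationAt ℂ L x₀).contMDiffAt_section_iff hy.2]
  exact holFunAt_iff_analyticAt hy.1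

lemma localRep_add {x₀ y : X} (hy : y ∈ localDomain E L x₀) (s t : ∀ y, L y) :
    localRep x₀ (s + t) =ᶠ[𝓝 (chartAt E x₀ y)] localRep x₀ s + localRep x₀ t := by
  filter_upwards [eventually_chart_symm hy] with z hz using fibreCoord_add hz.2 _ _

lemma localRep_const_smul {x₀ y : X} (hy : y ∈ localDomain E L x₀) (c : ℂ) (s : ∀ y, L y) :
    localRep x₀ (c • s) =ᶠ[𝓝 (chartAt E x₀ y)] c • localRep x₀ s := by
  filter_upwards [eventually_chart_symm hy] with z hz using fibreCoord_smul hz.2 _ _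

lemma localRep_smul {x₀ y : X} (hy : y ∈ localDomain E L x₀) (f : X → ℂ) (s : ∀ y, L y) :
    localRep x₀ (fun y => f y • s y) =ᶠ[𝓝 (chartAt E x₀ y)]
      (f ∘ (chartAt E x₀).symm) * localRep x₀ s := by
  filter_upwards [eventually_chart_symm hy] with z hz using fibreCoord_smul hz.2 _ _

lemma localRep_congr {x₀ y : X} (hy : y ∈ localDomain E L x₀) {s t : ∀ y, L y}
    (h : ∀ᶠ z in 𝓝 y, s z = t z) :
    localRep x₀ s =ᶠ[𝓝 (chartAt E x₀ y)] localRep x₀ t := by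
  have hc : ContinuousAt (chartAt E x₀).symm (chartAt E x₀ y) :=
    (chartAt E x₀).continuousAt_symm ((chartAt E x₀).map_source hy.1)
  rw [← (chartAt E x₀).left_inv hy.1] at h
  filter_upwards [hc.eventually h] with z hz
  simp [localRep, hz]

variable (E) in
/-- The value and the derivative at the point `y` of a section near `y`, in local coordinates. -/
def taylor (x₀ y : X) (s : ∀ y, L y) : ℂ × (E →L[ℂ] ℂ) :=
  (localRep x₀ s (chartAt E x₀ y), fderiv ℂ (localRep x₀ s) (chartAt E x₀ y))

/-- `taylor` as a linear map. -/
def taylorₗ {x₀ y : X} (hy : y ∈ localDomain E L x₀) :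
    holSections E L y →ₗ[ℂ] ℂ × (E →L[ℂ] ℂ) where
  toFun s := taylor E x₀ y s.1
  map_add' s t := by
    have hs := ((holAt_iff_analyticAt hy).1 s.2).differentiableAt
    have ht := ((holAt_iff_analyticAt hy).1 t.2).differentiableAt
    have h := localRep_add hy s.1 t.1
    refine Prod.ext h.self_of_nhds ?_
    exact h.fderiv_eq.trans (fderiv_add hs ht)
  map_smul' c s := by
    have hs := ((holAt_iff_analyticAt hy).1 s.2).differentiableAt
    have h := localRep_const_smul hy c s.1
    refine Prod.ext h.self_of_nhds ?_
    exact h.fderiv_eq.trans (fderiv_const_smul hs c)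

/-- The Leibniz rule in coordinates. With `f` and `s` both zero at `y` it shows that `𝔪² · L` has no
1-jet; with `f = s / s₀` it later turns the immersion property into a statement about 1-jets. -/
lemma taylor_smul {x₀ y : X} (hy : y ∈ localDomain E L x₀) {f : X → ℂ} {s : ∀ y, L y}
    (hf : HolFunAt E f y) (hs : HolAt E L s y) :
    taylor E x₀ y (fun y => f y • s y) = f y • taylor E x₀ y s +
      (0, fibreCoord x₀ (s y) • fderiv ℂ (f ∘ (chartAt E x₀).symm) (chartAt E x₀ y)) := by
  have h := localRep_smul hy f s
  have hf' := ((holFunAt_iff_analyticAt hy.1).1 hf).differentiableAt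
  have hs' := ((holAt_iff_analyticAt hy).1 hs).differentiableAt
  refine Prod.ext ?_ ?_
  · simp [taylor, h.self_of_nhds, (chartAt E x₀).left_inv hy.1]
  · simp only [taylor]
    rw [h.fderiv_eq, fderiv_mul hf' hs']
    simp [(chartAt E x₀).left_inv hy.1, localRep_chart hy]

lemma vanishTwice_le_ker_taylorₗ {x₀ y : X} (hy : y ∈ localDomain E L x₀) :
    vanishTwice E L y ≤ LinearMap.ker (taylorₗ hy) := by
  refine Submodule.span_le.2 ?_
  rintro ⟨_, _⟩ ⟨f, g, s, hf, hg, hs, hf0, hg0, rfl⟩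
  change taylor E x₀ y (fun z => (f z * g z) • s z) = 0
  have e : (fun z => (f z * g z) • s z) = fun z => f z • (fun z => g z • s z) z := by
    ext z; rw [mul_smul]
  rw [e, taylor_smul hy hf (HolAt.smul hg hs), hf0, hg0, zero_smul,
    fibreCoord_zero hy.2]
  refine Prod.ext ?_ (ContinuousLinearMap.ext fun v => ?_) <;> simp

/-- The coordinate representation of 1-jets. -/
def jetCoord {x₀ y : X} (hy : y ∈ localDomain E L x₀) : Jet E L y →ₗ[ℂ] ℂ × (E →L[ℂ] ℂ) :=
  (vanishTwice E L y).liftQ (taylorₗ hy) (vanishTwice_le_ker_taylorₗ hy)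

lemma jetCoord_jet {x₀ y : X} (hy : y ∈ localDomain E L x₀) {s : ∀ y, L y} (hs : HolAt E L s y) :
    jetCoord hy (jet E L y s) = taylor E x₀ y s := by
  rw [jet_of_hol hs]; rfl

lemma holAt_symm_one {x₀ y : X} (hy : y ∈ localDomain E L x₀) :
    HolAt E L (fun z => (trivializationAt ℂ L x₀).symm z (1 : ℂ)) y := by
  rw [HolAt, (trivializationAt ℂ L x₀).contMDiffAt_section_iff hy.2]
  refine (contMDiffAt_const (c := (1 : ℂ))).congr_of_eventuallyEq ?_
  filter_upwards [(trivializationAt ℂ L x₀).open_baseSet.mem_nhds hy.2] with z hz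
  rw [(trivializationAt ℂ L x₀).apply_mk_symm hz]

variable [FiniteDimensional ℂ E]

/-- Hadamard's lemma: in coordinates `s = ∑ᵢ (z - z₀)ᵢ gᵢ(z)` with `gᵢ` analytic. Since the
derivative of `s` vanishes, so does each `gᵢ(z₀)`, and every summand lies in `𝔪² · L`. -/
lemma jet_eq_zero_of_taylor {x₀ y : X} (hy : y ∈ localDomain E L x₀) {s : ∀ y, L y}
    (hs : HolAt E L s y) (h : taylor E x₀ y s = 0) : jet E L y s = 0 := by
  obtain ⟨g, hg, hg0, hev⟩ := ((holAt_iff_analyticAt hy).1 hs).exists_eq_add_clm_apply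
  have h1 : localRep x₀ s (chartAt E x₀ y) = 0 := congrArg Prod.fst h
  have h2 : fderiv ℂ (localRep x₀ s) (chartAt E x₀ y) = 0 := congrArg Prod.snd h
  rw [h2] at hg0
  rw [h1] at hev
  set z₀ := chartAt E x₀ y
  let b := Module.finBasis ℂ E
  have hb : ∀ i, AnalyticAt ℂ (fun z => b.repr (z - z₀) i) z₀ := fun i => by
    have : (fun z => b.repr (z - z₀) i) =
        fun z => (LinearMap.toContinuousLinearMap (b.coord i)) (z - z₀) := rfl
    rw [this]
    exact (ContinuousLinearMap.analyticAt _ _).comp (analyticAt_id.sub analyticAt_const)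
  have hgi : ∀ i, AnalyticAt ℂ (fun z => g z (b i)) z₀ := fun i =>
    ((ContinuousLinearMap.apply ℂ ℂ (b i)).analyticAt _).comp hg
  set σ : ∀ y, L y := fun z => (trivializationAt ℂ L x₀).symm z (1 : ℂ)
  have hσ : HolAt E L σ y := holAt_symm_one hy
  set φ := chartAt E x₀
  let t : Fin (Module.finrank ℂ E) → ∀ y, L y := fun i y' =>
    (b.repr (φ y' - z₀) i * g (φ y') (b i)) • σ y'
  have ht : ∀ i, HolAt E L (t i) y := fun i =>
    HolAt.smul (ContMDiffAt.mul (HolFunAt.comp_chart hy.1 (hb i))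
      (HolFunAt.comp_chart hy.1 (hgi i))) hσ
  have hjt : ∀ i, jet E L y (t i) = 0 := fun i =>
    jet_mul_mul (HolFunAt.comp_chart hy.1 (hb i)) (HolFunAt.comp_chart hy.1 (hgi i)) hσ
      (by simp [z₀, φ]) (by change g z₀ (b i) = 0; simp [hg0])
  have hsum : ∀ S : Finset (Fin (Module.finrank ℂ E)), jet E L y (∑ i ∈ S, t i) = 0 := by
    intro S
    induction S using Finset.induction_on with
    | empty => simpa using jet_eq_zero (x := y) (s := (0 : ∀ y, L y)) (by simp)
    | insert i S hi ih =>
      rw [Finset.sum_insert hi, jet_add (ht i) (HolAt.sum fun j _ => ht j), hjt, ih, add_zero]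
  rw [← hsum Finset.univ]
  refine jet_congr ?_
  have hc : ContinuousAt φ y := φ.continuousAt hy.1
  filter_upwards [hc.eventually hev, (localDomain E L x₀).isOpen.mem_nhds hy] with z hz hz'
  rw [localRep_chart hz', zero_add] at hz
  rw [← fibreCoord_smul_symm_one hz'.2 (s z), hz, Finset.sum_apply, ← Finset.sum_smul]
  congr 1
  conv_lhs => rw [← b.sum_repr (φ z - z₀)]
  simp

lemma jetCoord_injective {x₀ y : X} (hy : y ∈ localDomain E L x₀) :
    Function.Injective (jetCoord hy) := by
  rw [injective_iff_map_eq_zero]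
  intro q hq
  obtain ⟨s, hs, rfl⟩ := exists_jet_eq q
  rw [jetCoord_jet hy hs] at hq
  exact jet_eq_zero_of_taylor hy hs hq

end LocalAnalysis

end JetSpencer

end

noncomputable section

namespace JetSpencer

open Topology TopologicalSpace CategoryTheory

/-! ### Global sections generate the 1-jets, with holomorphic local right inverses. -/

section Frame

/-- Vectors depending analytically on a parameter and forming a basis at a point form a basis at
all near points, and coordinates with respect to it depend analytically on the parameter. -/
lemma exists_analytic_coords {E M : Type*} [NormedAddCommGroup E] [NormedSpace ℂ E]
    [NormedAddCommGroup M] [NormedSpace ℂ M] [FiniteDimensional ℂ M] {n : ℕ}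
    (b : Module.Basis (Fin n) ℂ M) {t : Fin n → E → M} {z₀ : E} (hb : ∀ i, t i z₀ = b i)
    (ht : ∀ i, ContinuousAt (t i) z₀) :
    ∃ c : E → M →ₗ[ℂ] (Fin n → ℂ), ∀ᶠ z in 𝓝 z₀, (∀ m, ∑ i, c z m i • t i z = m) ∧
      ((∀ i, AnalyticAt ℂ (t i) z) → ∀ g : E → M, AnalyticAt ℂ g z →
        ∀ i, AnalyticAt ℂ (fun z' => c z' (g z') i) z) := by
  have : CompleteSpace M := FiniteDimensional.complete ℂ M
  let S (i : Fin n) : M →L[ℂ] (Fin n → ℂ) →L[ℂ] M :=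
    ContinuousLinearMap.smulRightL ℂ (Fin n → ℂ) M (ContinuousLinearMap.proj i)
  -- `A z` maps coordinates to the combination of the vectors `t i z`. It is invertible at `z₀`,
  -- hence nearby, and inversion of operators is analytic there; where `A z` is not invertible,
  -- `inverse` has the default value 0, which is never used.
  let A : E → (Fin n → ℂ) →L[ℂ] M := fun z => ∑ i, S i (t i z)
  have hAc : ∀ z c, A z c = ∑ i, c i • t i z := fun z c => by
    simp only [A, sum_apply]; rfl
  let B : (Fin n → ℂ) ≃L[ℂ] M := b.equivFun.symm.toContinuousLinearEquiv
  have hA0 : A z₀ = B := by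
    ext1 c
    rw [hAc]
    change _ = b.equivFun.symm c
    rw [Module.Basis.equivFun_symm_apply]
    simp only [hb]
  have hcont : ContinuousAt A z₀ :=
    tendsto_finsetSum _ fun i _ => ((S i).continuous.continuousAt.comp (ht i)).tendsto
  have hinv : ∀ᶠ z in 𝓝 z₀, (A z).IsInvertible := by
    have h1 := hcont.tendsto
    rw [hA0] at h1
    exact h1.eventually (ContinuousLinearEquiv.nhds B)
  refine ⟨fun z => (A z).inverse, hinv.mono fun z hz => ⟨fun m => ?_, fun hta g hg i => ?_⟩⟩
  · refine (hAc z _).symm.trans ?_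
    obtain ⟨B', hB'⟩ := hz
    change A z ((A z).inverse m) = m
    rw [← hB', ContinuousLinearMap.inverse_equiv]
    simp
  · have hA : AnalyticAt ℂ A z := Finset.analyticAt_fun_sum _ fun i _ =>
      ((S i).analyticAt _).comp (hta i)
    have h2 : AnalyticAt ℂ (fun z => (A z).inverse) z :=
      AnalyticAt.comp (g := ContinuousLinearMap.inverse)
        (hz.contDiffAt_map_inverse (n := ω)).analyticAt hA
    have h3 : AnalyticAt ℂ (fun z => (A z).inverse (g z)) z :=
      ((h2.contDiffAt (n := ω)).clm_apply hg.contDiffAt).analyticAt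
    exact ((ContinuousLinearMap.proj (R := ℂ) (φ := fun _ : Fin n => ℂ) i).analyticAt _).comp h3

variable {E : Type*} [NormedAddCommGroup E] [NormedSpace ℂ E]
  {X : Type u} [TopologicalSpace X] [ChartedSpace E X] [IsManifold 𝓘(ℂ, E) ω X]
  {L : X → Type u} [∀ x, AddCommGroup (L x)] [∀ x, Module ℂ (L x)]
  [∀ x, TopologicalSpace (L x)] [TopologicalSpace (TotalSpace ℂ L)] [FiberBundle ℂ L]
  [VectorBundle ℂ ℂ L] [ContMDiffVectorBundle ω ℂ L 𝓘(ℂ, E)]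

lemma mfderiv_eq_fderiv_chart {x : X} {h : X → ℂ} (hh : HolFunAt E h x) (v : E) :
    mfderiv 𝓘(ℂ, E) 𝓘(ℂ, ℂ) h x v =
      fderiv ℂ (h ∘ (chartAt E x).symm) (chartAt E x x) v := by
  have hd : MDifferentiableAt 𝓘(ℂ, E) 𝓘(ℂ, ℂ) h x := ContMDiffAt.mdifferentiableAt hh (by simp)
  refine (DFunLike.congr_fun hd.mfderiv v).trans ?_
  change fderivWithin ℂ (writtenInExtChartAt 𝓘(ℂ, E) 𝓘(ℂ, ℂ) x h) _ _ v = _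
  simp only [writtenInExtChartAt, mfld_simps, fderivWithin_univ]
  rfl

/-- The 1-jet of a section at a point of `X`, as a function in the chart at `x₀`. -/
def taylorFun (x₀ : X) (s : ∀ y, L y) (z : E) : ℂ × (E →L[ℂ] ℂ) :=
  (localRep x₀ s z, fderiv ℂ (localRep x₀ s) z)

lemma analyticAt_taylorFun {x₀ y : X} (hy : y ∈ localDomain E L x₀) {s : ∀ y, L y}
    (hs : HolAt E L s y) : AnalyticAt ℂ (taylorFun x₀ s) (chartAt E x₀ y) := by
  have h := (holAt_iff_analyticAt hy).1 hs
  exact h.prod h.fderiv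

variable [FiniteDimensional ℂ E]

/-- Duality: a functional killing all global 1-jets has the form `q ↦ a q₁ + q₂(v)` with `v ∈ E`.
Applied to `s = h s₀` with `s₀ x ≠ 0` it gives `s₀(x) · dh(v) = 0`, so the immersion property forces
`v = 0`; then `s₀` itself forces `a = 0`. -/
lemma exists_taylor_eq (hL : VeryAmple E L) (x : X) (p : ℂ × (E →L[ℂ] ℂ)) :
    ∃ s : GlobalSections E L, taylor E x x s = p := by
  have hx := mem_localDomain (E := E) (L := L) x
  let Γ : GlobalSections E L →ₗ[ℂ] ℂ × (E →L[ℂ] ℂ) :=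
    taylorₗ hx ∘ₗ
      { toFun := fun s => ⟨s, s.hol x⟩
        map_add' := fun s t => rfl
        map_smul' := fun c s => rfl }
  suffices h : LinearMap.range Γ = ⊤ from LinearMap.range_eq_top.1 h p
  by_contra hne
  obtain ⟨f, hf0, hf⟩ := Submodule.exists_le_ker_of_lt_top _ (lt_top_iff_ne_top.2 hne)
  have hΓ : ∀ s : GlobalSections E L, f (taylor E x x s) = 0 := fun s => hf ⟨s, rfl⟩
  -- Restricted to covectors, `f` is an element of the bidual of `E`, that is, evaluation at a
  -- vector.
  let f₂ : Module.Dual ℂ (Module.Dual ℂ E) :=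
    f ∘ₗ LinearMap.inr ℂ ℂ (E →L[ℂ] ℂ) ∘ₗ
      (LinearMap.toContinuousLinearMap : (E →ₗ[ℂ] ℂ) ≃ₗ[ℂ] (E →L[ℂ] ℂ)).toLinearMap
  obtain ⟨v, hv⟩ := (Module.evalEquiv ℂ E).surjective f₂
  have hv' : ∀ l : E →L[ℂ] ℂ, f (0, l) = l v := by
    intro l
    have := LinearMap.congr_fun hv (l : E →ₗ[ℂ] ℂ)
    exact this.symm
  have hfp : ∀ q : ℂ × (E →L[ℂ] ℂ), f q = q.1 * f (1, 0) + q.2 v := by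
    intro q
    have : q = q.1 • ((1 : ℂ), (0 : E →L[ℂ] ℂ)) + (0, q.2) := by
      refine Prod.ext ?_ (ContinuousLinearMap.ext fun w => ?_) <;> simp
    conv_lhs => rw [this]
    rw [map_add, map_smul, hv', smul_eq_mul]
  obtain ⟨s₀, hs₀⟩ := hL.exists_ne_zero x
  have hv0 : v = 0 := by
    by_contra hv0
    obtain ⟨s, h, hh, hs, hd⟩ := hL.immersive x s₀ hs₀ v hv0
    refine hd ?_
    rw [mfderiv_eq_fderiv_chart hh]
    have h1 := hΓ s
    have h2 : taylor E x x s = taylor E x x (fun y => h y • s₀ y) := by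
      have := localRep_congr hx hs
      exact Prod.ext this.self_of_nhds this.fderiv_eq
    rw [h2, taylor_smul hx hh (s₀.hol x), map_add, map_smul, hΓ s₀, smul_zero, zero_add, hv'] at h1
    have h3 : fibreCoord x (s₀ x) ≠ 0 := fun h => hs₀ ((fibreCoord_eq_zero_iff hx.2 _).1 h)
    exact (mul_eq_zero.1 h1).resolve_left h3
  have hf1 : f (1, 0) = 0 := by
    have h1 := hΓ s₀
    rw [hfp, hv0, map_zero, add_zero] at h1
    refine (mul_eq_zero.1 h1).resolve_left ?_
    simp only [taylor]
    rw [localRep_chart hx, fibreCoord_eq_zero_iff hx.2]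
    exact hs₀
  exact hf0 (LinearMap.ext fun q => by simp [hfp q, hf1, hv0])

/-- Locally, the surjection `V ⊗ 𝒪 → J¹L` has a holomorphic right inverse. -/
theorem exists_jet_frame (hL : VeryAmple E L) (x₀ : X) :
    ∃ (U : Opens X) (n : ℕ) (e : Fin n → GlobalSections E L)
      (a : ∀ y, Jet E L y →ₗ[ℂ] (Fin n → ℂ)), x₀ ∈ U ∧
      (∀ y ∈ U, ∀ q, ∑ i, a y q i • jet E L y (e i) = q) ∧
      ∀ y ∈ U, ∀ s, HolAt E L s y → ∀ i, HolFunAt E (fun z => a z (jet E L z s) i) y := by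
  classical
  let b := Module.finBasis ℂ (ℂ × (E →L[ℂ] ℂ))
  -- Global sections whose 1-jets form a basis at `x₀`; by continuity they form a frame of `J¹L`
  -- near `x₀`, and `a` gives the coordinates with respect to it.
  choose e he using fun i => exists_taylor_eq hL x₀ (b i)
  have hx := mem_localDomain (E := E) (L := L) x₀
  obtain ⟨c, hc⟩ := exists_analytic_coords b (t := fun i => taylorFun x₀ (e i)) he
    fun i => (analyticAt_taylorFun hx ((e i).hol x₀)).continuousAt
  obtain ⟨W, hW, hWo, hxW⟩ := eventually_nhds_iff.1
    ((((chartAt E x₀).continuousAt hx.1).eventually hc).and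
      ((localDomain E L x₀).isOpen.mem_nhds hx))
  let a : ∀ y, Jet E L y →ₗ[ℂ] (Fin _ → ℂ) := fun y =>
    if hy : y ∈ localDomain E L x₀ then c (chartAt E x₀ y) ∘ₗ jetCoord hy else 0
  have ha : ∀ y (hy : y ∈ localDomain E L x₀) q,
      a y q = c (chartAt E x₀ y) (jetCoord hy q) := by
    intro y hy q
    simp only [a]
    rw [dif_pos hy]; rfl
  refine ⟨⟨W, hWo⟩, _, e, a, hxW, fun y hy q => ?_, fun y hy s hs i => ?_⟩
  · obtain ⟨⟨h1, -⟩, hyd⟩ := hW y hy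
    have hyd : y ∈ localDomain E L x₀ := hyd
    apply jetCoord_injective hyd
    rw [map_sum]
    refine Eq.trans (Finset.sum_congr rfl fun i _ => ?_) (h1 (jetCoord hyd q))
    rw [map_smul, jetCoord_jet hyd ((e i).hol y), ha y hyd]
    rfl
  · obtain ⟨⟨-, h2⟩, hyd⟩ := hW y hy
    have hyd : y ∈ localDomain E L x₀ := hyd
    refine (HolFunAt.comp_chart hyd.1 (h2 (fun j => analyticAt_taylorFun hyd ((e j).hol y)) _
      (analyticAt_taylorFun hyd hs) i)).congr_of_eventuallyEq ?_
    filter_upwards [(localDomain E L x₀).isOpen.mem_nhds hyd, hs.eventually] with z hz hzs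
    rw [ha z hz, jetCoord_jet hz hzs]
    rfl

/-- The 1-jets of global sections of a very ample bundle generate all 1-jets. -/
lemma exists_globalSection_jet_eq (hL : VeryAmple E L) {x : X} (q : Jet E L x) :
    ∃ s : GlobalSections E L, jet E L x s = q := by
  obtain ⟨s, hs, rfl⟩ := exists_jet_eq q
  have hx := mem_localDomain (E := E) (L := L) x
  obtain ⟨t, ht⟩ := exists_taylor_eq hL x (taylor E x x s)
  exact ⟨t, jetCoord_injective hx (by rw [jetCoord_jet hx hs, jetCoord_jet hx (t.hol x), ht])⟩

end Frame

end JetSpencer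

end

noncomputable section

namespace JetSpencer

open Topology TopologicalSpace CategoryTheory

/-! ### Finite-dimensionality of `V`. -/

section Finiteness

variable {E : Type*} [NormedAddCommGroup E] [NormedSpace ℂ E]
  {X : Type u} [TopologicalSpace X] [ChartedSpace E X] [IsManifold 𝓘(ℂ, E) ω X]
  {L : X → Type u} [∀ x, AddCommGroup (L x)] [∀ x, Module ℂ (L x)]
  [∀ x, TopologicalSpace (L x)] [TopologicalSpace (TotalSpace ℂ L)] [FiberBundle ℂ L]
  [VectorBundle ℂ ℂ L] [ContMDiffVectorBundle ω ℂ L 𝓘(ℂ, E)]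

/-- The norm of `a ∈ L_y` in the metric on `L` defined by finitely many sections without common
zeros. -/
def fibreNorm (S : Finset (GlobalSections E L)) {y : X} (a : L y) : ℝ :=
  ‖fibreCoord y a‖ / ∑ j ∈ S, ‖fibreCoord y (j y)‖

/-- Two trivializations differ on the fibre by a nonzero factor, which cancels in the quotient. Any
trivialization around `y` may thus be used for computing the norm. -/
lemma fibreNorm_eq (S : Finset (GlobalSections E L)) {x₀ y : X}
    (hy : y ∈ (trivializationAt ℂ L x₀).baseSet) (a : L y) :
    fibreNorm S a = ‖fibreCoord x₀ a‖ / ∑ j ∈ S, ‖fibreCoord x₀ (j y)‖ := by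
  have hy' := mem_baseSet_trivializationAt ℂ L y
  set c : ℂ := fibreCoord y ((trivializationAt ℂ L x₀).symm y (1 : ℂ)) with hc
  have key : ∀ b : L y, fibreCoord y b = fibreCoord x₀ b * c := fun b => by
    rw [hc, ← fibreCoord_smul hy', fibreCoord_smul_symm_one hy]
  have hc0 : c ≠ 0 := by
    intro h0
    have h1 : (trivializationAt ℂ L x₀).symm y (1 : ℂ) = 0 :=
      (fibreCoord_eq_zero_iff hy' _).1 h0
    have h2 := (trivializationAt ℂ L x₀).apply_mk_symm hy (1 : ℂ)
    rw [h1] at h2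
    have h3 := congrArg Prod.snd h2
    change fibreCoord x₀ (0 : L y) = 1 at h3
    rw [fibreCoord_zero hy] at h3
    exact zero_ne_one h3
  simp only [fibreNorm, key, norm_mul, ← Finset.sum_mul]
  rw [mul_div_mul_right _ _ (norm_ne_zero_iff.2 hc0)]

lemma GlobalSections.continuousAt_fibreCoord (s : GlobalSections E L) {x₀ y : X}
    (hy : y ∈ (trivializationAt ℂ L x₀).baseSet) :
    ContinuousAt (fun z => fibreCoord x₀ (s z)) y := by
  have h := s.hol y
  rw [HolAt, (trivializationAt ℂ L x₀).contMDiffAt_section_iff hy] at h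
  exact h.continuousAt

lemma GlobalSections.eventually_ne_zero (s : GlobalSections E L) {x : X} (hs : s x ≠ 0) :
    ∀ᶠ y in 𝓝 x, s y ≠ 0 := by
  have hx := mem_baseSet_trivializationAt ℂ L x
  have h1 : fibreCoord x (s x) ≠ 0 := fun h => hs ((fibreCoord_eq_zero_iff hx _).1 h)
  filter_upwards [(s.continuousAt_fibreCoord hx).eventually_ne h1,
    (trivializationAt ℂ L x).open_baseSet.mem_nhds hx] with y hy hyb h0
  rw [h0, fibreCoord_zero hyb] at hy
  exact hy rfl

lemma sum_norm_fibreCoord_pos {S : Finset (GlobalSections E L)} {x₀ y : X}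
    (hy : y ∈ (trivializationAt ℂ L x₀).baseSet) (hS : ∃ s ∈ S, s y ≠ 0) :
    0 < ∑ j ∈ S, ‖fibreCoord x₀ (j y)‖ := by
  obtain ⟨s, hsS, hs⟩ := hS
  refine Finset.sum_pos' (fun _ _ => norm_nonneg _) ⟨s, hsS, norm_pos_iff.2 fun h => hs ?_⟩
  exact (fibreCoord_eq_zero_iff hy _).1 h

lemma continuous_fibreNorm {S : Finset (GlobalSections E L)} (hS : ∀ x, ∃ s ∈ S, s x ≠ 0)
    (s : GlobalSections E L) : Continuous fun y => fibreNorm S (s y) := by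
  rw [continuous_iff_continuousAt]
  intro x
  have hx := mem_baseSet_trivializationAt ℂ L x
  have h1 : ContinuousAt (fun y => ‖fibreCoord x (s y)‖ / ∑ j ∈ S, ‖fibreCoord x (j y)‖) x :=
    (s.continuousAt_fibreCoord hx).norm.div
      (tendsto_finsetSum _ fun j _ => (GlobalSections.continuousAt_fibreCoord j hx).norm)
      (sum_norm_fibreCoord_pos hx (hS x)).ne'
  refine h1.congr ?_
  filter_upwards [(trivializationAt ℂ L x).open_baseSet.mem_nhds hx] with y hy
  exact (fibreNorm_eq S hy _).symm

lemma fibreNorm_nonneg (S : Finset (GlobalSections E L)) {y : X} (a : L y) : 0 ≤ fibreNorm S a :=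
  div_nonneg (norm_nonneg _) (Finset.sum_nonneg fun _ _ => norm_nonneg _)

/-- Near a zero a section is small compared with its maximum, by the Schwarz lemma. -/
lemma exists_nhds_fibreNorm_le {S : Finset (GlobalSections E L)} (hS : ∀ x, ∃ s ∈ S, s x ≠ 0)
    (p : X) : ∃ W ∈ 𝓝 p, ∀ (s : GlobalSections E L) (M : ℝ), (∀ y, fibreNorm S (s y) ≤ M) →
      s p = 0 → ∀ y ∈ W, fibreNorm S (s y) ≤ M / 2 := by
  have hp := mem_localDomain (E := E) (L := L) p
  set φ := chartAt E p
  set z₀ := φ p with hz₀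
  let G : E → ℝ := fun z => ∑ j ∈ S, ‖localRep p j z‖
  have hGc : ContinuousAt G z₀ := tendsto_finsetSum _ fun j _ =>
    ((holAt_iff_analyticAt hp).1 (GlobalSections.hol j p)).continuousAt.norm
  have hG : ∀ y ∈ localDomain E L p, G (φ y) = ∑ j ∈ S, ‖fibreCoord p (j y)‖ := fun y hy =>
    Finset.sum_congr rfl fun j _ => by rw [localRep_chart hy]
  set g := G z₀ with hg
  have hg0 : 0 < g := by
    rw [hg, hG p hp]; exact sum_norm_fibreCoord_pos hp.2 (hS p)
  -- The weight `G` stays within a factor 2 of `g`, which controls the passage between the norm and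
  -- the absolute value of the local coordinate.
  have hev : ∀ᶠ z in 𝓝 z₀, (φ.symm z ∈ localDomain E L p ∧ z ∈ φ.target) ∧ g / 2 < G z ∧
      G z < 2 * g :=
    ((eventually_chart_symm hp).and (φ.open_target.mem_nhds (φ.map_source hp.1))).and
      ((hGc.eventually (lt_mem_nhds (by linarith))).and
        (hGc.eventually (gt_mem_nhds (by linarith))))
  obtain ⟨r, hr, hball⟩ := Metric.eventually_nhds_iff_ball.1 hev
  -- The radius `r / 8` is fixed by the constants: the coordinate is at most `2gM` on the ball of
  -- radius `r`, so by Schwarz at most `gM/4` on the smaller one, and division by `G > g/2` leaves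
  -- `M/2`. The neighbourhood does not depend on `s`.
  refine ⟨φ.source ∩ φ ⁻¹' Metric.ball z₀ (r / 8), Filter.inter_mem
    (φ.open_source.mem_nhds hp.1) ((φ.continuousAt hp.1).preimage_mem_nhds
      (Metric.ball_mem_nhds _ (by positivity))), ?_⟩
  rintro s M hM hs y ⟨hys, hyb⟩
  have hM0 : 0 ≤ M := (fibreNorm_nonneg S _).trans (hM p)
  have hbound : ∀ z ∈ Metric.ball z₀ r, ‖localRep p s z‖ = fibreNorm S (s (φ.symm z)) * G z := by
    intro z hz
    obtain ⟨⟨h1, h2⟩, h3, h4⟩ := hball z hz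
    have h5 : G z = ∑ j ∈ S, ‖fibreCoord p (j (φ.symm z))‖ := by
      rw [← hG _ h1, φ.right_inv h2]
    rw [fibreNorm_eq S h1.2, ← h5, div_mul_cancel₀ _ (by linarith [hg0] : G z > 0).ne']
    rfl
  have hd : DifferentiableOn ℂ (localRep p s) (Metric.ball z₀ r) := by
    intro z hz
    obtain ⟨⟨h1, h2⟩, -⟩ := hball z hz
    have h3 := (holAt_iff_analyticAt h1).1 (s.hol _)
    rw [φ.right_inv h2] at h3
    exact h3.differentiableAt.differentiableWithinAt
  have h0 : localRep p s z₀ = 0 := by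
    rw [hz₀, localRep_chart hp, hs, fibreCoord_zero hp.2]
  have hmaps : Set.MapsTo (localRep p s) (Metric.ball z₀ r)
      (Metric.closedBall (localRep p s z₀) (2 * g * M)) := by
    intro z hz
    obtain ⟨-, h3, h4⟩ := hball z hz
    rw [h0, mem_closedBall_zero_iff, hbound z hz]
    nlinarith [hM (φ.symm z), fibreNorm_nonneg S (s (φ.symm z))]
  have hyr : φ y ∈ Metric.ball z₀ r := Metric.ball_subset_ball (by linarith) hyb
  have hschwarz := Complex.dist_le_div_mul_dist_of_mapsTo_ball hd hmaps hyr
  rw [h0, dist_zero_right, hbound _ hyr, φ.left_inv hys] at hschwarz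
  obtain ⟨-, h3, -⟩ := hball _ hyr
  have h5 : 2 * g * M / r * dist (φ y) z₀ ≤ g * M / 4 := by
    have h6 : dist (φ y) z₀ ≤ r / 8 := (Metric.mem_ball.1 hyb).le
    calc 2 * g * M / r * dist (φ y) z₀ ≤ 2 * g * M / r * (r / 8) := by gcongr
      _ = g * M / 4 := by field_simp; ring
  have h7 : fibreNorm S (s y) * (g / 2) ≤ g * M / 4 := by
    nlinarith [fibreNorm_nonneg S (s y)]
  nlinarith

/-- The space of sections of a base point free line bundle on a compact manifold is
finite-dimensional. -/
theorem finiteDimensional_globalSections [CompactSpace X]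
    (hL : ∀ x : X, ∃ s : GlobalSections E L, s x ≠ 0) :
    FiniteDimensional ℂ (GlobalSections E L) := by
  classical
  obtain ⟨S, hS⟩ : ∃ S : Finset (GlobalSections E L), ∀ x, ∃ s ∈ S, s x ≠ 0 := by
    choose s hs using hL
    obtain ⟨t, -, ht⟩ := isCompact_univ.elim_nhds_subcover (fun x => {y | s x y ≠ 0})
      fun x _ => (s x).eventually_ne_zero (hs x)
    refine ⟨t.image s, fun x => ?_⟩
    obtain ⟨i, hi, hx⟩ := Set.mem_iUnion₂.1 (ht (Set.mem_univ x))
    exact ⟨s i, Finset.mem_image_of_mem s hi, hx⟩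
  choose W hW hWs using exists_nhds_fibreNorm_le hS
  obtain ⟨t, -, ht⟩ := isCompact_univ.elim_nhds_subcover W fun x _ => hW x
  -- Evaluation at the centres of a finite cover by the neighbourhoods `W p`. It is injective: if
  -- `s` vanishes at all the centres, then the maximum of its norm is at most half of itself.
  let ev : GlobalSections E L →ₗ[ℂ] (t → ℂ) :=
    { toFun := fun s p => fibreCoord (p : X) (s p)
      map_add' := fun s s' => funext fun p =>
        fibreCoord_add (mem_baseSet_trivializationAt ℂ L _) _ _
      map_smul' := fun c s => funext fun p =>
        fibreCoord_smul (mem_baseSet_trivializationAt ℂ L _) _ _ }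
  refine Module.Finite.of_injective ev ((injective_iff_map_eq_zero ev).2 fun s hs => ?_)
  rcases isEmpty_or_nonempty X with hX | hX
  · ext x; exact hX.elim x
  obtain ⟨x₁, -, hx₁⟩ := isCompact_univ.exists_isMaxOn Set.univ_nonempty
    (continuous_fibreNorm hS s).continuousOn
  have hmax : ∀ y, fibreNorm S (s y) ≤ fibreNorm S (s x₁) := fun y => hx₁ (Set.mem_univ y)
  have hzero : fibreNorm S (s x₁) = 0 := by
    obtain ⟨p, hp, hx⟩ := Set.mem_iUnion₂.1 (ht (Set.mem_univ x₁))
    have hsp : s p = 0 := (fibreCoord_eq_zero_iff (mem_baseSet_trivializationAt ℂ L p) _).1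
      (congrFun hs ⟨p, hp⟩)
    have h1 := hWs p s _ hmax hsp x₁ hx
    have h2 := fibreNorm_nonneg S (s x₁)
    linarith
  ext y
  have hy := mem_baseSet_trivializationAt ℂ L y
  have h1 : fibreNorm S (s y) = 0 :=
    le_antisymm ((hmax y).trans hzero.le) (fibreNorm_nonneg S _)
  rw [fibreNorm, div_eq_zero_iff] at h1
  refine (fibreCoord_eq_zero_iff hy _).1 (norm_eq_zero.1 (h1.resolve_right ?_))
  exact (sum_norm_fibreCoord_pos hy (hS y)).ne'

end Finiteness

end JetSpencer

end

noncomputable section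

namespace JetSpencer

open Topology TopologicalSpace CategoryTheory

/-! ### Sections reconstructed from contractions; the prolongations as spaces of global sections. -/

section Contractions

/-- A function of `m + 2` variables is symmetric if it is symmetric in the last `m + 1` and in the
first two variables. -/
lemma symmetric_of_cons {m : ℕ} {J M : Type*} (T : (Fin (m + 2) → J) → M)
    (h₁ : ∀ (a : J) (σ : Equiv.Perm (Fin (m + 1))) (q : Fin (m + 1) → J),
      T (Fin.cons a (q ∘ σ)) = T (Fin.cons a q))
    (h₂ : ∀ (a b : J) (q : Fin m → J), T (Fin.cons a (Fin.cons b q)) =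
      T (Fin.cons b (Fin.cons a q)))
    (σ : Equiv.Perm (Fin (m + 2))) (q : Fin (m + 2) → J) : T (q ∘ σ) = T q := by
  -- Adjacent transpositions generate the symmetric group. The first one is `h₂`; the others fix the
  -- position 0 and fall under `h₁`.
  have hσ : σ ∈ Submonoid.closure
      (Set.range fun i : Fin (m + 1) => Equiv.swap i.castSucc i.succ) := by
    rw [Equiv.Perm.mclosure_swap_castSucc_succ]; trivial
  induction hσ using Submonoid.closure_induction generalizing q with
  | one => rfl
  | mul σ τ _ _ h1 h2 =>
    rw [Equiv.Perm.coe_mul, ← Function.comp_assoc, h2, h1]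
  | mem σ h =>
    obtain ⟨i, rfl⟩ := h
    induction i using Fin.cases with
    | zero =>
      have e : q = Fin.cons (q 0) (Fin.cons (q 1) (Fin.tail (Fin.tail q))) := by
        conv_lhs => rw [← Fin.cons_self_tail q, ← Fin.cons_self_tail (Fin.tail q)]
        rfl
      have e' : q ∘ Equiv.swap (Fin.castSucc (0 : Fin (m + 1))) (Fin.succ 0) =
          Fin.cons (q 1) (Fin.cons (q 0) (Fin.tail (Fin.tail q))) := by
        ext j
        refine Fin.cases ?_ (fun j => Fin.cases ?_ (fun j => ?_) j) j
        · simp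
        · simp
        · have h1 : (Fin.succ (Fin.succ j) : Fin (m + 2)) ≠ 0 := Fin.succ_ne_zero _
          have h2 : (Fin.succ (Fin.succ j) : Fin (m + 2)) ≠ 1 := by
            intro h; exact Fin.succ_ne_zero j (Fin.succ_injective _ h)
          simp [Equiv.swap_apply_of_ne_of_ne h1 h2, Fin.tail]
      rw [e', h₂, ← e]
    | succ i =>
      have e' : q ∘ Equiv.swap (Fin.castSucc i.succ) (Fin.succ i.succ) =
          Fin.cons (q 0) (Fin.tail q ∘ Equiv.swap i.castSucc i.succ) := by
        ext j
        refine Fin.cases ?_ (fun j => ?_) j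
        · rw [Function.comp_apply, Equiv.swap_apply_of_ne_of_ne]
          · simp
          · rw [Fin.castSucc_succ]; exact (Fin.succ_ne_zero _).symm
          · exact (Fin.succ_ne_zero _).symm
        · simp only [Function.comp_apply, Fin.cons_succ, Fin.tail, Fin.castSucc_succ]
          rw [(Fin.succ_injective _).swap_apply]
      rw [e', h₁, Fin.cons_self_tail]

variable {E : Type*} [NormedAddCommGroup E] [NormedSpace ℂ E]
  {X : Type u} [TopologicalSpace X] [ChartedSpace E X] [IsManifold 𝓘(ℂ, E) ω X]
  {L : X → Type u} [∀ x, AddCommGroup (L x)] [∀ x, Module ℂ (L x)]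
  [∀ x, TopologicalSpace (L x)] [TopologicalSpace (TotalSpace ℂ L)] [FiberBundle ℂ L]
  [VectorBundle ℂ ℂ L] [ContMDiffVectorBundle ω ℂ L 𝓘(ℂ, E)]

variable (E L) in
/-- The 1-jet at `x` of global sections, as a linear map. -/
def globalJet (x : X) : GlobalSections E L →ₗ[ℂ] Jet E L x where
  toFun s := jet E L x s
  map_add' s t := jet_add (s.hol x) (t.hol x)
  map_smul' c s := jet_smul (s.hol x) c

lemma globalJet_apply (x : X) (s : GlobalSections E L) : globalJet E L x s = jet E L x s := rfl

lemma contractJet_apply (v : GlobalSections E L) {m : ℕ} {U : Opens X}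
    (φ : symSections E L (m + 1) U) (x : U) (q : Fin m → Jet E L x) :
    (contractJet v m U φ).1 x q = φ.1 x (Fin.cons (globalJet E L x v) q) := rfl

lemma jets_cons {m : ℕ} (v : ∀ y, L y) (s : Fin m → ∀ y, L y) (y : X) :
    (fun i => jet E L y ((Fin.cons v s : Fin (m + 1) → ∀ y, L y) i)) =
      Fin.cons (jet E L y v) fun i => jet E L y (s i) := by
  ext j
  refine Fin.cases ?_ (fun j => ?_) j <;> simp

lemma evalJets_contractJet (v : GlobalSections E L) {m : ℕ} {U : Opens X}
    (φ : symSections E L (m + 1) U) (s : Fin m → ∀ y, L y) :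
    evalJets (contractJet v m U φ).1 s = evalJets φ.1 (Fin.cons (v : ∀ y, L y) s) := by
  ext y
  by_cases hy : y ∈ U
  · rw [evalJets_of_mem _ _ hy, evalJets_of_mem _ _ hy, contractJet_apply, jets_cons]
    rfl
  · simp [evalJets, hy]

/-- In the product rule for `φ(v, s₁, …, s_m)` the term in which `D` meets `v` is split off; the
rest is the Lie derivative of the contraction. The equivariance of the cohomology sequence is
derived from this formula. -/
lemma contractJet_lieDeriv (D : InfAut E L) (v : GlobalSections E L) (m : ℕ) (U : Opens X)
    (φ : symSections E L (m + 1) U) :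
    contractJet v m U (lieDeriv D (m + 1) U φ) =
      lieDeriv D m U (contractJet v m U φ) - contractJet (rep D v) m U φ := by
  rw [eq_sub_iff_add_eq]
  refine symSections_ext fun x hx s hs => ?_
  rw [evalJets_add, Pi.add_apply, evalJets_contractJet, evalJets_contractJet,
    evalJets_lieDeriv D _ hx (Fin.cases (v.hol x) hs), evalJets_lieDeriv D _ hx hs,
    Fin.sum_univ_succ]
  simp only [evalJets_contractJet, Fin.cons_zero, Fin.cons_succ, Fin.update_cons_zero,
    Fin.cons_update]
  have : (rep D v : ∀ y, L y) = appl D v := rfl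
  rw [this]
  abel

lemma toTensor_contractJet {m : ℕ} (v : GlobalSections E L)
    (φ : symSections E L (m + 1) (⊤ : Opens X)) :
    toTensor E L m (contractJet v m ⊤ φ) =
      Spencer.tensorContract m v (toTensor E L (m + 1) φ) := by
  ext w x
  rw [Spencer.tensorContract_apply, toTensor_apply, toTensor_apply, contractJet_apply]
  congr 1
  ext j
  refine Fin.cases ?_ (fun j => ?_) j <;> simp [globalJet_apply]

lemma toTensor_lieDeriv (D : InfAut E L) {m : ℕ} (φ : symSections E L m (⊤ : Opens X)) :
    toTensor E L m (lieDeriv D m ⊤ φ) = Spencer.tensorAct (rep D) (toTensor E L m φ) := by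
  ext v x
  rw [Spencer.tensorAct_apply]
  have h := evalJets_lieDeriv D φ (s := fun i => v i) (x := x) trivial fun i => (v i).hol x
  refine h.trans ?_
  rw [ContMDiffSection.coe_sub, Pi.sub_apply]
  congr 1
  have hsum : ∀ (S : Finset (Fin m)) (f : Fin m → GlobalSections E L),
      (∑ i ∈ S, f i : GlobalSections E L) x = ∑ i ∈ S, f i x := by
    intro S f
    exact map_sum ({ toFun := fun s => s x, map_zero' := rfl, map_add' := fun _ _ => rfl } :
      GlobalSections E L →+ L x) f S
  rw [hsum]
  refine Finset.sum_congr rfl fun i _ => ?_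
  have : (fun j => ((Function.update v i (rep D (v i)) j : GlobalSections E L) : ∀ y, L y)) =
      Function.update (fun j => (v j : ∀ y, L y)) i (appl D (v i)) := by
    ext j; by_cases h : j = i
    · subst h; simp; rfl
    · simp [h]
  change _ = evalJets φ.1 (fun j => ((Function.update v i (rep D (v i)) j :
    GlobalSections E L) : ∀ y, L y)) x
  rw [this]

variable [FiniteDimensional ℂ E]

lemma globalJet_surjective (hL : VeryAmple E L) (x : X) :
    Function.Surjective (globalJet E L x) :=
  fun q => exists_globalSection_jet_eq hL q

lemma toTensor_injective (hL : VeryAmple E L) (m : ℕ) : Function.Injective (toTensor E L m) := by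
  intro φ ψ h
  refine Subtype.ext (funext fun x => MultilinearMap.ext fun q => ?_)
  choose v hv using fun i => exists_globalSection_jet_eq hL (q i)
  obtain rfl : (fun i => jet E L x (v i)) = q := funext hv
  have := congrArg (fun s : GlobalSections E L => s x) (MultilinearMap.congr_fun h v)
  simpa only [toTensor_apply] using this

/-- Sections over `U` of `L ⊗ ⊙^m N*` are determined by their contractions with global jets. -/
lemma contractJet_ext (hL : VeryAmple E L) {m : ℕ} {U : Opens X}
    {φ ψ : symSections E L (m + 1) U}
    (h : ∀ v, contractJet v m U φ = contractJet v m U ψ) : φ = ψ := by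
  refine Subtype.ext (funext fun x => MultilinearMap.ext fun q => ?_)
  obtain ⟨v, hv⟩ := globalJet_surjective hL x (q 0)
  have := congrArg (fun χ : symSections E L m U => χ.1 x (Fin.tail q)) (h v)
  simp only [contractJet_apply, hv, Fin.cons_self_tail] at this
  exact this

/-- A linear family of sections of `L ⊗ ⊙^{m+1} N*` indexed by `V` that is symmetric comes from
a section of `L ⊗ ⊙^{m+2} N*`. -/
theorem exists_contractJet_eq (hL : VeryAmple E L) {m : ℕ} {U : Opens X}
    (β : GlobalSections E L →ₗ[ℂ] symSections E L (m + 1) U)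
    (hβ : ∀ v w, contractJet v m U (β w) = contractJet w m U (β v)) :
    ∃ φ : symSections E L (m + 2) U, ∀ v, contractJet v (m + 1) U φ = β v := by
  have hβ' : ∀ (x : U) (v w : GlobalSections E L) (q : Fin m → Jet E L x),
      (β w).1 x (Fin.cons (globalJet E L x v) q) = (β v).1 x (Fin.cons (globalJet E L x w) q) :=
    fun x v w q => congrArg (fun χ : symSections E L m U => χ.1 x q) (hβ v w)
  let B : ∀ x : U, GlobalSections E L →ₗ[ℂ] JetForm E L (m + 1) x := fun x =>
    LinearMap.proj (R := ℂ) (φ := fun x : U => JetForm E L (m + 1) x) x ∘ₗ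
      (symSections E L (m + 1) U).subtype ∘ₗ β
  have hBβ : ∀ x v, B x v = (β v).1 x := fun x v => rfl
  -- A linear right inverse at each point, with no regularity in `x`. By `hker` the resulting `φ`
  -- does not depend on the choice.
  choose σ hσ using fun x : U =>
    (globalJet E L (x : X)).exists_rightInverse_of_surjective
      (LinearMap.range_eq_top.2 (globalJet_surjective hL x))
  have hσ' : ∀ (x : U) q, globalJet E L (x : X) (σ x q) = q := fun x q =>
    LinearMap.congr_fun (hσ x) q
  -- Here the symmetry of `β` enters: it moves `u` from the index of the family into a jet argument,
  -- where its jet is zero.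
  have hker : ∀ (x : U) (u : GlobalSections E L), globalJet E L (x : X) u = 0 → B x u = 0 := by
    intro x u hu
    refine MultilinearMap.ext fun q => ?_
    rw [← Fin.cons_self_tail q, ← hσ' x (q 0), hBβ, hβ', hu]
    exact MultilinearMap.map_coord_zero _ 0 (Fin.cons_zero _ _)
  let φ : ∀ x : U, JetForm E L (m + 2) x := fun x => (B x ∘ₗ σ x).uncurryLeft
  have hφ : ∀ (x : U) (q : Jet E L (x : X)) (r : Fin (m + 1) → Jet E L (x : X)),
      φ x (Fin.cons q r) = B x (σ x q) r := fun x q r => by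
    simp [φ, LinearMap.uncurryLeft_apply, Fin.tail_cons]
  have hφv : ∀ (x : U) (v : GlobalSections E L) (r : Fin (m + 1) → Jet E L (x : X)),
      φ x (Fin.cons (globalJet E L x v) r) = (β v).1 x r := by
    intro x v r
    rw [hφ, ← hBβ, ← sub_eq_zero, ← sub_apply, ← map_sub, hker]
    · rfl
    · rw [map_sub, hσ', sub_self]
  have hmem : φ ∈ symSections E L (m + 2) U := by
    refine ⟨fun x τ q => ?_, fun x s hs => ?_⟩
    · refine symmetric_of_cons (φ x) (fun a τ q => ?_) (fun a b q => ?_) τ q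
      · rw [hφ, hφ]; exact (β (σ x a)).2.1 x τ q
      · rw [hφ, hφ, hBβ, hBβ]
        conv_lhs => rw [← hσ' x b]
        conv_rhs => rw [← hσ' x a]
        exact hβ' x _ _ q
    -- Holomorphy: expanding the first jet in a holomorphic frame writes `φ(s₀, s₁, …)` near `x` as
    -- `∑ aᵢ(s₀) β(eᵢ)(s₁, …)`.
    · obtain ⟨W, n, e, a, hxW, ha, hah⟩ := exists_jet_frame hL (x : X)
      have h1 : HolAt E L (∑ i : Fin n, fun y => a y (jet E L y (s 0)) i •
          evalJets (β (e i)).1 (Fin.tail s) y) x :=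
        HolAt.sum fun i _ => HolAt.smul (hah x hxW (s 0) (hs 0) i)
          (HolAt.evalJets (β (e i)) x.2 fun j => hs j.succ)
      refine h1.congr ?_
      filter_upwards [U.isOpen.mem_nhds x.2, W.isOpen.mem_nhds hxW] with y hy hyW
      rw [evalJets_of_mem _ _ hy, Finset.sum_apply]
      have e1 : (fun i => jet E L y (s i)) =
          Fin.cons (∑ i, a y (jet E L y (s 0)) i • globalJet E L y (e i))
            (fun i => jet E L y (Fin.tail s i)) := by
        rw [← Fin.cons_self_tail (fun i => jet E L y (s i))]
        congr 1
        exact (ha y hyW _).symm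
      rw [e1, hφ, map_sum, map_sum, sum_apply]
      refine Finset.sum_congr rfl fun i _ => ?_
      rw [map_smul, map_smul, smul_apply, ← hφ ⟨y, hy⟩, hφv,
        evalJets_of_mem _ _ hy]
  refine ⟨⟨φ, hmem⟩, fun v => Subtype.ext (funext fun x => MultilinearMap.ext fun q => ?_)⟩
  exact hφv x v q

/-- Degree one is the definition of `lieAlgebra`. In the induction step the contractions of `T ∈
𝔤^{(m+1)}` with vectors are global sections by hypothesis, they depend linearly on the vector, and
`exists_contractJet_eq` assembles them into one section. -/
theorem range_toTensor (hL : VeryAmple E L) (m : ℕ) :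
    LinearMap.range (toTensor E L (m + 1)) = Spencer.prolong (lieAlgebra E L) (m + 1) := by
  induction m with
  | zero =>
    have h : ∀ D : InfAut E L, toTensor E L 1 D =
        MultilinearMap.ofSubsingletonₗ ℂ ℂ (GlobalSections E L) (GlobalSections E L) (0 : Fin 1)
          (rep D) := by
      intro D
      ext v x
      rw [toTensor_apply]
      change _ = rep D (v 0) x
      rw [rep_apply, linAt_apply]
      congr 1
      ext j
      rw [Subsingleton.elim j 0]
    ext T
    constructor
    · rintro ⟨D, rfl⟩
      exact ⟨rep D, ⟨D, rfl⟩, (h D).symm⟩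
    · rintro ⟨_, ⟨D, rfl⟩, rfl⟩
      exact ⟨D, h D⟩
  | succ m ih =>
    ext T
    constructor
    · rintro ⟨φ, rfl⟩
      refine ⟨fun σ v => ?_, fun v => ?_⟩
      · ext x
        rw [toTensor_apply, toTensor_apply]
        exact φ.2.1 ⟨x, trivial⟩ σ fun i => jet E L x (v i)
      · rw [← ih, ← toTensor_contractJet]
        exact ⟨_, rfl⟩
    · intro hT
      have hT2 : ∀ v, Spencer.tensorContract (m + 1) v T ∈
          LinearMap.range (toTensor E L (m + 1)) := fun v => ih ▸ hT.2 v
      let β : GlobalSections E L →ₗ[ℂ] symSections E L (m + 1) (⊤ : Opens X) :=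
        (LinearEquiv.ofInjective _ (toTensor_injective hL (m + 1))).symm.toLinearMap ∘ₗ
          ((Spencer.tensorContract (m + 1)).flip T).codRestrict _ hT2
      have hβ : ∀ v, toTensor E L (m + 1) (β v) = Spencer.tensorContract (m + 1) v T := fun v =>
        congrArg Subtype.val ((LinearEquiv.ofInjective _
          (toTensor_injective hL (m + 1))).apply_symm_apply
            ⟨Spencer.tensorContract (m + 1) v T, hT2 v⟩)
      -- Since `toTensor` is injective, the compatibility of `β` may be checked on tensors, where it
      -- is the symmetry of `T` in its first two arguments.
      obtain ⟨φ, hφ⟩ := exists_contractJet_eq hL β fun v w => by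
        apply toTensor_injective hL m
        rw [toTensor_contractJet, toTensor_contractJet, hβ, hβ]
        ext q : 1
        rw [Spencer.tensorContract_apply, Spencer.tensorContract_apply,
          Spencer.tensorContract_apply, Spencer.tensorContract_apply,
          ← hT.1 (Equiv.swap 0 1) (Fin.cons v (Fin.cons w q))]
        congr 1
        ext1 j
        refine Fin.cases ?_ (fun j => Fin.cases ?_ (fun j => ?_) j) j
        · simp
        · simp
        · have h1 : (Fin.succ (Fin.succ j) : Fin (m + 2)) ≠ 0 := Fin.succ_ne_zero _
          have h2 : (Fin.succ (Fin.succ j) : Fin (m + 2)) ≠ 1 := by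
            intro h; exact Fin.succ_ne_zero j (Fin.succ_injective _ h)
          simp [Equiv.swap_apply_of_ne_of_ne h1 h2]
      refine ⟨φ, MultilinearMap.ext fun v => ?_⟩
      have h1 := hβ (v 0)
      rw [← hφ, toTensor_contractJet] at h1
      have h2 := MultilinearMap.congr_fun h1 (Fin.tail v)
      rwa [Spencer.tensorContract_apply, Spencer.tensorContract_apply, Fin.cons_self_tail] at h2

end Contractions

end JetSpencer

end

noncomputable section

namespace JetSpencer

/-! ### Linear algebra: a primitive for closed 2-forms in a Koszul complex. -/

section Koszul

variable {V J M : Type*} [AddCommGroup V] [Module ℂ V] [AddCommGroup J] [Module ℂ J]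
  [AddCommGroup M] [Module ℂ M] {m : ℕ}

/-- The map `v ↦ ((q₀, …, q_m) ↦ ∑ᵢ B(v, σ qᵢ)(q₀, …, q̂ᵢ, …, q_m))`. -/
def koszulSum (B : V →ₗ[ℂ] V →ₗ[ℂ] MultilinearMap ℂ (fun _ : Fin m => J) M) (σ : J →ₗ[ℂ] V) :
    V →ₗ[ℂ] MultilinearMap ℂ (fun _ : Fin (m + 1) => J) M where
  toFun v := ∑ i : Fin (m + 1), LinearMap.uncurryMid i (B v ∘ₗ σ)
  map_add' v w := by ext q; simp [Finset.sum_add_distrib]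
  map_smul' c v := by ext q; simp [Finset.smul_sum]

lemma koszulSum_apply (B : V →ₗ[ℂ] V →ₗ[ℂ] MultilinearMap ℂ (fun _ : Fin m => J) M)
    (σ : J →ₗ[ℂ] V) (v : V) (q : Fin (m + 1) → J) :
    koszulSum B σ v q = ∑ i, B v (σ (q i)) (i.removeNth q) := by
  simp [koszulSum]

/-- A permutation of `m + 1` letters restricts to the complement of a letter. -/
lemma exists_perm_succAbove (τ : Equiv.Perm (Fin (m + 1))) (i : Fin (m + 1)) :
    ∃ ρ : Equiv.Perm (Fin m), ∀ j, τ (i.succAbove j) = (τ i).succAbove (ρ j) := by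
  refine ⟨(finSuccAboveEquiv i).trans ((τ.subtypeEquiv (p := fun x => x ≠ i)
    (q := fun x => x ≠ τ i) fun x => by simp).trans (finSuccAboveEquiv (τ i)).symm),
    fun j => ?_⟩
  have h := (finSuccAboveEquiv (τ i)).apply_symm_apply
    ((τ.subtypeEquiv (p := fun x => x ≠ i) (q := fun x => x ≠ τ i) fun x => by simp)
      (finSuccAboveEquiv i j))
  exact (congrArg Subtype.val h).symm

lemma koszulSum_perm {B : V →ₗ[ℂ] V →ₗ[ℂ] MultilinearMap ℂ (fun _ : Fin m => J) M}
    (hB : ∀ v w (τ : Equiv.Perm (Fin m)) q, B v w (q ∘ τ) = B v w q) (σ : J →ₗ[ℂ] V) (v : V)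
    (τ : Equiv.Perm (Fin (m + 1))) (q : Fin (m + 1) → J) :
    koszulSum B σ v (q ∘ τ) = koszulSum B σ v q := by
  rw [koszulSum_apply, koszulSum_apply]
  refine Fintype.sum_equiv τ _ _ fun i => ?_
  obtain ⟨ρ, hρ⟩ := exists_perm_succAbove τ i
  refine Eq.trans ?_ (hB _ _ ρ _)
  congr 1
  ext j
  simp [Fin.removeNth, hρ]

lemma apply_cons_removeNth {T : (Fin (m + 1) → J) → M}
    (hT : ∀ (τ : Equiv.Perm (Fin (m + 1))) q, T (q ∘ τ) = T q) (i : Fin (m + 1))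
    (q : Fin (m + 1) → J) : T (Fin.cons (q i) (i.removeNth q)) = T q := by
  rw [← hT i.cycleRange.symm q]
  congr 1
  ext j
  refine Fin.cases ?_ (fun j => ?_) j
  · simp
  · simp [Fin.removeNth]

lemma removeNth_succ_cons (a : J) (r : Fin (m + 1) → J) (i : Fin (m + 1)) :
    (i.succ.removeNth (Fin.cons a r : Fin (m + 2) → J)) = Fin.cons a (i.removeNth r) := by
  ext j
  refine Fin.cases ?_ (fun j => ?_) j
  · simp [Fin.removeNth]
  · simp [Fin.removeNth]

/-- The primitive of a closed form `B ∈ ⊙^m J* ⊗ Λ²V* ⊗ M`. -/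
def koszulPrimitive (B : V →ₗ[ℂ] V →ₗ[ℂ] MultilinearMap ℂ (fun _ : Fin m => J) M)
    (j : V →ₗ[ℂ] J) (σ : J →ₗ[ℂ] V) :
    V →ₗ[ℂ] MultilinearMap ℂ (fun _ : Fin (m + 1) => J) M :=
  -- The constants come from `V = ker j ⊕ σ(J)`. For closed `B` and `m ≥ 1`, `B` vanishes on pairs
  -- from `ker j`, and the differential of `koszulSum B σ` is `-(m+1) B` on mixed pairs and `-(m+2)
  -- B` on pairs from `σ(J)`. The second term, which sees only `σ(J)`, corrects the latter weight:
  -- `(m+2)/(m+1) - 1/(m+1) = 1`.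
  (-(m + 1 : ℂ)⁻¹) • koszulSum B σ +
    ((m + 1 : ℂ)⁻¹ * (m + 2 : ℂ)⁻¹) • (koszulSum B σ ∘ₗ σ ∘ₗ j)

/-- Exactness of the Koszul complex `⊙^{m+2} J* ⊗ V* → ⊙^{m+1} J* ⊗ Λ²V* → ⊙^m J* ⊗ Λ³V*` for a
surjection `V → J`. -/
theorem koszulPrimitive_spec
    {B : V →ₗ[ℂ] V →ₗ[ℂ] MultilinearMap ℂ (fun _ : Fin (m + 1) => J) M}
    {j : V →ₗ[ℂ] J} {σ : J →ₗ[ℂ] V} (hσ : ∀ q, j (σ q) = q)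
    (hskew : ∀ v w, B v w = - B w v)
    (hsym : ∀ v w (τ : Equiv.Perm (Fin (m + 1))) q, B v w (q ∘ τ) = B v w q)
    (hcyc : ∀ u v w (q : Fin m → J), B v w (Fin.cons (j u) q) + B w u (Fin.cons (j v) q) +
      B u v (Fin.cons (j w) q) = 0) (v w : V) (r : Fin (m + 1) → J) :
    koszulPrimitive B j σ w (Fin.cons (j v) r) - koszulPrimitive B j σ v (Fin.cons (j w) r) =
      B v w r := by
  -- The closedness identity for `σ (r i), v, w` compares the `i`-th summands of the two sums; their
  -- difference is `-B v w r` once `r i` is put back in its place, and there are `m + 1` of them.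
  have key : ∀ v w, koszulSum B σ w (Fin.cons (j v) r) - koszulSum B σ v (Fin.cons (j w) r) =
      B w (σ (j v)) r - B v (σ (j w)) r - (m + 1 : ℂ) • B v w r := by
    intro v w
    have h0 : ∀ v w, koszulSum B σ w (Fin.cons (j v) r) = B w (σ (j v)) r +
        ∑ i, B w (σ (r i)) (Fin.cons (j v) (i.removeNth r)) := by
      intro v w
      rw [koszulSum_apply, Fin.sum_univ_succ]
      simp only [Fin.cons_zero, Fin.cons_succ, removeNth_succ_cons, Fin.removeNth_zero,
        Fin.tail_cons]
    rw [h0, h0]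
    have h1 : ∀ i : Fin (m + 1), B w (σ (r i)) (Fin.cons (j v) (i.removeNth r)) =
        B v (σ (r i)) (Fin.cons (j w) (i.removeNth r)) - B v w r := by
      intro i
      have h2 := hcyc (σ (r i)) v w (i.removeNth r)
      rw [hσ, apply_cons_removeNth (hsym v w), hskew (σ (r i)) v, neg_apply] at h2
      rw [← sub_eq_zero, ← h2]
      abel
    simp only [h1, Finset.sum_sub_distrib, Finset.sum_const, Finset.card_univ, Fintype.card_fin]
    rw [← Nat.cast_smul_eq_nsmul ℂ]
    push_cast
    abel
  -- In the closedness identity for `σ (r 0), κ, κ'` the other two terms have `j κ` or `j κ'` as an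
  -- argument. This needs at least one symmetric argument, hence the degree `m + 1` in the
  -- statement.
  have hκ : ∀ κ κ', j κ = 0 → j κ' = 0 → B κ κ' r = 0 := by
    intro κ κ' h h'
    have h2 := hcyc (σ (r 0)) κ κ' (Fin.tail r)
    rw [hσ, h, h', Fin.cons_self_tail, MultilinearMap.map_coord_zero _ 0 (Fin.cons_zero _ _),
      MultilinearMap.map_coord_zero _ 0 (Fin.cons_zero _ _), add_zero, add_zero] at h2
    exact h2
  have h1 := key v w
  -- The same formula for the components in `σ(J)`; with the vanishing on the components in `ker j`
  -- it determines all terms.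
  have h2 := key (σ (j v)) (σ (j w))
  simp only [hσ] at h2
  have h3 := hκ (v - σ (j v)) (w - σ (j w)) (by simp [hσ]) (by simp [hσ])
  simp only [map_sub, LinearMap.sub_apply, sub_apply] at h3
  rw [hskew w (σ (j v)), neg_apply] at h1
  rw [hskew (σ (j w)) (σ (j v)), neg_apply] at h2
  have hm1 : (m + 1 : ℂ) + 1 ≠ 0 := by
    exact_mod_cast (Nat.succ_ne_zero (m + 1))
  have hm2 : (m + 1 : ℂ) + 2 ≠ 0 := by
    exact_mod_cast (Nat.succ_ne_zero (m + 2))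
  have e : ∀ v q, koszulPrimitive B j σ v q = (-((m + 1 : ℂ) + 1)⁻¹) • koszulSum B σ v q +
      (((m + 1 : ℂ) + 1)⁻¹ * ((m + 1 : ℂ) + 2)⁻¹) • koszulSum B σ (σ (j v)) q := by
    intro v q
    simp [koszulPrimitive]
  rw [e, e]
  have h4 : B v w r = B (σ (j v)) w r + B v (σ (j w)) r - B (σ (j v)) (σ (j w)) r := by
    rw [← sub_eq_zero, ← h3]; abel
  calc _ = (-((m + 1 : ℂ) + 1)⁻¹) • (koszulSum B σ w (Fin.cons (j v) r) -
          koszulSum B σ v (Fin.cons (j w) r)) +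
        (((m + 1 : ℂ) + 1)⁻¹ * ((m + 1 : ℂ) + 2)⁻¹) •
          (koszulSum B σ (σ (j w)) (Fin.cons (j v) r) -
            koszulSum B σ (σ (j v)) (Fin.cons (j w) r)) := by module
    _ = (-((m + 1 : ℂ) + 1)⁻¹) • (-(B v w r + B (σ (j v)) (σ (j w)) r) -
          (m + 1 : ℂ) • B v w r) +
        (((m + 1 : ℂ) + 1)⁻¹ * ((m + 1 : ℂ) + 2)⁻¹) •
          (-((m + 1 : ℂ) + 2) • B (σ (j v)) (σ (j w)) r) := by
      rw [h1, h2]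
      congr 2
      · rw [h4]; abel
      · module
    _ = ((((m + 1 : ℂ) + 1)⁻¹) * ((m + 1 : ℂ) + 1)) • B v w r +
        (((m + 1 : ℂ) + 1)⁻¹ - ((m + 1 : ℂ) + 1)⁻¹ * (((m + 1 : ℂ) + 2)⁻¹ * ((m + 1 : ℂ) + 2))) •
          B (σ (j v)) (σ (j w)) r := by module
    _ = B v w r := by
      rw [inv_mul_cancel₀ hm1, inv_mul_cancel₀ hm2]; simp

end Koszul

end JetSpencer

end

noncomputable section

namespace JetSpencer

open Topology TopologicalSpace CategoryTheory Opposite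

/-! ### Short exact sequences of sheaves and the connecting homomorphism. -/

section SheafSequences

variable {X : Type u} [TopologicalSpace X]

/-- Morphisms of sheaves of abelian groups from compatible additive maps. -/
def sheafHomMk {F G : Sheaf (Opens.grothendieckTopology X) AddCommGrpCat.{u}}
    (f : ∀ U : Opens X, F.obj.obj (op U) →+ G.obj.obj (op U))
    (hf : ∀ (U U' : Opens X) (h : U ≤ U') (s : F.obj.obj (op U')),
      f U (F.obj.map (homOfLE h).op s) = G.obj.map (homOfLE h).op (f U' s)) : F ⟶ G :=
  ⟨{ app := fun U => AddCommGrpCat.ofHom (f U.unop)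
     naturality := fun U U' i => by
      ext s
      exact hf U'.unop U.unop i.unop.le s }⟩

/-- A sequence of sheaves that is left exact on sections, with locally surjective second map, is
short exact. -/
lemma shortExact_of_sections {F G H : Sheaf (Opens.grothendieckTopology X) AddCommGrpCat.{u}}
    (f : F ⟶ G) (g : G ⟶ H) (w : f ≫ g = 0)
    (hinj : ∀ U : Opens X, Function.Injective (f.hom.app (op U)))
    (hex : ∀ (U : Opens X) (s : G.obj.obj (op U)), g.hom.app (op U) s = 0 →
      ∃ t, f.hom.app (op U) t = s)
    (hsurj : ∀ (U : Opens X) (t : H.obj.obj (op U)), ∀ x ∈ U, ∃ (W : Opens X) (h : W ≤ U),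
      x ∈ W ∧ ∃ s, g.hom.app (op W) s = H.obj.map (homOfLE h).op t) :
    (ShortComplex.mk f g w).ShortExact := by
  have hmono : Mono f := by
    refine ⟨fun a b hab => ?_⟩
    ext U z
    apply hinj U.unop
    exact congrArg (fun k => k.hom.app U z) hab
  have hepi : Epi g := by
    refine (TopCat.Sheaf.isLocallySurjective_iff_epi (X := TopCat.of X) g).1 ?_
    refine (TopCat.Presheaf.isLocallySurjective_iff (X := TopCat.of X) _).2 fun U t x hx => ?_
    obtain ⟨W, h, hxW, s, hs⟩ := hsurj U t x hx
    exact ⟨W, h, ⟨s, hs⟩, hxW⟩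
  refine { exact := ShortComplex.exact_of_f_is_kernel _ ?_, mono_f := hmono, epi_g := hepi }
  refine Limits.KernelFork.IsLimit.ofι' f w fun {Z} k hk => ?_
  have hk' : ∀ (U : Opens X) (z : Z.obj.obj (op U)), g.hom.app (op U) (k.hom.app (op U) z) = 0 :=
    fun U z => congrArg (fun k => k.hom.app (op U) z) hk
  -- Preimages are unique by `hinj`; so the arbitrary choice is automatically additive and
  -- compatible with restrictions.
  choose l hl using fun (U : Opens X) (z : Z.obj.obj (op U)) => hex U _ (hk' U z)
  refine ⟨sheafHomMk (fun U => { toFun := l U, map_zero' := ?_, map_add' := fun a b => ?_ })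
    fun U U' h s => ?_, ?_⟩
  · apply hinj U
    rw [hl, map_zero, map_zero]
  · apply hinj U
    rw [hl, map_add, map_add, hl, hl]
  · apply hinj U
    change f.hom.app (op U) (l U _) = f.hom.app (op U) (F.obj.map _ (l U' s))
    rw [hl]
    have h1 := ConcreteCategory.congr_hom (f.hom.naturality (homOfLE h).op) (l U' s)
    have h2 := ConcreteCategory.congr_hom (k.hom.naturality (homOfLE h).op) s
    refine h2.trans (Eq.trans ?_ h1.symm)
    exact congrArg (G.obj.map (homOfLE h).op) (hl U' s).symm
  · ext U z
    exact hl U.unop z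

section Connecting

variable {S S' : ShortComplex (Sheaf (Opens.grothendieckTopology X) AddCommGrpCat.{u})}
  (hS : S.ShortExact) (hS' : S'.ShortExact)

open Abelian

/-- The connecting homomorphism `H⁰(X, S₃) → H¹(X, S₁)`. -/
def connecting : S.X₃.obj.obj (op (⊤ : Opens X)) →+ Sheaf.H S.X₁ 1 :=
  (hS.extClass.postcomp _ (zero_add 1)).comp
    (Sheaf.H.equiv₀ S.X₃ (Limits.isTerminalTop (α := Opens X))).symm.toAddMonoidHom

lemma connecting_apply (c : S.X₃.obj.obj (op (⊤ : Opens X))) :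
    connecting hS c = ((Sheaf.H.equiv₀ S.X₃ (Limits.isTerminalTop (α := Opens X))).symm c).comp
      hS.extClass (zero_add 1) := rfl

/-- Exactness of the long `Ext` sequence at `H⁰(X, S₃)`, with degree-zero cohomology read as global
sections through `Sheaf.H.equiv₀`. -/
lemma connecting_eq_zero_iff (c : S.X₃.obj.obj (op (⊤ : Opens X))) :
    connecting hS c = 0 ↔ ∃ b, S.g.hom.app (op (⊤ : Opens X)) b = c := by
  rw [connecting_apply]
  constructor
  · intro h
    obtain ⟨b, hb⟩ := Ext.covariant_sequence_exact₃ _ hS _ _ h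
    refine ⟨Sheaf.H.equiv₀ S.X₂ (Limits.isTerminalTop (α := Opens X)) b, ?_⟩
    rw [Sheaf.H.equiv₀_naturality, Sheaf.H.map_apply, hb, AddEquiv.apply_symm_apply]
  · rintro ⟨b, rfl⟩
    rw [← Sheaf.H.equiv₀_symm_naturality, Sheaf.H.map_apply,
      Ext.comp_assoc_of_second_deg_zero, hS.comp_extClass, Ext.comp_zero]

/-- Exactness of the long `Ext` sequence at `H¹(X, S₁)`. -/
lemma map_f_eq_zero_iff (h : Sheaf.H S.X₁ 1) :
    Sheaf.H.map S.f 1 h = 0 ↔ ∃ c, connecting hS c = h := by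
  constructor
  · intro hh
    obtain ⟨c, hc⟩ := Ext.covariant_sequence_exact₁ _ hS h hh (zero_add 1)
    refine ⟨Sheaf.H.equiv₀ S.X₃ (Limits.isTerminalTop (α := Opens X)) c, ?_⟩
    rw [connecting_apply, AddEquiv.symm_apply_apply, hc]
  · rintro ⟨c, rfl⟩
    rw [connecting_apply, Sheaf.H.map_apply, Ext.comp_assoc_of_third_deg_zero,
      hS.extClass_comp, Ext.comp_zero]

/-- Used for endomorphisms of a single sequence: scalars give the `ℂ`-linearity of the connecting
map, the Lie derivatives its equivariance. -/
lemma connecting_naturality (φ : S ⟶ S') (c : S.X₃.obj.obj (op (⊤ : Opens X))) :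
    connecting hS' (φ.τ₃.hom.app (op (⊤ : Opens X)) c) =
      Sheaf.H.map φ.τ₁ 1 (connecting hS c) := by
  rw [connecting_apply, connecting_apply, ← Sheaf.H.equiv₀_symm_naturality, Sheaf.H.map_apply,
    Sheaf.H.map_apply, Ext.comp_assoc_of_second_deg_zero, Ext.comp_assoc_of_third_deg_zero,
    ShortComplex.ShortExact.extClass_naturality hS hS' φ]

end Connecting

end SheafSequences

end JetSpencer

end

noncomputable section

namespace JetSpencer

open Topology TopologicalSpace CategoryTheory Opposite

/-! ### Sheaves of families of sections subject to fibrewise linear conditions. -/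

section FibreSheaf

variable {E : Type*} [NormedAddCommGroup E] [NormedSpace ℂ E]
  {X : Type u} [TopologicalSpace X] [ChartedSpace E X]
  {L : X → Type u} [∀ x, AddCommGroup (L x)] [∀ x, Module ℂ (L x)]
  [∀ x, TopologicalSpace (L x)] [TopologicalSpace (TotalSpace ℂ L)] [FiberBundle ℂ L]
  [VectorBundle ℂ ℂ L]

/-- Sections of `L ⊗ ⊙^m N*` over the members of an open cover glue. -/
lemma exists_glue_symSections {m : ℕ} {ι : Type*} {U : ι → Opens X}
    (sf : ∀ i, symSections E L m (U i))
    (hsf : ∀ (i j : ι) (x : X) (hi : x ∈ U i) (hj : x ∈ U j),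
      (sf i).1 ⟨x, hi⟩ = (sf j).1 ⟨x, hj⟩) :
    ∃ s : symSections E L m (iSup U), ∀ (i : ι) (x : X) (hi : x ∈ U i)
      (hx : x ∈ iSup U), s.1 ⟨x, hx⟩ = (sf i).1 ⟨x, hi⟩ := by
  have hmem : ∀ x : (iSup U : Opens X), ∃ i, (x : X) ∈ U i := fun x => Opens.mem_iSup.1 x.2
  choose c hc using hmem
  refine ⟨⟨fun x => (sf (c x)).1 ⟨x, hc x⟩, fun x => (sf (c x)).2.1 ⟨x, hc x⟩, fun x s hs => ?_⟩,
    fun i x hi hx => hsf _ _ _ _ _⟩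
  refine ((sf (c x)).2.2 ⟨x, hc x⟩ s hs).congr ?_
  filter_upwards [(U (c x)).isOpen.mem_nhds (hc x)] with y hy
  have hy' : y ∈ (iSup U : Opens X) := Opens.mem_iSup.2 ⟨_, hy⟩
  rw [evalJets_of_mem _ _ hy', evalJets_of_mem _ _ hy]
  exact congrArg (fun T : JetForm E L m y => T (fun i => jet E L y (s i)))
    (hsf (c ⟨y, hy'⟩) (c x) y (hc ⟨y, hy'⟩) hy)

variable {T : Type u} {m : ℕ}

/-- Families of sections of `L ⊗ ⊙^m N*` indexed by `T` that satisfy a linear condition in every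
fibre. -/
def fibreSections (P : ∀ x : X, Submodule ℂ (T → JetForm E L m x)) (U : Opens X) :
    Submodule ℂ (T → symSections E L m U) where
  carrier := {f | ∀ x : U, (fun t => (f t).1 x) ∈ P x}
  add_mem' hf hg x := (P x).add_mem (hf x) (hg x)
  zero_mem' x := (P x).zero_mem
  smul_mem' c _ hf x := (P x).smul_mem c (hf x)

lemma fibreSections_ext {P : ∀ x : X, Submodule ℂ (T → JetForm E L m x)} {U : Opens X}
    {f g : fibreSections P U} (h : ∀ (t : T) (x : U), (f.1 t).1 x = (g.1 t).1 x) : f = g :=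
  Subtype.ext (funext fun t => Subtype.ext (funext fun x => h t x))

/-- Restriction of families of sections. -/
def fibreRestrict (P : ∀ x : X, Submodule ℂ (T → JetForm E L m x)) {U U' : Opens X} (h : U ≤ U') :
    fibreSections P U' →ₗ[ℂ] fibreSections P U where
  toFun f := ⟨fun t => restrict h (f.1 t), fun x => f.2 ⟨x, h x.2⟩⟩
  map_add' _ _ := rfl
  map_smul' _ _ := rfl

/-- The presheaf of families of sections. -/
def fibrePresheaf (P : ∀ x : X, Submodule ℂ (T → JetForm E L m x)) :
    (Opens X)ᵒᵖ ⥤ AddCommGrpCat.{u} where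
  obj U := AddCommGrpCat.of (fibreSections P U.unop)
  map f := AddCommGrpCat.ofHom (fibreRestrict P f.unop.le).toAddMonoidHom

/-- The condition `P` is imposed point by point, so it survives the glueing, which is done
separately for each index. -/
lemma fibrePresheaf_isSheaf (P : ∀ x : X, Submodule ℂ (T → JetForm E L m x)) :
    Presheaf.IsSheaf (Opens.grothendieckTopology X) (fibrePresheaf P) := by
  change TopCat.Presheaf.IsSheaf (X := TopCat.of X) (fibrePresheaf P)
  rw [TopCat.Presheaf.isSheaf_iff_isSheaf_comp (forget AddCommGrpCat.{u})]
  refine TopCat.Presheaf.isSheaf_of_isSheafUniqueGluing_types _ ?_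
  intro ι U sf hsf
  have hcomp : ∀ (t : T) (i j : ι) (x : X) (hi : x ∈ U i) (hj : x ∈ U j),
      ((sf i : fibreSections P (U i)).1 t).1 ⟨x, hi⟩ =
        ((sf j : fibreSections P (U j)).1 t).1 ⟨x, hj⟩ := by
    intro t i j x hi hj
    exact congrArg (fun f : fibreSections P (U i ⊓ U j) => (f.1 t).1 ⟨x, hi, hj⟩) (hsf i j)
  choose s hs using fun t => exists_glue_symSections
    (fun i => (sf i : fibreSections P (U i)).1 t) (hcomp t)
  refine ⟨(⟨s, fun x => ?_⟩ : fibreSections P (iSup U)), fun i => ?_, fun f hf => ?_⟩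
  · obtain ⟨i, hi⟩ := Opens.mem_iSup.1 x.2
    have h1 := (sf i : fibreSections P (U i)).2 ⟨x, hi⟩
    have h2 : (fun t => (s t).1 x) =
        fun t => ((sf i : fibreSections P (U i)).1 t).1 ⟨x, hi⟩ :=
      funext fun t => hs t i x hi x.2
    rw [h2]
    exact h1
  · exact fibreSections_ext fun t x => hs t i x x.2 (Opens.mem_iSup.2 ⟨i, x.2⟩)
  · refine fibreSections_ext fun t x => ?_
    obtain ⟨i, hi⟩ := Opens.mem_iSup.1 x.2
    rw [hs t i x hi x.2]
    exact congrArg (fun f : fibreSections P (U i) => (f.1 t).1 ⟨x, hi⟩) (hf i)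

/-- The sheaf of families of sections. -/
def fibreSheaf (P : ∀ x : X, Submodule ℂ (T → JetForm E L m x)) :
    Sheaf (Opens.grothendieckTopology X) AddCommGrpCat.{u} :=
  ⟨fibrePresheaf P, fibrePresheaf_isSheaf P⟩

lemma smul_mem_symSections {U : Opens X} {φ : ∀ x : U, JetForm E L m x}
    (hφ : φ ∈ symSections E L m U) {f : X → ℂ} (hf : ∀ x ∈ U, HolFunAt E f x) :
    (fun x : U => f x • φ x) ∈ symSections E L m U := by
  refine ⟨fun x σ q => ?_, fun x s hs => ?_⟩
  · rw [smul_apply, smul_apply, hφ.1]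
  · refine (HolAt.smul (hf x x.2) (hφ.2 x s hs)).congr ?_
    filter_upwards [U.isOpen.mem_nhds x.2] with y hy
    rw [evalJets_of_mem _ _ hy, evalJets_of_mem _ _ hy, smul_apply]

end FibreSheaf

/-! ### The sheaf of Spencer cocycles and local exactness. -/

section SpencerSheaves

variable {E : Type*} [NormedAddCommGroup E] [NormedSpace ℂ E]
  {X : Type u} [TopologicalSpace X] [ChartedSpace E X] [IsManifold 𝓘(ℂ, E) ω X]
  {L : X → Type u} [∀ x, AddCommGroup (L x)] [∀ x, Module ℂ (L x)]
  [∀ x, TopologicalSpace (L x)] [TopologicalSpace (TotalSpace ℂ L)] [FiberBundle ℂ L]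
  [VectorBundle ℂ ℂ L] [ContMDiffVectorBundle ω ℂ L 𝓘(ℂ, E)]

variable (E L) in
/-- The fibre at `x` of `L ⊗ (N*)^{⊗ m} ⊗ V*`. -/
def linearFamilies (m : ℕ) (x : X) : Submodule ℂ (GlobalSections E L → JetForm E L m x) where
  carrier := {f | (∀ v w, f (v + w) = f v + f w) ∧ ∀ (c : ℂ) v, f (c • v) = c • f v}
  add_mem' {f g} hf hg := ⟨fun v w => by simp only [Pi.add_apply, hf.1, hg.1]; abel,
    fun c v => by simp only [Pi.add_apply, hf.2, hg.2, smul_add]⟩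
  zero_mem' := ⟨fun v w => by simp, fun c v => by simp⟩
  smul_mem' a f hf := ⟨fun v w => by simp only [Pi.smul_apply, hf.1, smul_add],
    fun c v => by simp only [Pi.smul_apply, hf.2]; rw [smul_comm]⟩

variable (E L) in
/-- The fibre at `x` of the bundle of Spencer cocycles in `L ⊗ (N*)^{⊗(m+1)} ⊗ Λ²V*`. -/
def closedForms (m : ℕ) (x : X) :
    Submodule ℂ (GlobalSections E L × GlobalSections E L → JetForm E L (m + 1) x) where
  -- Linearity is asked in the first variable only; skew symmetry carries it over to the second.
  carrier := {f | (∀ u v w, f (u + v, w) = f (u, w) + f (v, w)) ∧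
    (∀ (c : ℂ) v w, f (c • v, w) = c • f (v, w)) ∧ (∀ v w, f (v, w) = - f (w, v)) ∧
    ∀ u v w, (f (v, w)).curryLeft (globalJet E L x u) + (f (w, u)).curryLeft (globalJet E L x v) +
      (f (u, v)).curryLeft (globalJet E L x w) = 0}
  add_mem' {f g} hf hg := by
    refine ⟨fun u v w => ?_, fun c v w => ?_, fun v w => ?_, fun u v w => ?_⟩
    · simp only [Pi.add_apply, hf.1, hg.1]; abel
    · simp only [Pi.add_apply, hf.2.1, hg.2.1, smul_add]
    · simp only [Pi.add_apply]; rw [hf.2.2.1, hg.2.2.1]; abel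
    · have h1 := hf.2.2.2 u v w
      have h2 := hg.2.2.2 u v w
      rw [← add_zero (0 : JetForm E L m x)]
      nth_rewrite 1 [← h1]
      rw [← h2]
      ext q
      simp only [Pi.add_apply, add_apply, MultilinearMap.curryLeft_apply]
      abel
  zero_mem' := by
    refine ⟨fun u v w => ?_, fun c v w => ?_, fun v w => ?_, fun u v w => ?_⟩
    · simp
    · simp
    · simp
    · ext q; simp
  smul_mem' a f hf := by
    refine ⟨fun u v w => ?_, fun c v w => ?_, fun v w => ?_, fun u v w => ?_⟩
    · simp only [Pi.smul_apply, hf.1, smul_add]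
    · simp only [Pi.smul_apply, hf.2.1]; rw [smul_comm]
    · simp only [Pi.smul_apply]; rw [hf.2.2.1, smul_neg]
    · have h1 := hf.2.2.2 u v w
      rw [← smul_zero a, ← h1]
      ext q
      simp only [Pi.smul_apply, add_apply, smul_apply, MultilinearMap.curryLeft_apply, smul_add]

/-- A section of `L ⊗ ⊙^m N* ⊗ V*` as a linear map on `V`. -/
def familyMap {m : ℕ} {U : Opens X} (β : fibreSections (linearFamilies E L m) U) :
    GlobalSections E L →ₗ[ℂ] symSections E L m U where
  toFun := β.1
  map_add' v w := Subtype.ext (funext fun x => (β.2 x).1 v w)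
  map_smul' c v := Subtype.ext (funext fun x => (β.2 x).2 c v)

lemma familyMap_apply {m : ℕ} {U : Opens X} (β : fibreSections (linearFamilies E L m) U)
    (v : GlobalSections E L) : familyMap β v = β.1 v := rfl

/-- A linear map from `V` to the sections of `L ⊗ ⊙^m N*` as a section of `L ⊗ ⊙^m N* ⊗ V*`. -/
def familyOfMap {m : ℕ} {U : Opens X} (β : GlobalSections E L →ₗ[ℂ] symSections E L m U) :
    fibreSections (linearFamilies E L m) U :=
  ⟨β, fun x => ⟨fun v w => congrArg (fun φ : symSections E L m U => φ.1 x) (β.map_add v w),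
    fun c v => congrArg (fun φ : symSections E L m U => φ.1 x) (β.map_smul c v)⟩⟩

/-- The inclusion `L ⊗ ⊙^{m+1} N* → L ⊗ ⊙^m N* ⊗ V*`. -/
def contractFamily (m : ℕ) (U : Opens X) :
    symSections E L (m + 1) U →ₗ[ℂ] fibreSections (linearFamilies E L m) U where
  toFun φ := familyOfMap
    { toFun := fun v => contractJet v m U φ
      map_add' := fun v w => contractJet_add v w m U φ
      map_smul' := fun c v => contractJet_smul c v m U φ }
  map_add' φ ψ := Subtype.ext (funext fun v => map_add (contractJet v m U) φ ψ)
  map_smul' c φ := Subtype.ext (funext fun v => map_smul (contractJet v m U) c φ)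

lemma apply_cons_cons_comm {m : ℕ} {U : Opens X} (φ : symSections E L (m + 2) U) (x : U)
    (a b : Jet E L (x : X)) (q : Fin m → Jet E L (x : X)) :
    φ.1 x (Fin.cons a (Fin.cons b q)) = φ.1 x (Fin.cons b (Fin.cons a q)) := by
  rw [← φ.2.1 x (Equiv.swap 0 1) (Fin.cons b (Fin.cons a q))]
  congr 1
  ext1 j
  refine Fin.cases ?_ (fun j => Fin.cases ?_ (fun j => ?_) j) j
  · simp
  · simp
  · have h1 : (Fin.succ (Fin.succ j) : Fin (m + 2)) ≠ 0 := Fin.succ_ne_zero _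
    have h2 : (Fin.succ (Fin.succ j) : Fin (m + 2)) ≠ 1 := by
      intro h; exact Fin.succ_ne_zero j (Fin.succ_injective _ h)
    simp [Equiv.swap_apply_of_ne_of_ne h1 h2]

/-- The cyclic identity is `∂² = 0`: its six terms cancel in pairs because each `β v` is symmetric
in its first two arguments. -/
lemma contractJet_sub_mem_closedForms {m : ℕ} {U : Opens X}
    (β : GlobalSections E L →ₗ[ℂ] symSections E L (m + 2) U) :
    (fun p : GlobalSections E L × GlobalSections E L =>
      contractJet p.1 (m + 1) U (β p.2) - contractJet p.2 (m + 1) U (β p.1)) ∈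
        fibreSections (closedForms E L m) U := by
  intro x
  refine ⟨fun u v w => ?_, fun c v w => ?_, fun v w => ?_, fun u v w => ?_⟩
  · have h : contractJet (u + v) (m + 1) U (β w) - contractJet w (m + 1) U (β (u + v)) =
        (contractJet u (m + 1) U (β w) - contractJet w (m + 1) U (β u)) +
          (contractJet v (m + 1) U (β w) - contractJet w (m + 1) U (β v)) := by
      rw [contractJet_add, map_add, map_add, add_sub_add_comm]
    exact congrArg (fun φ : symSections E L (m + 1) U => φ.1 x) h
  · have h : contractJet (c • v) (m + 1) U (β w) - contractJet w (m + 1) U (β (c • v)) =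
        c • (contractJet v (m + 1) U (β w) - contractJet w (m + 1) U (β v)) := by
      rw [contractJet_smul, map_smul, map_smul]
      exact (smul_sub c _ _).symm
    exact congrArg (fun φ : symSections E L (m + 1) U => φ.1 x) h
  · exact congrArg (fun φ : symSections E L (m + 1) U => φ.1 x) (neg_sub _ _).symm
  · refine MultilinearMap.ext fun q => ?_
    change ((β w).1 x (Fin.cons (globalJet E L x v) (Fin.cons (globalJet E L x u) q)) -
        (β v).1 x (Fin.cons (globalJet E L x w) (Fin.cons (globalJet E L x u) q))) +
      ((β u).1 x (Fin.cons (globalJet E L x w) (Fin.cons (globalJet E L x v) q)) -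
        (β w).1 x (Fin.cons (globalJet E L x u) (Fin.cons (globalJet E L x v) q))) +
      ((β v).1 x (Fin.cons (globalJet E L x u) (Fin.cons (globalJet E L x w) q)) -
        (β u).1 x (Fin.cons (globalJet E L x v) (Fin.cons (globalJet E L x w) q))) = 0
    rw [apply_cons_cons_comm (β w) x (globalJet E L x v),
      apply_cons_cons_comm (β v) x (globalJet E L x w),
      apply_cons_cons_comm (β u) x (globalJet E L x w)]
    abel

/-- The Spencer differential `L ⊗ ⊙^{m+2} N* ⊗ V* → L ⊗ ⊙^{m+1} N* ⊗ Λ²V*`. -/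
def spencerFamily (m : ℕ) (U : Opens X) :
    fibreSections (linearFamilies E L (m + 2)) U →ₗ[ℂ] fibreSections (closedForms E L m) U :=
  LinearMap.codRestrict (fibreSections (closedForms E L m) U)
    (LinearMap.pi (fun p : GlobalSections E L × GlobalSections E L =>
      contractJet p.1 (m + 1) U ∘ₗ
          LinearMap.proj (φ := fun _ => symSections E L (m + 2) U) p.2 -
        contractJet p.2 (m + 1) U ∘ₗ
          LinearMap.proj (φ := fun _ => symSections E L (m + 2) U) p.1) ∘ₗ
      (fibreSections (linearFamilies E L (m + 2)) U).subtype)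
    fun β => contractJet_sub_mem_closedForms (familyMap β)

lemma spencerFamily_apply {m : ℕ} {U : Opens X}
    (β : fibreSections (linearFamilies E L (m + 2)) U) (v w : GlobalSections E L) :
    (spencerFamily m U β).1 (v, w) =
      contractJet v (m + 1) U (β.1 w) - contractJet w (m + 1) U (β.1 v) := rfl

/-- The value at a point of a section of closed forms, as a bilinear map. -/
def closedFormAt {m : ℕ} {U : Opens X} (c : fibreSections (closedForms E L m) U) (x : U) :
    GlobalSections E L →ₗ[ℂ] GlobalSections E L →ₗ[ℂ] JetForm E L (m + 1) x :=
  LinearMap.mk₂ ℂ (fun v w => (c.1 (v, w)).1 x) (fun u v w => (c.2 x).1 u v w)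
    (fun a v w => (c.2 x).2.1 a v w)
    (fun u v w => by
      have h : ∀ v w, (c.1 (v, w)).1 x = -(c.1 (w, v)).1 x := (c.2 x).2.2.1
      have h' : (c.1 (v + w, u)).1 x = (c.1 (v, u)).1 x + (c.1 (w, u)).1 x := (c.2 x).1 v w u
      rw [h, h', h u v, h u w, neg_add])
    (fun a v w => by
      have h : ∀ v w, (c.1 (v, w)).1 x = -(c.1 (w, v)).1 x := (c.2 x).2.2.1
      have h' : (c.1 (a • w, v)).1 x = a • (c.1 (w, v)).1 x := (c.2 x).2.1 a w v
      rw [h, h', h v w, smul_neg])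

variable [FiniteDimensional ℂ E]

/-- The Spencer differential is locally surjective onto the sheaf of cocycles. -/
theorem exists_local_primitive (hL : VeryAmple E L) {m : ℕ} {U : Opens X}
    (c : fibreSections (closedForms E L m) U) {x : X} (hx : x ∈ U) :
    ∃ (W : Opens X) (h : W ≤ U), x ∈ W ∧
      ∃ β, spencerFamily m W β = fibreRestrict (closedForms E L m) h c := by
  obtain ⟨W₀, n, e, a, hxW, ha, hah⟩ := exists_jet_frame hL x
  let W : Opens X := U ⊓ W₀
  have hWU : W ≤ U := inf_le_left
  -- The right inverse is built from the holomorphic frame, so that a primitive formed with it in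
  -- each fibre is again holomorphic.
  let σ : ∀ y : X, Jet E L y →ₗ[ℂ] GlobalSections E L := fun y =>
    ∑ i, (LinearMap.proj i ∘ₗ a y).smulRight (e i)
  have hσ_apply : ∀ y q, σ y q = ∑ i, a y q i • e i := fun y q => by simp [σ]
  have hσ : ∀ y ∈ W, ∀ q, globalJet E L y (σ y q) = q := by
    intro y hy q
    rw [hσ_apply, map_sum]
    simp only [map_smul]
    exact ha y hy.2 q
  let B : ∀ y : W, GlobalSections E L →ₗ[ℂ] GlobalSections E L →ₗ[ℂ] JetForm E L (m + 1) y :=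
    fun y => closedFormAt c ⟨y, hWU y.2⟩
  have hBsym : ∀ (y : W) v w (τ : Equiv.Perm (Fin (m + 1))) q, B y v w (q ∘ τ) = B y v w q :=
    fun y v w τ q => (c.1 (v, w)).2.1 ⟨y, hWU y.2⟩ τ q
  -- Expanding `σ` in the frame turns the sum into combinations of values of the holomorphic
  -- sections `c (v, e l)`, with holomorphic coefficients.
  have hsum : ∀ v, (fun y : W => koszulSum (B y) (σ y) v) ∈ symSections E L (m + 2) W := by
    intro v
    refine ⟨fun y τ q => koszulSum_perm (hBsym y) (σ y) v τ q, fun y s hs => ?_⟩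
    have h1 : HolAt E L (∑ i : Fin (m + 2), ∑ l : Fin n, fun z => a z (jet E L z (s i)) l •
        evalJets (c.1 (v, e l)).1 (i.removeNth s) z) y :=
      HolAt.sum fun i _ => HolAt.sum fun l _ => HolAt.smul (hah y y.2.2 (s i) (hs i) l)
        (HolAt.evalJets (c.1 (v, e l)) (hWU y.2) fun j => hs _)
    refine h1.congr ?_
    filter_upwards [W.isOpen.mem_nhds y.2] with z hz
    rw [evalJets_of_mem _ _ hz, koszulSum_apply, Finset.sum_apply]
    refine Finset.sum_congr rfl fun i _ => ?_
    rw [hσ_apply, map_sum, sum_apply, Finset.sum_apply]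
    refine Finset.sum_congr rfl fun l _ => ?_
    rw [map_smul, smul_apply, evalJets_of_mem _ _ (hWU hz)]
    rfl
  let β₀ : ∀ y : W, GlobalSections E L →ₗ[ℂ] JetForm E L (m + 2) y := fun y =>
    koszulPrimitive (B y) (globalJet E L (y : X)) (σ y)
  have hβ₀ : ∀ v, (fun y : W => β₀ y v) ∈ symSections E L (m + 2) W := by
    intro v
    have h1 : (fun y : W => koszulSum (B y) (σ y) (σ y (globalJet E L y v))) ∈
        symSections E L (m + 2) W := by
      have h2 : (fun y : W => koszulSum (B y) (σ y) (σ y (globalJet E L y v))) =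
          ∑ l : Fin n, fun y : W => a y (jet E L (y : X) v) l • koszulSum (B y) (σ y) (e l) := by
        funext y
        rw [hσ_apply, map_sum, Finset.sum_apply]
        simp only [map_smul]
        rfl
      rw [h2]
      exact Submodule.sum_mem _ fun l _ => smul_mem_symSections (hsum (e l))
        (f := fun z => a z (jet E L z v) l) fun z hz => hah z hz.2 v (v.hol z) l
    exact (symSections E L (m + 2) W).add_mem
      ((symSections E L (m + 2) W).smul_mem _ (hsum v))
      ((symSections E L (m + 2) W).smul_mem _ h1)
  refine ⟨W, hWU, ⟨hx, hxW⟩, ⟨fun v => ⟨_, hβ₀ v⟩, fun y => ⟨fun v w => (β₀ y).map_add v w,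
    fun c v => (β₀ y).map_smul c v⟩⟩, fibreSections_ext fun p y => MultilinearMap.ext fun r => ?_⟩
  have hc := c.2 ⟨y, hWU y.2⟩
  exact koszulPrimitive_spec (hσ y y.2) (fun v w => hc.2.2.1 v w) (hBsym y)
    (fun u v w q => MultilinearMap.congr_fun (hc.2.2.2 u v w) q) p.1 p.2 r

end SpencerSheaves

end JetSpencer

end

noncomputable section

namespace JetSpencer

open Topology TopologicalSpace CategoryTheory Opposite

/-! ### The short exact sequence, its cohomology, and the action of `𝔤` on it. -/

section SpencerSequence

variable {E : Type*} [NormedAddCommGroup E] [NormedSpace ℂ E]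
  {X : Type u} [TopologicalSpace X] [ChartedSpace E X] [IsManifold 𝓘(ℂ, E) ω X]
  {L : X → Type u} [∀ x, AddCommGroup (L x)] [∀ x, Module ℂ (L x)]
  [∀ x, TopologicalSpace (L x)] [TopologicalSpace (TotalSpace ℂ L)] [FiberBundle ℂ L]
  [VectorBundle ℂ ℂ L] [ContMDiffVectorBundle ω ℂ L 𝓘(ℂ, E)]

/-- Passes from identities in the fibres to identities between sections; over `⊤` the latter
translate into the Spencer cocycle condition. -/
lemma mem_closedForms_iff {m : ℕ} {U : Opens X}
    {f : GlobalSections E L × GlobalSections E L → symSections E L (m + 1) U} :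
    f ∈ fibreSections (closedForms E L m) U ↔
      (∀ u v w, f (u + v, w) = f (u, w) + f (v, w)) ∧
      (∀ (c : ℂ) v w, f (c • v, w) = c • f (v, w)) ∧ (∀ v w, f (v, w) = - f (w, v)) ∧
      ∀ u v w, contractJet u m U (f (v, w)) + contractJet v m U (f (w, u)) +
        contractJet w m U (f (u, v)) = 0 := by
  constructor
  · intro h
    refine ⟨fun u v w => Subtype.ext (funext fun x => ?_),
      fun c v w => Subtype.ext (funext fun x => ?_), fun v w => Subtype.ext (funext fun x => ?_),
      fun u v w => Subtype.ext (funext fun x => ?_)⟩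
    · exact (h x).1 u v w
    · exact (h x).2.1 c v w
    · exact (h x).2.2.1 v w
    · exact (h x).2.2.2 u v w
  · rintro ⟨h1, h2, h3, h4⟩ x
    exact ⟨fun u v w => congrArg (fun φ : symSections E L (m + 1) U => φ.1 x) (h1 u v w),
      fun c v w => congrArg (fun φ : symSections E L (m + 1) U => φ.1 x) (h2 c v w),
      fun v w => congrArg (fun φ : symSections E L (m + 1) U => φ.1 x) (h3 v w),
      fun u v w => congrArg (fun φ : symSections E L m U => φ.1 x) (h4 u v w)⟩

variable (E L) in
/-- The complex `L ⊗ ⊙^{m+3} N* → L ⊗ ⊙^{m+2} N* ⊗ V* → Z` of sheaves, where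
`Z ⊆ L ⊗ ⊙^{m+1} N* ⊗ Λ²V*` is the sheaf of Spencer cocycles. -/
def spencerSequence (m : ℕ) :
    ShortComplex (Sheaf (Opens.grothendieckTopology X) AddCommGrpCat.{u}) :=
  ShortComplex.mk (X₁ := symSheaf E L (m + 3)) (X₂ := fibreSheaf (linearFamilies E L (m + 2)))
    (X₃ := fibreSheaf (closedForms E L m))
    (sheafHomMk (fun U => (contractFamily (m + 2) U).toAddMonoidHom) fun _ _ _ _ => rfl)
    (sheafHomMk (fun U => (spencerFamily m U).toAddMonoidHom) fun _ _ _ _ => rfl)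
    (by
      ext U φ
      refine fibreSections_ext fun p x => MultilinearMap.ext fun q => ?_
      exact sub_eq_zero.2 (apply_cons_cons_comm (show symSections E L (m + 3) U.unop from φ) x
        (globalJet E L x p.2) (globalJet E L x p.1) q))

/-- The evaluation `L ⊗ ⊙^m N* ⊗ V* → L ⊗ ⊙^m N*` at an element of `V`. -/
def evalHom (m : ℕ) (v : GlobalSections E L) :
    fibreSheaf (linearFamilies E L m) ⟶ symSheaf E L m :=
  sheafHomMk (F := fibreSheaf (linearFamilies E L m)) (G := symSheaf E L m)
    (fun U => (LinearMap.proj (φ := fun _ => symSections E L m U) v ∘ₗ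
      (fibreSections (linearFamilies E L m) U).subtype).toAddMonoidHom) fun _ _ _ _ => rfl

/-- The map `φ ↦ φ ⊗ l` defined by `l ∈ V*`. -/
def tensorFamily {m : ℕ} (l : GlobalSections E L →ₗ[ℂ] ℂ) (U : Opens X) :
    symSections E L m U →ₗ[ℂ] fibreSections (linearFamilies E L m) U where
  toFun φ := familyOfMap (l.smulRight φ)
  map_add' φ ψ := Subtype.ext (funext fun v => smul_add (l v) φ ψ)
  map_smul' c φ := Subtype.ext (funext fun v => smul_comm (l v) c φ)

lemma sum_tensorFamily {m : ℕ} {U : Opens X} {ι : Type*} [Fintype ι]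
    (b : Module.Basis ι ℂ (GlobalSections E L)) (β : fibreSections (linearFamilies E L m) U) :
    ∑ i, tensorFamily (b.coord i) U (β.1 (b i)) = β := by
  refine Subtype.ext (funext fun v => ?_)
  rw [Submodule.coe_sum, Finset.sum_apply, ← familyMap_apply β v]
  conv_rhs => rw [← b.sum_repr v, map_sum]
  refine Finset.sum_congr rfl fun i _ => ?_
  rw [map_smul]
  rfl

/-- The map `L ⊗ ⊙^m N* → L ⊗ ⊙^m N* ⊗ V*` defined by an element of `V*`. -/
def tensorHom (m : ℕ) (l : GlobalSections E L →ₗ[ℂ] ℂ) :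
    symSheaf E L m ⟶ fibreSheaf (linearFamilies E L m) :=
  sheafHomMk (F := symSheaf E L m) (G := fibreSheaf (linearFamilies E L m))
    (fun U => (tensorFamily l U).toAddMonoidHom) fun _ _ _ _ => rfl

/-- A finite basis of `V` splits the identity of `L ⊗ ⊙^m N* ⊗ V*` through copies of `L ⊗ ⊙^m N*`.
This is how cohomology is seen to commute with `⊗ V*`. -/
lemma sum_evalHom_comp_tensorHom (m : ℕ) {ι : Type*} [Fintype ι]
    (b : Module.Basis ι ℂ (GlobalSections E L)) :
    ∑ i, evalHom m (b i) ≫ tensorHom m (b.coord i) = 𝟙 (fibreSheaf (linearFamilies E L m)) := by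
  ext U β
  let ev : (fibreSheaf (linearFamilies E L m) ⟶ fibreSheaf (linearFamilies E L m)) →+
      fibreSections (linearFamilies E L m) U.unop :=
    AddMonoidHom.mk' (fun f => f.hom.app U β) fun f g => rfl
  exact (map_sum ev _ _).trans (sum_tensorFamily b β)

/-- A class in `H¹(X, L ⊗ ⊙^m N* ⊗ V*)` vanishes if its contractions with elements of `V` do. -/
lemma H_fibreSheaf_eq_zero [FiniteDimensional ℂ (GlobalSections E L)] {m : ℕ}
    (h : Sheaf.H (fibreSheaf (linearFamilies E L m)) 1)
    (hh : ∀ v : GlobalSections E L, Sheaf.H.map (evalHom m v) 1 h = 0) : h = 0 := by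
  let b := Module.finBasis ℂ (GlobalSections E L)
  let μ : (fibreSheaf (linearFamilies E L m) ⟶ fibreSheaf (linearFamilies E L m)) →+
      Sheaf.H (fibreSheaf (linearFamilies E L m)) 1 :=
    AddMonoidHom.mk' (fun f => Sheaf.H.map f 1 h) fun f g => Sheaf.H.map_add_apply f g h
  have h1 : μ (𝟙 _) = h := Sheaf.H.map_id_apply h
  rw [← h1, ← sum_evalHom_comp_tensorHom m b, map_sum]
  refine Finset.sum_eq_zero fun i _ => ?_
  change Sheaf.H.map (evalHom m (b i) ≫ tensorHom m (b.coord i)) 1 h = 0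
  rw [Sheaf.H.map_comp_apply, hh, map_zero]

/-- The inclusion into `L ⊗ ⊙^{m+2} N* ⊗ V*` followed by evaluation at `v` is the contraction with
`v`, and the evaluations detect classes because `V` is finite-dimensional. -/
lemma map_spencerSequence_f_eq_zero_iff [FiniteDimensional ℂ (GlobalSections E L)] {m : ℕ}
    (h : H1 E L (m + 3)) :
    Sheaf.H.map (spencerSequence E L m).f 1 h = 0 ↔ H1contract (m + 2) h = 0 := by
  have key : ∀ v : GlobalSections E L, Sheaf.H.map (evalHom (m + 2) v) 1 (Sheaf.H.map (spencerSequence E L m).f 1 h) =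
      H1contract (m + 2) h v := by
    intro v
    exact (Sheaf.H.map_comp_apply (spencerSequence E L m).f (evalHom (m + 2) v) h).symm
  constructor
  · intro h0
    refine LinearMap.ext fun v => ?_
    exact (key v).symm.trans ((congrArg (Sheaf.H.map (evalHom (m + 2) v) 1) h0).trans
      (map_zero _))
  · intro h0
    refine H_fibreSheaf_eq_zero _ fun v => ?_
    rw [key, h0]
    rfl

/-- The action of `D ∈ H⁰(X, L ⊗ N*)` on the sections of `L ⊗ ⊙^m N* ⊗ V*`. -/
def familyAct (D : InfAut E L) (m : ℕ) (U : Opens X) :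
    fibreSections (linearFamilies E L m) U →ₗ[ℂ] fibreSections (linearFamilies E L m) U where
  toFun β := familyOfMap (lieDeriv D m U ∘ₗ familyMap β - familyMap β ∘ₗ rep D)
  map_add' β γ := by
    refine Subtype.ext (funext fun v => ?_)
    change lieDeriv D m U (β.1 v + γ.1 v) - (β.1 (rep D v) + γ.1 (rep D v)) =
      (lieDeriv D m U (β.1 v) - β.1 (rep D v)) + (lieDeriv D m U (γ.1 v) - γ.1 (rep D v))
    rw [map_add, add_sub_add_comm]
  map_smul' c β := by
    refine Subtype.ext (funext fun v => ?_)
    change lieDeriv D m U (c • β.1 v) - c • β.1 (rep D v) =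
      c • (lieDeriv D m U (β.1 v) - β.1 (rep D v))
    rw [map_smul]
    exact (smul_sub c _ _).symm

lemma add_sub_add_sub_add {G : Type*} [AddCommGroup G] (a b c a' b' c' : G) :
    (a + a') - (b + b') - (c + c') = (a - b - c) + (a' - b' - c') := by abel

lemma smul_sub_smul_sub_smul {G : Type*} [AddCommGroup G] [Module ℂ G] (r : ℂ) (a b c : G) :
    r • a - r • b - r • c = r • (a - b - c) := by
  rw [smul_sub, smul_sub]

/-- By the product rule the cyclic sum for the new family is the Lie derivative of the cyclic sum of
`f` minus the cyclic sums with `D` applied to `u`, to `v` and to `w`. All four vanish; `aux` does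
the regrouping. -/
lemma act_mem_closedForms (D : InfAut E L) {m : ℕ} {U : Opens X}
    {f : GlobalSections E L × GlobalSections E L → symSections E L (m + 1) U}
    (hf : f ∈ fibreSections (closedForms E L m) U) :
    (fun p => lieDeriv D (m + 1) U (f p) - f (rep D p.1, p.2) - f (p.1, rep D p.2)) ∈
      fibreSections (closedForms E L m) U := by
  obtain ⟨h1, h2, h3, h4⟩ := mem_closedForms_iff.1 hf
  have aux : ∀ {G : Type u} [AddCommGroup G]
      {a₁ a₂ a₃ b₁ b₂ b₃ c₁ c₂ c₃ d₁ d₂ d₃ : G}, a₁ + a₂ + a₃ = 0 → b₁ + b₂ + b₃ = 0 →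
      c₁ + c₂ + c₃ = 0 → d₁ + d₂ + d₃ = 0 →
      (a₁ - b₁ - c₁ - d₁) + (a₂ - c₂ - d₂ - b₂) + (a₃ - d₃ - b₃ - c₃) = 0 := by
    intro G _ a₁ a₂ a₃ b₁ b₂ b₃ c₁ c₂ c₃ d₁ d₂ d₃ ha hb hc hd
    have : (a₁ - b₁ - c₁ - d₁) + (a₂ - c₂ - d₂ - b₂) + (a₃ - d₃ - b₃ - c₃) =
      (a₁ + a₂ + a₃) - (b₁ + b₂ + b₃) - (c₁ + c₂ + c₃) - (d₁ + d₂ + d₃) := by abel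
    rw [this, ha, hb, hc, hd]; simp
  have aux'' : ∀ {G : Type u} [AddCommGroup G] (a b c : G),
      -a - (-b) - (-c) = -(a - c - b) := by intros; abel
  rw [mem_closedForms_iff]
  refine ⟨fun u v w => ?_, fun a v w => ?_, fun v w => ?_, fun u v w => ?_⟩
  · simp only
    rw [h1, map_add, map_add, h1, h1]
    exact add_sub_add_sub_add _ _ _ _ _ _
  · simp only
    rw [h2, map_smul, map_smul, h2, h2]
    exact smul_sub_smul_sub_smul _ _ _ _
  · simp only
    rw [h3 v w, h3 (rep D v) w, h3 v (rep D w), map_neg]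
    exact aux'' _ _ _
  · have e0 := congrArg (lieDeriv D m U) (h4 u v w)
    rw [map_add, map_add, map_zero] at e0
    simp only
    rw [map_sub, map_sub, contractJet_lieDeriv, map_sub, map_sub, contractJet_lieDeriv,
      map_sub, map_sub, contractJet_lieDeriv]
    exact aux e0 (h4 (rep D u) v w) (h4 u (rep D v) w) (h4 u v (rep D w))

/-- The action of `D ∈ H⁰(X, L ⊗ N*)` on the sections of the sheaf of Spencer cocycles. -/
def closedAct (D : InfAut E L) (m : ℕ) (U : Opens X) :
    fibreSections (closedForms E L m) U →ₗ[ℂ] fibreSections (closedForms E L m) U where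
  toFun c := ⟨_, act_mem_closedForms D c.2⟩
  map_add' b c := Subtype.ext (funext fun p =>
    (congrArg (fun t => t - (b.1 (rep D p.1, p.2) + c.1 (rep D p.1, p.2)) -
      (b.1 (p.1, rep D p.2) + c.1 (p.1, rep D p.2)))
        (map_add (lieDeriv D (m + 1) U) (b.1 p) (c.1 p))).trans
      (add_sub_add_sub_add _ _ _ _ _ _))
  map_smul' r c := Subtype.ext (funext fun p =>
    (congrArg (fun t => t - r • c.1 (rep D p.1, p.2) - r • c.1 (p.1, rep D p.2))
      (map_smul (lieDeriv D (m + 1) U) r (c.1 p))).trans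
      (smul_sub_smul_sub_smul _ _ _ _))

/-- Endomorphisms of the Spencer sequence from linear maps that commute with the differentials. -/
def spencerSequenceHom {m : ℕ}
    (F : ∀ U : Opens X, symSections E L (m + 3) U →ₗ[ℂ] symSections E L (m + 3) U)
    (hF : ∀ (U U' : Opens X) (h : U ≤ U') (φ : symSections E L (m + 3) U'),
      F U (restrict h φ) = restrict h (F U' φ))
    (G : ∀ U : Opens X, fibreSections (linearFamilies E L (m + 2)) U →ₗ[ℂ]
      fibreSections (linearFamilies E L (m + 2)) U)
    (hG : ∀ (U U' : Opens X) (h : U ≤ U') (β), G U (fibreRestrict _ h β) =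
      fibreRestrict _ h (G U' β))
    (K : ∀ U : Opens X, fibreSections (closedForms E L m) U →ₗ[ℂ]
      fibreSections (closedForms E L m) U)
    (hK : ∀ (U U' : Opens X) (h : U ≤ U') (c), K U (fibreRestrict _ h c) =
      fibreRestrict _ h (K U' c))
    (hFG : ∀ U φ, contractFamily (m + 2) U (F U φ) = G U (contractFamily (m + 2) U φ))
    (hGK : ∀ U β, spencerFamily m U (G U β) = K U (spencerFamily m U β)) :
    spencerSequence E L m ⟶ spencerSequence E L m where
  τ₁ := sheafHom F hF
  τ₂ := sheafHomMk (F := fibreSheaf (linearFamilies E L (m + 2)))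
    (G := fibreSheaf (linearFamilies E L (m + 2)))
    (fun U => (G U).toAddMonoidHom) fun U U' h β => hG U U' h β
  τ₃ := sheafHomMk (F := fibreSheaf (closedForms E L m)) (G := fibreSheaf (closedForms E L m))
    (fun U => (K U).toAddMonoidHom) fun U U' h c => hK U U' h c
  comm₁₂ := by
    ext U φ
    exact hFG U.unop φ
  comm₂₃ := by
    ext U β
    exact hGK U.unop β

/-- The action of `D` on the Spencer sequence. -/
def spencerSequenceAct (D : InfAut E L) (m : ℕ) : spencerSequence E L m ⟶ spencerSequence E L m :=
  spencerSequenceHom (lieDeriv D (m + 3)) (lieDeriv_restrict D (m + 3)) (familyAct D (m + 2))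
    (fun U U' h β => Subtype.ext (funext fun v => by
      change lieDeriv D (m + 2) U (restrict h (β.1 v)) - restrict h (β.1 (rep D v)) =
        restrict h (lieDeriv D (m + 2) U' (β.1 v) - β.1 (rep D v))
      rw [lieDeriv_restrict, map_sub]))
    (closedAct D m)
    (fun U U' h c => Subtype.ext (funext fun p => by
      change lieDeriv D (m + 1) U (restrict h (c.1 p)) - restrict h (c.1 (rep D p.1, p.2)) -
          restrict h (c.1 (p.1, rep D p.2)) =
        restrict h (lieDeriv D (m + 1) U' (c.1 p) - c.1 (rep D p.1, p.2) - c.1 (p.1, rep D p.2))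
      rw [lieDeriv_restrict, map_sub, map_sub]))
    (fun U φ => Subtype.ext (funext fun v => contractJet_lieDeriv D v (m + 2) U φ))
    (fun U β => Subtype.ext (funext fun p => by
      change contractJet p.1 (m + 1) U (lieDeriv D (m + 2) U (β.1 p.2) - β.1 (rep D p.2)) -
          contractJet p.2 (m + 1) U (lieDeriv D (m + 2) U (β.1 p.1) - β.1 (rep D p.1)) =
        lieDeriv D (m + 1) U (contractJet p.1 (m + 1) U (β.1 p.2) -
          contractJet p.2 (m + 1) U (β.1 p.1)) -
        (contractJet (rep D p.1) (m + 1) U (β.1 p.2) -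
          contractJet p.2 (m + 1) U (β.1 (rep D p.1))) -
        (contractJet p.1 (m + 1) U (β.1 (rep D p.2)) -
          contractJet (rep D p.2) (m + 1) U (β.1 p.1))
      simp only [map_sub, contractJet_lieDeriv]
      abel))

variable (E L) in
/-- Multiplication by a scalar on the Spencer sequence. -/
def spencerSequenceSmul (a : ℂ) (m : ℕ) : spencerSequence E L m ⟶ spencerSequence E L m :=
  spencerSequenceHom (fun _ => a • LinearMap.id) (fun _ _ h φ => by simp)
    (fun _ => a • LinearMap.id) (fun _ _ h φ => by simp)
    (fun _ => a • LinearMap.id) (fun _ _ h φ => by simp) (fun U φ => by simp)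
    (fun U φ => by simp)

variable [FiniteDimensional ℂ E]

/-- Injectivity holds because global jets fill the fibres, exactness in the middle by reconstruction
from contractions, and local surjectivity by the Koszul primitive. -/
lemma spencerSequence_shortExact (hL : VeryAmple E L) (m : ℕ) :
    (spencerSequence E L m).ShortExact := by
  refine shortExact_of_sections _ _ _ (fun U φ ψ h => ?_) (fun U β hβ => ?_) fun U c x hx => ?_
  · refine contractJet_ext hL fun v => ?_
    exact congrArg (fun β : fibreSections (linearFamilies E L (m + 2)) U => β.1 v) h
  · obtain ⟨φ, hφ⟩ := exists_contractJet_eq hL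
      (familyMap (show fibreSections (linearFamilies E L (m + 2)) U from β)) fun v w =>
        sub_eq_zero.1 (congrArg (fun c : fibreSections (closedForms E L m) U => c.1 (v, w)) hβ)
    exact ⟨φ, Subtype.ext (funext fun v => hφ v)⟩
  · obtain ⟨W, h, hxW, β, hβ⟩ := exists_local_primitive hL
      (show fibreSections (closedForms E L m) U from c) hx
    exact ⟨W, h, hxW, β, hβ⟩

/-- The connecting map `H⁰(X, Z) → H¹(X, L ⊗ ⊙^{m+3} N*)`, where `Z` is the sheaf of Spencer
cocycles. -/
def spencerConnecting (hL : VeryAmple E L) (m : ℕ) :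
    fibreSections (closedForms E L m) (⊤ : Opens X) →ₗ[ℂ] H1 E L (m + 3) where
  toFun := connecting (spencerSequence_shortExact hL m)
  map_add' := map_add (connecting (spencerSequence_shortExact hL m))
  -- Scalars act on `H¹` by functoriality, so homogeneity is naturality for the scalar endomorphism
  -- of the sequence.
  map_smul' a c := connecting_naturality (spencerSequence_shortExact hL m)
    (spencerSequence_shortExact hL m) (spencerSequenceSmul E L a m) c

lemma spencerConnecting_eq_zero_iff (hL : VeryAmple E L) {m : ℕ}
    (c : fibreSections (closedForms E L m) (⊤ : Opens X)) :
    spencerConnecting hL m c = 0 ↔ ∃ β, spencerFamily m ⊤ β = c :=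
  connecting_eq_zero_iff (spencerSequence_shortExact hL m) c

lemma H1contract_eq_zero_iff (hL : VeryAmple E L) [FiniteDimensional ℂ (GlobalSections E L)]
    {m : ℕ} (h : H1 E L (m + 3)) :
    H1contract (m + 2) h = 0 ↔ ∃ c, spencerConnecting hL m c = h :=
  (map_spencerSequence_f_eq_zero_iff h).symm.trans
    (map_f_eq_zero_iff (spencerSequence_shortExact hL m) h)

lemma spencerConnecting_closedAct (hL : VeryAmple E L) {m : ℕ} (D : InfAut E L)
    (c : fibreSections (closedForms E L m) (⊤ : Opens X)) :
    spencerConnecting hL m (closedAct D m ⊤ c) = H1act D (m + 3) (spencerConnecting hL m c) :=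
  connecting_naturality (spencerSequence_shortExact hL m) (spencerSequence_shortExact hL m)
    (spencerSequenceAct D m) c

end SpencerSequence

end JetSpencer

end

noncomputable section

namespace JetSpencer

open Topology TopologicalSpace CategoryTheory Opposite

attribute [local instance] LieRing.ofAssociativeRing

/-! ### Translation between Spencer cochains and global sections. -/

section SpencerCohomology

/-- An alternating form of degree two from a bilinear map. -/
def alternatingOfBilinear {V W : Type*} [AddCommGroup V] [Module ℂ V] [AddCommGroup W]
    [Module ℂ W] (B : V →ₗ[ℂ] V →ₗ[ℂ] W) (hB : ∀ v, B v v = 0) : V [⋀^Fin 2]→ₗ[ℂ] W :=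
  { MultilinearMap.mk' (fun v : Fin 2 → V => B (v 0) (v 1))
      (fun v i x y => by fin_cases i <;> simp)
      (fun v i c x => by fin_cases i <;> simp) with
    map_eq_zero_of_eq' := fun v i j hv hij => by
      change B (v 0) (v 1) = 0
      have h : v 0 = v 1 := by
        fin_cases i <;> fin_cases j <;> simp_all
      rw [h, hB] }

lemma differential_one_apply {V : Type*} [AddCommGroup V] [Module ℂ V]
    (𝔤 : LieSubalgebra ℂ (Module.End ℂ V)) (m : ℕ) (η : Spencer.Cochain 𝔤 (m + 1) 1)
    (v : Fin 2 → V) :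
    Spencer.differential 𝔤 m 1 η v =
      Spencer.contract 𝔤 m (v 0) (η fun _ => v 1) -
        Spencer.contract 𝔤 m (v 1) (η fun _ => v 0) := by
  rw [Spencer.differential_apply, Fin.sum_univ_two]
  have h0 : Fin.removeNth (0 : Fin 2) v = fun _ => v 1 := by
    funext i; rw [Subsingleton.elim i 0]; rfl
  have h1 : Fin.removeNth (1 : Fin 2) v = fun _ => v 0 := by
    funext i; rw [Subsingleton.elim i 0]; rfl
  rw [h0, h1]
  simp [sub_eq_add_neg]

/-- The sign of the middle term is absorbed by exchanging its two arguments, which yields the cyclic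
form used in `closedForms`. -/
lemma differential_two_apply {V : Type*} [AddCommGroup V] [Module ℂ V]
    (𝔤 : LieSubalgebra ℂ (Module.End ℂ V)) (m : ℕ) (θ : Spencer.Cochain 𝔤 (m + 1) 2)
    (v : Fin 3 → V) :
    Spencer.differential 𝔤 m 2 θ v =
      Spencer.contract 𝔤 m (v 0) (θ ![v 1, v 2]) + Spencer.contract 𝔤 m (v 1) (θ ![v 2, v 0]) +
        Spencer.contract 𝔤 m (v 2) (θ ![v 0, v 1]) := by
  rw [Spencer.differential_apply, Fin.sum_univ_three]
  have h0 : Fin.removeNth (0 : Fin 3) v = ![v 1, v 2] := by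
    funext i; fin_cases i <;> rfl
  have h1 : Fin.removeNth (1 : Fin 3) v = ![v 2, v 0] ∘ Equiv.swap 0 1 := by
    funext i; fin_cases i <;> rfl
  have h2 : Fin.removeNth (2 : Fin 3) v = ![v 0, v 1] := by
    funext i; fin_cases i <;> rfl
  rw [h0, h1, h2, AlternatingMap.map_swap _ _ (by decide), map_neg]
  simp

variable {E : Type*} [NormedAddCommGroup E] [NormedSpace ℂ E] [FiniteDimensional ℂ E]
  {X : Type u} [TopologicalSpace X] [ChartedSpace E X] [IsManifold 𝓘(ℂ, E) ω X]
  {L : X → Type u} [∀ x, AddCommGroup (L x)] [∀ x, Module ℂ (L x)]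
  [∀ x, TopologicalSpace (L x)] [TopologicalSpace (TotalSpace ℂ L)] [FiberBundle ℂ L]
  [VectorBundle ℂ ℂ L] [ContMDiffVectorBundle ω ℂ L 𝓘(ℂ, E)]

lemma toTensor_mem_prolong (hL : VeryAmple E L) {m : ℕ} (φ : symSections E L m (⊤ : Opens X)) :
    toTensor E L m φ ∈ Spencer.prolong (lieAlgebra E L) m := by
  cases m with
  | zero => exact Submodule.mem_top
  | succ m => rw [← range_toTensor hL]; exact ⟨φ, rfl⟩

/-- The map `H⁰(X, L ⊗ ⊙^m N*) → 𝔤^{(m-1)}`. -/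
def toProlongation (hL : VeryAmple E L) (m : ℕ) :
    symSections E L m (⊤ : Opens X) →ₗ[ℂ] Spencer.Prolongation (lieAlgebra E L) m :=
  (toTensor E L m).codRestrict (Spencer.prolong (lieAlgebra E L) m)
    fun φ => toTensor_mem_prolong hL φ

lemma toProlongation_injective (hL : VeryAmple E L) (m : ℕ) :
    Function.Injective (toProlongation hL m) := fun _ _ h =>
  toTensor_injective hL m (congrArg Subtype.val h)

lemma toProlongation_surjective (hL : VeryAmple E L) (m : ℕ) :
    Function.Surjective (toProlongation hL (m + 1)) := by
  rintro ⟨T, hT⟩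
  rw [← range_toTensor hL] at hT
  obtain ⟨φ, rfl⟩ := hT
  exact ⟨φ, rfl⟩

lemma contract_toProlongation (hL : VeryAmple E L) {m : ℕ} (v : GlobalSections E L)
    (φ : symSections E L (m + 1) (⊤ : Opens X)) :
    Spencer.contract (lieAlgebra E L) m v (toProlongation hL (m + 1) φ) =
      toProlongation hL m (contractJet v m ⊤ φ) :=
  Subtype.ext (toTensor_contractJet v φ).symm

lemma prolongAct_toProlongation (hL : VeryAmple E L) {m : ℕ} (D : InfAut E L)
    (φ : symSections E L m (⊤ : Opens X)) :
    Spencer.prolongAct (lieAlgebra E L) m (toLie D) (toProlongation hL m φ) =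
      toProlongation hL m (lieDeriv D m ⊤ φ) :=
  Subtype.ext (toTensor_lieDeriv D φ).symm

/-- The isomorphism `H⁰(X, L ⊗ ⊙^{m+1} N*) ≃ 𝔤^{(m)}`. -/
def prolongationEquiv (hL : VeryAmple E L) (m : ℕ) :
    symSections E L (m + 1) (⊤ : Opens X) ≃ₗ[ℂ] Spencer.Prolongation (lieAlgebra E L) (m + 1) :=
  LinearEquiv.ofBijective (toProlongation hL (m + 1))
    ⟨toProlongation_injective hL (m + 1), toProlongation_surjective hL m⟩

lemma toProlongation_prolongationEquiv_symm (hL : VeryAmple E L) {m : ℕ}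
    (T : Spencer.Prolongation (lieAlgebra E L) (m + 1)) :
    toProlongation hL (m + 1) ((prolongationEquiv hL m).symm T) = T :=
  (prolongationEquiv hL m).apply_symm_apply T

lemma cocycle_mem_closedForms (hL : VeryAmple E L) {k : ℕ}
    (θ : Spencer.cocycles (lieAlgebra E L) k 1) :
    (fun p : GlobalSections E L × GlobalSections E L =>
      (prolongationEquiv hL k).symm (θ.1 ![p.1, p.2])) ∈
        fibreSections (closedForms E L k) (⊤ : Opens X) := by
  rw [mem_closedForms_iff]
  refine ⟨fun u v w => ?_, fun c v w => ?_, fun v w => ?_, fun u v w => ?_⟩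
  · rw [← map_add]
    exact congrArg _ (θ.1.toMultilinearMap.cons_add ![w] u v)
  · rw [← map_smul]
    exact congrArg _ (θ.1.toMultilinearMap.cons_smul ![w] c v)
  · rw [← map_neg, ← AlternatingMap.map_swap θ.1 ![w, v] (i := 0) (j := 1) (by decide)]
    congr 2
    funext i
    fin_cases i <;> rfl
  -- The cyclic identity lives in degree `k`, which may be 0; only the injectivity of the comparison
  -- map is needed there.
  · apply toProlongation_injective hL k
    rw [map_add, map_add, map_zero, ← contract_toProlongation, ← contract_toProlongation,
      ← contract_toProlongation, toProlongation_prolongationEquiv_symm,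
      toProlongation_prolongationEquiv_symm, toProlongation_prolongationEquiv_symm]
    have h := AlternatingMap.congr_fun (show Spencer.differential (lieAlgebra E L) k 2 θ.1 = 0
      from θ.2) ![u, v, w]
    rw [differential_two_apply] at h
    exact h

/-- Spencer cocycles as global sections of the sheaf of cocycles. -/
def cocycleSection (hL : VeryAmple E L) (k : ℕ) :
    Spencer.cocycles (lieAlgebra E L) k 1 →ₗ[ℂ]
      fibreSections (closedForms E L k) (⊤ : Opens X) where
  toFun θ := ⟨_, cocycle_mem_closedForms hL θ⟩
  map_add' _ _ := Subtype.ext (funext fun _ => map_add (prolongationEquiv hL k).symm _ _)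
  map_smul' c _ := Subtype.ext (funext fun _ => map_smul (prolongationEquiv hL k).symm c _)

lemma toProlongation_cocycleSection (hL : VeryAmple E L) {k : ℕ}
    (θ : Spencer.cocycles (lieAlgebra E L) k 1) (v w : GlobalSections E L) :
    toProlongation hL (k + 1) ((cocycleSection hL k θ).1 (v, w)) = θ.1 ![v, w] :=
  toProlongation_prolongationEquiv_symm hL _

lemma eq_vec_two {V : Type*} (v : Fin 2 → V) : v = ![v 0, v 1] := by
  funext i; fin_cases i <;> rfl

lemma cocycleSection_surjective (hL : VeryAmple E L) (k : ℕ) :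
    Function.Surjective (cocycleSection hL k) := by
  intro c
  obtain ⟨h1, h2, h3, h4⟩ := mem_closedForms_iff.1 c.2
  let B : GlobalSections E L →ₗ[ℂ] GlobalSections E L →ₗ[ℂ]
      symSections E L (k + 1) (⊤ : Opens X) :=
    LinearMap.mk₂ ℂ (fun v w => c.1 (v, w)) h1 h2
      (fun u v w => by rw [h3, h1, h3 u v, h3 u w, neg_add])
      (fun a v w => by rw [h3, h2, h3 v w]; exact (smul_neg a _).symm)
  have hB : ∀ v w, B v w = c.1 (v, w) := fun v w => rfl
  have hB0 : ∀ v, B v v = 0 := fun v => by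
    -- Sections of `Z` are skew by definition, cochains are alternating; the two agree after
    -- division by 2.
    have h : (2 : ℂ) • B v v = 0 := (two_smul ℂ _).trans (eq_neg_iff_add_eq_zero.1 (h3 v v))
    exact (smul_eq_zero.1 h).resolve_left two_ne_zero
  let θ : Spencer.Cochain (lieAlgebra E L) (k + 1) 2 :=
    alternatingOfBilinear (B.compr₂ (toProlongation hL (k + 1))) fun v => by
      rw [LinearMap.compr₂_apply, hB0, map_zero]
  have hθ : ∀ v w, θ ![v, w] = toProlongation hL (k + 1) (c.1 (v, w)) := fun v w => rfl
  have hθ0 : Spencer.differential (lieAlgebra E L) k 2 θ = 0 := by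
    ext v : 1
    rw [differential_two_apply, hθ, hθ, hθ, contract_toProlongation, contract_toProlongation,
      contract_toProlongation, ← map_add, ← map_add, h4, map_zero]
    rfl
  refine ⟨⟨θ, hθ0⟩, Subtype.ext (funext fun p => ?_)⟩
  apply toProlongation_injective hL (k + 1)
  exact (toProlongation_cocycleSection hL ⟨θ, hθ0⟩ p.1 p.2).trans (hθ p.1 p.2)

/-- A 1-cochain with values in `𝔤^{(k+1)}` is a linear map from `V` to global sections, that is, a
global section of the middle sheaf; under this dictionary the two differentials agree. -/
lemma cocycleSection_mem_range_iff (hL : VeryAmple E L) {k : ℕ}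
    (θ : Spencer.cocycles (lieAlgebra E L) k 1) :
    (∃ β, spencerFamily k ⊤ β = cocycleSection hL k θ) ↔
      θ ∈ Spencer.coboundaries (lieAlgebra E L) k 1 := by
  constructor
  · rintro ⟨β, hβ⟩
    refine ⟨AlternatingMap.ofSubsingleton ℂ (GlobalSections E L) _ (0 : Fin 1)
      (toProlongation hL (k + 2) ∘ₗ familyMap β), ?_⟩
    ext v : 1
    refine (differential_one_apply (lieAlgebra E L) (k + 1) _ v).trans ?_
    change Spencer.contract (lieAlgebra E L) (k + 1) (v 0) (toProlongation hL (k + 2) (β.1 (v 1))) -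
      Spencer.contract (lieAlgebra E L) (k + 1) (v 1) (toProlongation hL (k + 2) (β.1 (v 0))) =
        θ.1 v
    rw [contract_toProlongation, contract_toProlongation, ← map_sub, ← spencerFamily_apply, hβ,
      toProlongation_cocycleSection, ← eq_vec_two v]
  · rintro ⟨η, hη⟩
    let β : GlobalSections E L →ₗ[ℂ] symSections E L (k + 2) (⊤ : Opens X) :=
      (prolongationEquiv hL (k + 1)).symm.toLinearMap ∘ₗ
        (AlternatingMap.ofSubsingleton ℂ (GlobalSections E L) _ (0 : Fin 1)).symm η
    have hβ : ∀ v, toProlongation hL (k + 2) (β v) = η fun _ => v := fun v =>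
      toProlongation_prolongationEquiv_symm hL _
    refine ⟨familyOfMap β, Subtype.ext (funext fun p => ?_)⟩
    apply toProlongation_injective hL (k + 1)
    refine Eq.trans ?_ (toProlongation_cocycleSection hL θ p.1 p.2).symm
    have h := AlternatingMap.congr_fun hη ![p.1, p.2]
    refine Eq.trans ?_ h
    refine Eq.trans ?_ (differential_one_apply (lieAlgebra E L) (k + 1) η ![p.1, p.2]).symm
    change toProlongation hL (k + 1) (contractJet p.1 (k + 1) ⊤ (β p.2) -
      contractJet p.2 (k + 1) ⊤ (β p.1)) = _
    rw [map_sub, ← contract_toProlongation, ← contract_toProlongation, hβ, hβ]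
    rfl

lemma cocycleSection_cocycleAct (hL : VeryAmple E L) {k : ℕ} (D : InfAut E L)
    (θ : Spencer.cocycles (lieAlgebra E L) k 1) :
    cocycleSection hL k (Spencer.cocycleAct (lieAlgebra E L) k 1 (toLie D) θ) =
      closedAct D k ⊤ (cocycleSection hL k θ) := by
  refine Subtype.ext (funext fun p => ?_)
  apply toProlongation_injective hL (k + 1)
  refine (toProlongation_cocycleSection hL _ p.1 p.2).trans ?_
  refine (Spencer.cochainAct_apply (lieAlgebra E L) (k + 1) 2 (toLie D) θ.1 ![p.1, p.2]).trans ?_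
  have h0 : Function.update ![p.1, p.2] 0 (rep D p.1) = ![rep D p.1, p.2] := by
    funext i; fin_cases i <;> rfl
  have h1 : Function.update ![p.1, p.2] 1 (rep D p.2) = ![p.1, rep D p.2] := by
    funext i; fin_cases i <;> rfl
  rw [Fin.sum_univ_two]
  change Spencer.prolongAct (lieAlgebra E L) (k + 1) (toLie D) (θ.1 ![p.1, p.2]) -
    (θ.1 (Function.update ![p.1, p.2] 0 (rep D p.1)) +
      θ.1 (Function.update ![p.1, p.2] 1 (rep D p.2))) =
    toProlongation hL (k + 1) (lieDeriv D (k + 1) ⊤ ((cocycleSection hL k θ).1 (p.1, p.2)) -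
      (cocycleSection hL k θ).1 (rep D p.1, p.2) - (cocycleSection hL k θ).1 (p.1, rep D p.2))
  rw [h0, h1, map_sub, map_sub, ← prolongAct_toProlongation, toProlongation_cocycleSection,
    toProlongation_cocycleSection, toProlongation_cocycleSection, sub_sub]

lemma ker_spencerConnecting_comp (hL : VeryAmple E L) (k : ℕ) :
    LinearMap.ker (spencerConnecting hL k ∘ₗ cocycleSection hL k) =
      Spencer.coboundaries (lieAlgebra E L) k 1 := by
  ext θ
  rw [LinearMap.mem_ker, LinearMap.comp_apply, spencerConnecting_eq_zero_iff,
    cocycleSection_mem_range_iff]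

/-- The map `H^{k+1,2}(𝔤) → H¹(X, L ⊗ ⊙^{k+3} N*)`. -/
def cohomologyConnecting (hL : VeryAmple E L) (k : ℕ) :
    Spencer.Cohomology (lieAlgebra E L) k 1 →ₗ[ℂ] H1 E L (k + 3) :=
  Submodule.liftQ _ (spencerConnecting hL k ∘ₗ cocycleSection hL k)
    (ker_spencerConnecting_comp hL k).ge

lemma cohomologyConnecting_injective (hL : VeryAmple E L) (k : ℕ) :
    Function.Injective (cohomologyConnecting hL k) :=
  LinearMap.ker_eq_bot.1 (Submodule.ker_liftQ_eq_bot' _ _ (ker_spencerConnecting_comp hL k).symm)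

/-- The kernel of the contraction is the image of the connecting map on all of `H⁰(X, Z)`; since
every global section of `Z` is a Spencer cocycle, the cohomology group has the same image. -/
lemma exact_cohomologyConnecting (hL : VeryAmple E L) [FiniteDimensional ℂ (GlobalSections E L)]
    (k : ℕ) :
    Function.Exact (cohomologyConnecting hL k) (H1contract (E := E) (L := L) (k + 2)) := by
  intro h
  rw [H1contract_eq_zero_iff hL]
  constructor
  · rintro ⟨c, rfl⟩
    obtain ⟨θ, rfl⟩ := cocycleSection_surjective hL k c
    exact ⟨Submodule.Quotient.mk θ, rfl⟩
  · rintro ⟨q, rfl⟩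
    obtain ⟨θ, rfl⟩ := Submodule.Quotient.mk_surjective _ q
    exact ⟨cocycleSection hL k θ, rfl⟩

lemma cohomologyConnecting_cohomologyAct (hL : VeryAmple E L) (k : ℕ) (D : InfAut E L)
    (c : Spencer.Cohomology (lieAlgebra E L) k 1) :
    cohomologyConnecting hL k (Spencer.cohomologyAct (lieAlgebra E L) k 1 (toLie D) c) =
      H1act D (k + 3) (cohomologyConnecting hL k c) := by
  obtain ⟨θ, rfl⟩ := Submodule.Quotient.mk_surjective _ c
  change spencerConnecting hL k (cocycleSection hL k
    (Spencer.cocycleAct (lieAlgebra E L) k 1 (toLie D) θ)) =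
      H1act D (k + 3) (spencerConnecting hL k (cocycleSection hL k θ))
  rw [cocycleSection_cocycleAct, spencerConnecting_closedAct]

/-- `contractJet_lieDeriv`, rearranged into a sum of sheaf morphisms and carried over by the
additive functor `H¹`. -/
lemma H1contract_H1act (D : InfAut E L) (m : ℕ) (c : H1 E L (m + 1)) (v : GlobalSections E L) :
    H1contract m (H1act D (m + 1) c) v =
      H1act D m (H1contract m c v) - H1contract m c (rep D v) := by
  rw [eq_sub_iff_add_eq]
  have h : sheafHom (lieDeriv D (m + 1)) (lieDeriv_restrict D (m + 1)) ≫
      sheafHom (contractJet v m) (fun _ _ _ _ => rfl) +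
        sheafHom (contractJet (rep D v) m) (fun _ _ _ _ => rfl) =
      sheafHom (contractJet v m) (fun _ _ _ _ => rfl) ≫
        sheafHom (lieDeriv D m) (lieDeriv_restrict D m) := by
    ext U φ
    exact eq_sub_iff_add_eq.1 (contractJet_lieDeriv D v m U.unop φ)
  have h' := congrArg (fun f => Sheaf.H.map f 1 c) h
  exact (((Sheaf.H.map_add_apply _ _ _).trans
    (congrArg (· + _) (Sheaf.H.map_comp_apply _ _ _))).symm.trans h').trans
      (Sheaf.H.map_comp_apply _ _ _)

end SpencerCohomology

end JetSpencer

end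

/-! ### The main theorem; the index `k` of the exact sequence is shifted by one and starts at 0. -/

theorem theorem3p3 {E : Type v} [NormedAddCommGroup E] [NormedSpace ℂ E] [FiniteDimensional ℂ E]
    {X : Type u} [TopologicalSpace X] [CompactSpace X] [T2Space X] [ChartedSpace E X]
    [IsManifold 𝓘(ℂ, E) ω X]
    {L : X → Type u} [∀ x, AddCommGroup (L x)] [∀ x, Module ℂ (L x)]
    [∀ x, TopologicalSpace (L x)] [TopologicalSpace (TotalSpace ℂ L)] [FiberBundle ℂ L]
    [VectorBundle ℂ ℂ L] [ContMDiffVectorBundle ω ℂ L 𝓘(ℂ, E)]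
    (hX : Homogeneous E X) (hL : VeryAmple E L) :
    -- `V = H⁰(X, L)` is finite-dimensional, so that `W ⊗ V* = Hom(V, W)` for all `W`
    FiniteDimensional ℂ (GlobalSections E L) ∧
    -- the natural map `H⁰(X, L ⊗ ⊙^{k+1} N*) → V ⊗ (V*)^{⊗(k+1)}` is an isomorphism of `𝔤`-modules
    -- onto the prolongation `𝔤^{(k)}`
    (∀ k : ℕ, Function.Injective (toTensor E L (k + 1)) ∧
      LinearMap.range (toTensor E L (k + 1)) = Spencer.prolong (lieAlgebra E L) (k + 1) ∧
      ∀ (D : InfAut E L) (φ : symSections E L (k + 1) ⊤),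
        toTensor E L (k + 1) (lieDeriv D (k + 1) ⊤ φ) =
          Spencer.tensorAct (rep D) (toTensor E L (k + 1) φ)) ∧
    -- the exact sequence of `𝔤`-modules
    -- `0 → H^{k+1,2}(𝔤) → H¹(X, L ⊗ ⊙^{k+3} N*) → H¹(X, L ⊗ ⊙^{k+2} N*) ⊗ V*`
    ∀ k : ℕ, ∃ δ : Spencer.Cohomology (lieAlgebra E L) k 1 →ₗ[ℂ] H1 E L (k + 3),
      Function.Injective δ ∧
      Function.Exact δ (H1contract (E := E) (L := L) (k + 2)) ∧
      (∀ (D : InfAut E L) (c : Spencer.Cohomology (lieAlgebra E L) k 1),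
        δ (Spencer.cohomologyAct (lieAlgebra E L) k 1 (toLie D) c) = H1act D (k + 3) (δ c)) ∧
      ∀ (D : InfAut E L) (c : H1 E L (k + 3)) (v : GlobalSections E L),
        H1contract (k + 2) (H1act D (k + 3) c) v =
          H1act D (k + 2) (H1contract (k + 2) c v) - H1contract (k + 2) c (rep D v) := by
  have hfin := finiteDimensional_globalSections hL.exists_ne_zero
  exact ⟨hfin, fun k => ⟨toTensor_injective hL (k + 1), range_toTensor hL k,
      fun D φ => toTensor_lieDeriv D φ⟩,
    fun k => ⟨cohomologyConnecting hL k, cohomologyConnecting_injective hL k,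
      exact_cohomologyConnecting hL k, cohomologyConnecting_cohomologyAct hL k,
      fun D c v => H1contract_H1act D (k + 2) c v⟩⟩
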